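/- Let $P\subset\mathbb R^2$ be a polygonal element: a compact set whose boundary is a simple closed polygonal line with vertices $a_1,\dots,a_n$ ($n\ge 3$; consecutive edges may be aligned), and which is star-shaped with respect to a ball of radius $\varrho h_P$ for some $\varrho>0$, where $h_P$ is the diameter of $P$. Let $\Psi(P)$ be a finite-dimensional space of functions on $P$ with $\Psi(P)\subset H^1(P)\cap C^0(P)$ and $\Delta\Psi(P)\subset L^2(P)$ (for instance the restrictions to a mesh element $P$ of a global enrichment space). Let $k\ge 1$ and $l=\max\{0,k-2\}$. For an edge $E$ of $P$ let $\mathfrak P_E$ be the $L^2(E)$-orthogonal complement of $\mathbb P_k(E)$ in $\mathbb P_k(E)+\Psi(E)$, where $\Psi(E)=\{\psi|_E:\psi\in\Psi(P)\}$ and $\mathbb P_{-1}=\{0\}$. Let $$B=\{w\in C^0(\partial P): w|_E\in \mathbb P_k(E)+\Psi(E)\ \text{for every edge } E\},$$ $$V_h^k(P)=\{v\in H^1(P):\ \Delta v\in \mathbb P_l(P)+\Delta\Psi(P),\ v|_{\partial P}\in B\},$$ with $v|_{\partial P}$ the trace of $v$. Consider the degrees of freedom * (D1) the values of $v$ at the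 vertices of $P$; * (D2) for every edge $E$, the $L^2(E)$-orthogonal projection of $v|_E$ onto $\mathbb P_{k-2}(E)\oplus\mathfrak P_E$; * (D3) the $L^2(P)$-orthogonal projection of $v$ onto $\mathbb P_l(P)+\Delta\Psi(P)$. Then the trace $v\mapsto v|_{\partial P}$ is a well-defined linear map on $V_h^k(P)$ with values in $B$, and the following hold. 1. (D1)–(D2) are unisolvent for $B$: for all values $m_i\in\mathbb R$ at the vertices and all $r_E\in \mathbb P_{k-2}(E)\oplus\mathfrak P_E$ there is exactly one $w\in B$ with these degrees of freedom. In particular (D1)–(D2) of $v\in V_h^k(P)$ determine $v|_{\partial P}$. 2. (D1)–(D3) uniquely determine a function of $V_h^k(P)$. Moreover, for every $w$ in the trace space $\{v|_{\partial P}:v\in V_h^k(P)\}$ and every $s\in\mathbb P_l(P)+\Delta\Psi(P)$ there is $v\in V_h^k(P)$ whose (D1)–(D2) are those of $w$ and whose (D3) is $s$. 3. If, in addition, $$\int_P\frac{|\psi(x)-\psi(a_i)|^2}{|x-a_i|^2}\,dx<\infty\qquad\text{for every }\psi\in\Psi(P)\text{ and every vertex }a_i$$ (which holds, for example, if every $\psi\in\Psi(P)$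 is Hölder continuous at the vertices of $P$), then the trace space of $V_h^k(P)$ is $B$, so that (D1)–(D2) are unisolvent for the trace space, and (D1)–(D3) are unisolvent for $V_h^k(P)$: for all values $m_i$, $r_E$ as in 1 and all $s\in\mathbb P_l(P)+\Delta\Psi(P)$ there is exactly one $v\in V_h^k(P)$ with these degrees of freedom. -/

import Mathlib

open MeasureTheory Filter Topology Set
open scoped ContDiff Gradient ENNReal

/-! ### Geometry -/

/-- The Euclidean plane. -/
abbrev Plane : Type := EuclideanSpace ℝ (Fin 2)

/-- `P` is a polygonal element with vertices `a 0, …, a (n-1)` (in cyclic order) and edges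
`[a i, a (i+1)]`: a compact set bounded by a simple closed polygonal line, star-shaped with respect
to a ball of radius `ϱ h_P` for some `ϱ > 0`. Consecutive edges may be aligned (hanging nodes). -/
structure IsPolygonalElement {n : ℕ} (P : Set Plane) (a : Polygon Plane n) : Prop where
  three_le : 3 ≤ n
  isCompact : IsCompact P
  frontier_eq : frontier P = a.boundary ℝ
  injective : Function.Injective a.vertices
  simple : ∀ i j, i ≠ j → a.edgeSet ℝ i ∩ a.edgeSet ℝ j ⊆
    {a i, a (finRotate n i)} ∩ {a j, a (finRotate n j)}
  starShaped : ∃ ϱ > 0, ∃ c : Plane,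
    ∀ y ∈ Metric.ball c (ϱ * Metric.diam P), StarConvex ℝ y P

/-- Lebesgue measure on the interior of `P`; `L²(P)` is `Lp ℝ 2 (areaMeasure P)`. -/
noncomputable abbrev areaMeasure (P : Set Plane) : Measure Plane := volume.restrict (interior P)

/-- Arc length on the `i`-th edge, so that
`∫ f ∂(edgeMeasure a i) = |E| ∫₀¹ f (a i + t (a (i+1) - a i)) dt`;
`L²(E)` is `Lp ℝ 2 (edgeMeasure a i)`. -/
noncomputable def edgeMeasure {n : ℕ} (a : Polygon Plane n) (i : Fin n) : Measure Plane :=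
  ENNReal.ofReal (dist (a i) (a (finRotate n i))) •
    (volume.restrict (Icc (0 : ℝ) 1)).map (a.edgePath ℝ i)

/-- Arc length on the boundary of a polygon. -/
noncomputable def boundaryMeasure {n : ℕ} (a : Polygon Plane n) : Measure Plane :=
  ∑ i, edgeMeasure a i

/-! ### Weak derivatives -/

/-- `φ ∈ C_c^∞(D)`. -/
structure IsTestFunction (D : Set Plane) (φ : Plane → ℝ) : Prop where
  smooth : ContDiff ℝ ∞ φ
  compactSupport : HasCompactSupport φ
  support_subset : tsupport φ ⊆ D

/-- `u ∈ H¹(P)` and `G ∈ L²(P)²` is its weak gradient in the interior of `P`. -/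
structure HasWeakGradient (P : Set Plane) (u : Plane → ℝ) (G : Plane → Plane) : Prop where
  memLp : MemLp u 2 (areaMeasure P)
  memLp_grad : MemLp G 2 (areaMeasure P)
  integral_eq : ∀ φ, IsTestFunction (interior P) φ →
    ∫ x in interior P, u x • ∇ φ x = - ∫ x in interior P, φ x • G x

/-- `u ∈ H¹(P)`. -/
def MemH1 (P : Set Plane) (u : Plane → ℝ) : Prop := ∃ G, HasWeakGradient P u G

/-- `u ∈ H¹(P)` and `Δu = f` in the weak sense: `∫_P ∇u · ∇φ = - ∫_P f φ` for all
`φ ∈ C_c^∞`. -/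
def HasWeakLaplacian (P : Set Plane) (u f : Plane → ℝ) : Prop :=
  ∃ G, HasWeakGradient P u G ∧ ∀ φ, IsTestFunction (interior P) φ →
    ∫ x in interior P, inner ℝ (G x) (∇ φ x) = - ∫ x in interior P, f x * φ x

/-! ### Traces -/

/-- The extension by zero to the plane of a function on `∂P`. -/
noncomputable def extendZero {P : Set Plane} (w : C(frontier P, ℝ)) : Plane → ℝ :=
  Function.extend Subtype.val w 0

/-- `v ∈ H¹(P)` has trace `w ∈ C⁰(∂P)`: the pair `(v, w)` is a limit in `H¹(P) × L²(∂P)` of pairs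
`(φ, φ|_∂P)` with `φ` smooth up to the boundary. -/
def HasTrace {n : ℕ} (P : Set Plane) (a : Polygon Plane n) (v : Plane → ℝ)
    (w : C(frontier P, ℝ)) : Prop :=
  ∃ G, HasWeakGradient P v G ∧ ∃ φ : ℕ → Plane → ℝ, (∀ m, ContDiff ℝ ∞ (φ m)) ∧
    Tendsto (fun m => eLpNorm (fun x => φ m x - v x) 2 (areaMeasure P)) atTop (𝓝 0) ∧
    Tendsto (fun m => eLpNorm (fun x => ∇ (φ m) x - G x) 2 (areaMeasure P)) atTop (𝓝 0) ∧
    Tendsto (fun m => eLpNorm (fun x => φ m x - extendZero w x) 2 (boundaryMeasure a))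
      atTop (𝓝 0)

/-! ### Auxiliary facts -/

theorem continuous_gradient {φ : Plane → ℝ} (h : ContDiff ℝ ∞ φ) : Continuous (∇ φ) :=
  (InnerProductSpace.toDual ℝ Plane).symm.continuous.comp (h.continuous_fderiv (by simp))

theorem IsTestFunction.hasCompactSupport_gradient {D : Set Plane} {φ : Plane → ℝ}
    (h : IsTestFunction D φ) : HasCompactSupport (∇ φ) :=
  (h.compactSupport.fderiv (𝕜 := ℝ)).comp_left (map_zero _)

theorem IsTestFunction.memLp {D : Set Plane} {φ : Plane → ℝ} (h : IsTestFunction D φ)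
    (μ : Measure Plane) [IsFiniteMeasureOnCompacts μ] : MemLp φ 2 μ :=
  h.smooth.continuous.memLp_of_hasCompactSupport h.compactSupport

theorem IsTestFunction.memLp_gradient {D : Set Plane} {φ : Plane → ℝ} (h : IsTestFunction D φ)
    (μ : Measure Plane) [IsFiniteMeasureOnCompacts μ] : MemLp (∇ φ) 2 μ :=
  (continuous_gradient h.smooth).memLp_of_hasCompactSupport h.hasCompactSupport_gradient

theorem gradient_smul_add {φ ψ : Plane → ℝ} (hφ : ContDiff ℝ ∞ φ) (hψ : ContDiff ℝ ∞ ψ) (c : ℝ)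
    (x : Plane) : ∇ (fun x => c * φ x + ψ x) x = c • ∇ φ x + ∇ ψ x := by
  have h1 : DifferentiableAt ℝ φ x := (hφ.differentiable (by simp)) x
  have h2 : DifferentiableAt ℝ ψ x := (hψ.differentiable (by simp)) x
  have h3 : DifferentiableAt ℝ (fun x => c * φ x) x := h1.const_mul c
  simp only [gradient]
  rw [fderiv_fun_add h3 h2, fderiv_const_mul h1]
  simp

theorem HasWeakGradient.smul_add {P : Set Plane} {u v : Plane → ℝ} {G H : Plane → Plane}
    (hu : HasWeakGradient P u G) (hv : HasWeakGradient P v H) (c : ℝ) :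
    HasWeakGradient P (fun x => c * u x + v x) (fun x => c • G x + H x) where
  memLp := (hu.memLp.const_mul c).add hv.memLp
  memLp_grad := (hu.memLp_grad.const_smul c).add hv.memLp_grad
  integral_eq φ hφ := by
    have hg := hφ.memLp_gradient (areaMeasure P)
    have hf := hφ.memLp (areaMeasure P)
    have i1 : Integrable (fun x => u x • ∇ φ x) (areaMeasure P) :=
      memLp_one_iff_integrable.1 (hg.smul hu.memLp (p := 2) (q := 2) (r := 1))
    have i2 : Integrable (fun x => v x • ∇ φ x) (areaMeasure P) :=
      memLp_one_iff_integrable.1 (hg.smul hv.memLp (p := 2) (q := 2) (r := 1))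
    have i3 : Integrable (fun x => φ x • G x) (areaMeasure P) :=
      memLp_one_iff_integrable.1 (hu.memLp_grad.smul hf (p := 2) (q := 2) (r := 1))
    have i4 : Integrable (fun x => φ x • H x) (areaMeasure P) :=
      memLp_one_iff_integrable.1 (hv.memLp_grad.smul hf (p := 2) (q := 2) (r := 1))
    have e1 : ∀ x, (c * u x + v x) • ∇ φ x = c • (u x • ∇ φ x) + v x • ∇ φ x := fun x => by module
    have e2 : ∀ x, φ x • (c • G x + H x) = c • (φ x • G x) + φ x • H x := fun x => by module
    have j1 : Integrable (fun x => c • (u x • ∇ φ x)) (areaMeasure P) := i1.smul c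
    have j3 : Integrable (fun x => c • (φ x • G x)) (areaMeasure P) := i3.smul c
    simp only [e1, e2]
    rw [integral_add j1 i2, integral_add j3 i4, integral_smul, integral_smul,
      hu.integral_eq φ hφ, hv.integral_eq φ hφ]
    module

theorem HasWeakGradient.congr {P : Set Plane} {u v : Plane → ℝ} {G : Plane → Plane}
    (hu : HasWeakGradient P u G) (h : u =ᵐ[areaMeasure P] v) : HasWeakGradient P v G where
  memLp := (memLp_congr_ae h).1 hu.memLp
  memLp_grad := hu.memLp_grad
  integral_eq φ hφ := by
    rw [← hu.integral_eq φ hφ]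
    refine integral_congr_ae (h.symm.mono fun x hx => ?_)
    simp only [hx]

theorem hasWeakGradient_zero (P : Set Plane) : HasWeakGradient P (fun _ => 0) (fun _ => 0) where
  memLp := MemLp.zero'
  memLp_grad := MemLp.zero'
  integral_eq φ hφ := by simp

theorem HasWeakGradient.unique {P : Set Plane} {u : Plane → ℝ} {G H : Plane → Plane}
    (hG : HasWeakGradient P u G) (hH : HasWeakGradient P u H) : G =ᵐ[areaMeasure P] H := by
  have hd := hG.smul_add hH (-1)
  have h0 : ∀ᵐ x, x ∈ interior P → (-1 : ℝ) • G x + H x = 0 := by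
    refine isOpen_interior.ae_eq_zero_of_integral_contDiff_smul_eq_zero ?_ ?_
    · have : LocallyIntegrable (fun x => (-1 : ℝ) • G x + H x) (areaMeasure P) :=
        hd.memLp_grad.locallyIntegrable (by norm_num)
      exact locallyIntegrableOn_of_locallyIntegrable_restrict this
    · intro g hg hc hs
      have := hd.integral_eq g ⟨hg, hc, hs⟩
      simp only [neg_mul, one_mul, neg_add_cancel, zero_smul, integral_zero] at this
      rw [← setIntegral_eq_integral_of_forall_compl_eq_zero (s := interior P)]
      · exact neg_eq_zero.1 this.symm
      · intro x hx
        rw [image_eq_zero_of_notMem_tsupport fun h => hx (hs h), zero_smul]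
  rw [Filter.EventuallyEq, ae_restrict_iff' isOpen_interior.measurableSet]
  filter_upwards [h0] with x hx hxP
  have := hx hxP
  rw [neg_one_smul, neg_add_eq_zero] at this
  exact this

theorem integrable_inner_of_memLp {μ : Measure Plane} {G H : Plane → Plane} (hG : MemLp G 2 μ)
    (hH : MemLp H 2 μ) : Integrable (fun x => inner ℝ (G x) (H x)) μ :=
  memLp_one_iff_integrable.1 <| MemLp.of_le
    (memLp_one_iff_integrable.2 (hG.norm.integrable_mul hH.norm)) (hG.1.inner hH.1) <|
    .of_forall fun x => by
      simpa using (norm_inner_le_norm (𝕜 := ℝ) (G x) (H x))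

theorem HasWeakLaplacian.congr {P : Set Plane} {u v f g : Plane → ℝ}
    (hu : HasWeakLaplacian P u f) (h : u =ᵐ[areaMeasure P] v) (hf : f =ᵐ[areaMeasure P] g) :
    HasWeakLaplacian P v g := by
  obtain ⟨G, hG, hL⟩ := hu
  refine ⟨G, hG.congr h, fun φ hφ => ?_⟩
  rw [hL φ hφ]
  congr 1
  exact integral_congr_ae (hf.mono fun x hx => by simp only [hx])

theorem HasWeakLaplacian.smul_add {P : Set Plane} {u v f g : Plane → ℝ}
    (hu : HasWeakLaplacian P u f) (hv : HasWeakLaplacian P v g)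
    (hf : MemLp f 2 (areaMeasure P)) (hg : MemLp g 2 (areaMeasure P)) (c : ℝ) :
    HasWeakLaplacian P (fun x => c * u x + v x) (fun x => c * f x + g x) := by
  obtain ⟨G, hG, hGL⟩ := hu
  obtain ⟨H, hH, hHL⟩ := hv
  refine ⟨_, hG.smul_add hH c, fun φ hφ => ?_⟩
  have hφg := hφ.memLp_gradient (areaMeasure P)
  have hφm := hφ.memLp (areaMeasure P)
  have i1 : Integrable (fun x => inner ℝ (G x) (∇ φ x)) (areaMeasure P) :=
    integrable_inner_of_memLp hG.memLp_grad hφg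
  have i2 : Integrable (fun x => inner ℝ (H x) (∇ φ x)) (areaMeasure P) :=
    integrable_inner_of_memLp hH.memLp_grad hφg
  have i3 : Integrable (fun x => f x * φ x) (areaMeasure P) := hf.integrable_mul hφm
  have i4 : Integrable (fun x => g x * φ x) (areaMeasure P) := hg.integrable_mul hφm
  simp only [inner_add_left, real_inner_smul_left, add_mul, mul_assoc]
  rw [integral_add (i1.const_mul c) i2, integral_add (i3.const_mul c) i4, integral_const_mul,
    integral_const_mul, hGL φ hφ, hHL φ hφ]
  ring

theorem HasWeakLaplacian.eq_zero {P : Set Plane} {f : Plane → ℝ}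
    (h : HasWeakLaplacian P (fun _ => 0) f) (hf : MemLp f 2 (areaMeasure P)) :
    f =ᵐ[areaMeasure P] 0 := by
  obtain ⟨G, hG, hL⟩ := h
  have hG0 := hG.unique (hasWeakGradient_zero P)
  have h0 : ∀ᵐ x, x ∈ interior P → f x = 0 := by
    refine isOpen_interior.ae_eq_zero_of_integral_contDiff_smul_eq_zero ?_ ?_
    · exact locallyIntegrableOn_of_locallyIntegrable_restrict (hf.locallyIntegrable (by norm_num))
    · intro g hg hc hs
      have h1 := hL g ⟨hg, hc, hs⟩
      have h2 : ∫ x in interior P, inner ℝ (G x) (∇ g x) = 0 := by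
        rw [← integral_zero Plane ℝ]
        refine integral_congr_ae (hG0.mono fun x hx => ?_)
        simp only [hx, inner_zero_left]
      rw [← setIntegral_eq_integral_of_forall_compl_eq_zero (s := interior P)]
      · rw [h2] at h1
        simpa [mul_comm] using h1.symm
      · intro x hx
        rw [image_eq_zero_of_notMem_tsupport fun h => hx (hs h), zero_smul]
  rw [Filter.EventuallyEq, ae_restrict_iff' isOpen_interior.measurableSet]
  exact h0

instance {n : ℕ} (a : Polygon Plane n) (i : Fin n) : IsFiniteMeasure (edgeMeasure a i) := by
  unfold edgeMeasure
  have : IsFiniteMeasure ((volume.restrict (Icc (0 : ℝ) 1)).map (a.edgePath ℝ i)) := inferInstance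
  exact Measure.smul_finite _ ENNReal.ofReal_ne_top

theorem measurable_extendZero {P : Set Plane} (w : C(frontier P, ℝ)) :
    Measurable (extendZero w) :=
  (MeasurableEmbedding.subtype_coe isClosed_frontier.measurableSet).measurable_extend
    w.continuous.measurable measurable_zero

theorem extendZero_apply {P : Set Plane} (w : C(frontier P, ℝ)) (x : frontier P) :
    extendZero w x = w x :=
  Subtype.val_injective.extend_apply _ _ _

theorem extendZero_apply_of_notMem {P : Set Plane} (w : C(frontier P, ℝ)) {x : Plane}
    (hx : x ∉ frontier P) : extendZero w x = 0 := by
  rw [extendZero, Function.extend_apply' _ _ _ (by rintro ⟨y, rfl⟩; exact hx y.2)]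
  rfl

theorem extendZero_smul_add {P : Set Plane} (c : ℝ) (w z : C(frontier P, ℝ)) (x : Plane) :
    extendZero (c • w + z) x = c * extendZero w x + extendZero z x := by
  by_cases hx : x ∈ frontier P
  · have h := fun w : C(frontier P, ℝ) => extendZero_apply w ⟨x, hx⟩
    simp only at h
    simp [h]
  · simp [extendZero_apply_of_notMem _ hx]

theorem ae_mem_edgeSet {n : ℕ} (a : Polygon Plane n) (i : Fin n) :
    ∀ᵐ x ∂(edgeMeasure a i), x ∈ a.edgeSet ℝ i := by
  have hcont : Continuous (a.edgePath ℝ i) := (a.edgePath ℝ i).continuous_of_finiteDimensional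
  have hc : IsCompact (a.edgeSet ℝ i) := by
    rw [a.edgeSet_eq_image_edgePath ℝ]
    exact isCompact_Icc.image hcont
  refine Measure.ae_smul_measure ?_ _
  refine (ae_map_iff hcont.aemeasurable (p := fun x => x ∈ a.edgeSet ℝ i) hc.measurableSet).2 ?_
  filter_upwards [ae_restrict_mem measurableSet_Icc] with t ht
  rw [a.edgeSet_eq_image_edgePath ℝ]
  exact mem_image_of_mem _ ht

theorem memLp_extendZero {n : ℕ} {P : Set Plane} (a : Polygon Plane n) (i : Fin n)
    (w : C(frontier P, ℝ)) : MemLp (extendZero w) 2 (edgeMeasure a i) := by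
  have hcont : Continuous (a.edgePath ℝ i) := (a.edgePath ℝ i).continuous_of_finiteDimensional
  have hc : IsCompact (a.edgeSet ℝ i) := by
    rw [a.edgeSet_eq_image_edgePath ℝ]
    exact isCompact_Icc.image hcont
  have hK : IsCompact (Subtype.val ⁻¹' (a.edgeSet ℝ i) : Set (frontier P)) :=
    isClosed_frontier.isClosedEmbedding_subtypeVal.isCompact_preimage hc
  obtain ⟨C, hC⟩ := hK.exists_bound_of_continuousOn w.continuous.continuousOn
  refine MemLp.of_bound (measurable_extendZero w).aestronglyMeasurable (max C 0) ?_
  filter_upwards [ae_mem_edgeSet a i] with x hx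
  by_cases hxP : x ∈ frontier P
  · have := extendZero_apply w ⟨x, hxP⟩
    simp only at this
    rw [this]
    exact (hC ⟨x, hxP⟩ hx).trans (le_max_left _ _)
  · rw [extendZero_apply_of_notMem w hxP, norm_zero]
    exact le_max_right _ _

theorem HasTrace.congr {n : ℕ} {P : Set Plane} {a : Polygon Plane n} {u v : Plane → ℝ}
    {w : C(frontier P, ℝ)} (hu : HasTrace P a u w) (h : u =ᵐ[areaMeasure P] v) :
    HasTrace P a v w := by
  obtain ⟨G, hG, φ, hφ, h1, h2, h3⟩ := hu
  refine ⟨G, hG.congr h, φ, hφ, ?_, h2, h3⟩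
  refine h1.congr fun m => eLpNorm_congr_ae ?_
  filter_upwards [h] with x hx
  rw [hx]

theorem tendsto_eLpNorm_smul_add {F : Type*} [NormedAddCommGroup F] [NormedSpace ℝ F]
    {μ : Measure Plane} {f g : ℕ → Plane → F} (hf : ∀ m, AEStronglyMeasurable (f m) μ)
    (hg : ∀ m, AEStronglyMeasurable (g m) μ)
    (h1 : Tendsto (fun m => eLpNorm (f m) 2 μ) atTop (𝓝 0))
    (h2 : Tendsto (fun m => eLpNorm (g m) 2 μ) atTop (𝓝 0)) (c : ℝ) :
    Tendsto (fun m => eLpNorm (fun x => c • f m x + g m x) 2 μ) atTop (𝓝 0) := by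
  have h3 : Tendsto (fun m => ‖c‖ₑ * eLpNorm (f m) 2 μ + eLpNorm (g m) 2 μ) atTop (𝓝 0) := by
    simpa using (ENNReal.Tendsto.const_mul h1 (Or.inr enorm_ne_top)).add h2
  refine tendsto_of_tendsto_of_tendsto_of_le_of_le tendsto_const_nhds h3
    (fun _ => zero_le) fun m => ?_
  refine (eLpNorm_add_le ((hf m).const_smul c) (hg m) (by norm_num)).trans ?_
  rw [eLpNorm_const_smul]

theorem HasTrace.smul_add {n : ℕ} {P : Set Plane} {a : Polygon Plane n} {u v : Plane → ℝ}
    {w z : C(frontier P, ℝ)} (hu : HasTrace P a u w) (hv : HasTrace P a v z) (c : ℝ) :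
    HasTrace P a (fun x => c * u x + v x) (c • w + z) := by
  obtain ⟨G, hG, φ, hφ, h1, h2, h3⟩ := hu
  obtain ⟨H, hH, ψ, hψ, k1, k2, k3⟩ := hv
  refine ⟨_, hG.smul_add hH c, fun m x => c * φ m x + ψ m x,
    fun m => (contDiff_const.mul (hφ m)).add (hψ m), ?_, ?_, ?_⟩
  · refine (tendsto_eLpNorm_smul_add
      (fun m => (hφ m).continuous.aestronglyMeasurable.sub hG.memLp.1)
      (fun m => (hψ m).continuous.aestronglyMeasurable.sub hH.memLp.1) h1 k1 c).congr fun m => ?_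
    congr 1
    ext x
    simp only [smul_eq_mul, Pi.sub_apply]
    ring
  · refine (tendsto_eLpNorm_smul_add
      (fun m => (continuous_gradient (hφ m)).aestronglyMeasurable.sub hG.memLp_grad.1)
      (fun m => (continuous_gradient (hψ m)).aestronglyMeasurable.sub hH.memLp_grad.1)
      h2 k2 c).congr fun m => ?_
    congr 1
    funext x
    simp only [gradient_smul_add (hφ m) (hψ m) c x, Pi.sub_apply]
    module
  · refine (tendsto_eLpNorm_smul_add
      (fun m => (hφ m).continuous.aestronglyMeasurable.sub
        (measurable_extendZero w).aestronglyMeasurable)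
      (fun m => (hψ m).continuous.aestronglyMeasurable.sub
        (measurable_extendZero z).aestronglyMeasurable) h3 k3 c).congr fun m => ?_
    congr 1
    ext x
    simp only [smul_eq_mul, extendZero_smul_add, Pi.sub_apply]
    ring

theorem hasTrace_zero {n : ℕ} (P : Set Plane) (a : Polygon Plane n) :
    HasTrace P a (fun _ => 0) 0 := by
  have h0 : ∀ x, extendZero (0 : C(frontier P, ℝ)) x = 0 := fun x => by
    simpa using extendZero_smul_add (-1) (0 : C(frontier P, ℝ)) 0 x
  have hg : ∇ (fun _ : Plane => (0 : ℝ)) = fun _ => 0 := by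
    funext x
    simp [gradient]
  refine ⟨_, hasWeakGradient_zero P, fun _ _ => 0, fun _ => contDiff_const, ?_, ?_, ?_⟩ <;>
    simp [h0, hg, eLpNorm_zero']

/-- The range of a linear relation with finite-dimensional domain in which `0` is only related
to `0` is finite-dimensional. -/
theorem finiteDimensional_map_snd {V W : Type*} [AddCommGroup V] [Module ℝ V] [AddCommGroup W]
    [Module ℝ W] (S : Submodule ℝ V) [FiniteDimensional ℝ S] (R : Submodule ℝ (V × W))
    (h1 : ∀ p ∈ R, p.1 ∈ S) (h2 : ∀ w, (0, w) ∈ R → w = 0) :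
    FiniteDimensional ℝ (R.map (LinearMap.snd ℝ V W)) := by
  let f : R →ₗ[ℝ] S :=
    ((LinearMap.fst ℝ V W).comp R.subtype).codRestrict S fun p => h1 p.1 p.2
  have hf : Function.Injective f := by
    rw [← LinearMap.ker_eq_bot, LinearMap.ker_eq_bot']
    rintro ⟨⟨v, w⟩, hp⟩ hfp
    have hv : v = 0 := congrArg Subtype.val hfp
    subst hv
    have := h2 w hp
    subst this
    rfl
  have : FiniteDimensional ℝ R := FiniteDimensional.of_injective f hf
  infer_instance

/-! ### Local spaces -/

/-- Polynomial functions on the plane of total degree at most `d`; `{0}` if `d < 0`. -/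
noncomputable def polySpace (d : ℤ) : Submodule ℝ (Plane → ℝ) :=
  if d < 0 then ⊥ else
    (MvPolynomial.restrictTotalDegree (Fin 2) ℝ d.toNat).map
      (LinearMap.pi fun x : Plane => (MvPolynomial.aeval (R := ℝ) fun i => x i).toLinearMap)

/-- The relation `f` is the class of `g ∈ S` in `L²(μ)`. -/
def classRel (μ : Measure Plane) (S : Submodule ℝ (Plane → ℝ)) :
    Submodule ℝ ((Plane → ℝ) × Lp ℝ 2 μ) where
  carrier := {p | p.1 ∈ S ∧ p.2 =ᵐ[μ] p.1}
  zero_mem' := ⟨S.zero_mem, Lp.coeFn_zero _ _ _⟩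
  add_mem' := fun hp hq => ⟨S.add_mem hp.1 hq.1, (Lp.coeFn_add _ _).trans (hp.2.add hq.2)⟩
  smul_mem' := fun c _ hp => ⟨S.smul_mem c hp.1, (Lp.coeFn_smul _ _).trans (hp.2.const_smul c)⟩

/-- The subspace of `L²(μ)` of the classes of the (square-integrable) functions in `S`. -/
noncomputable def classSpace (μ : Measure Plane) (S : Submodule ℝ (Plane → ℝ)) :
    Submodule ℝ (Lp ℝ 2 μ) := (classRel μ S).map (LinearMap.snd ℝ _ _)

/-- The relation `f = Δψ` in `P`, with `ψ ∈ Ψ` in `H¹(P)` and `f ∈ L²(P)`. -/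
def laplacianRel (P : Set Plane) (Ψ : Submodule ℝ (Plane → ℝ)) :
    Submodule ℝ ((Plane → ℝ) × Lp ℝ 2 (areaMeasure P)) where
  carrier := {p | p.1 ∈ Ψ ∧ HasWeakLaplacian P p.1 p.2}
  zero_mem' := by
    refine ⟨Ψ.zero_mem, HasWeakLaplacian.congr
      ⟨_, hasWeakGradient_zero P, fun φ hφ => ?_⟩ (f := 0) ae_eq_rfl (Lp.coeFn_zero _ _ _).symm⟩
    simp
  add_mem' := by
    rintro p q ⟨hp, hpL⟩ ⟨hq, hqL⟩
    refine ⟨Ψ.add_mem hp hq,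
      (hpL.smul_add hqL (Lp.memLp _) (Lp.memLp _) 1).congr (.of_forall fun x => ?_) ?_⟩
    · simp
    · filter_upwards [Lp.coeFn_add p.2 q.2] with x hx
      rw [one_mul]
      exact hx.symm
  smul_mem' := by
    rintro c p ⟨hp, hpL⟩
    have h0 : HasWeakLaplacian P (fun _ => 0) (fun _ => 0) :=
      ⟨_, hasWeakGradient_zero P, fun φ hφ => by simp⟩
    refine ⟨Ψ.smul_mem c hp,
      (hpL.smul_add h0 (Lp.memLp _) MemLp.zero' c).congr (.of_forall fun x => ?_) ?_⟩
    · simp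
    · filter_upwards [Lp.coeFn_smul c p.2] with x hx
      simp [hx]

/-- The space `ΔΨ(P) ⊆ L²(P)`. -/
noncomputable def laplacianSpace (P : Set Plane) (Ψ : Submodule ℝ (Plane → ℝ)) :
    Submodule ℝ (Lp ℝ 2 (areaMeasure P)) := (laplacianRel P Ψ).map (LinearMap.snd ℝ _ _)

/-- The space `P_l(P) + ΔΨ(P) ⊆ L²(P)`, where `l = max {0, k - 2}`. -/
noncomputable def elementMomentSpace (P : Set Plane) (k : ℕ) (Ψ : Submodule ℝ (Plane → ℝ)) :
    Submodule ℝ (Lp ℝ 2 (areaMeasure P)) :=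
  classSpace (areaMeasure P) (polySpace (max 0 ((k : ℤ) - 2))) ⊔ laplacianSpace P Ψ

/-- The space `𝔓_E`: the `L²(E)`-orthogonal complement of `P_k(E)` in `P_k(E) + Ψ(E)`. -/
noncomputable def edgeSingularSpace {n : ℕ} (a : Polygon Plane n) (k : ℕ)
    (Ψ : Submodule ℝ (Plane → ℝ)) (i : Fin n) : Submodule ℝ (Lp ℝ 2 (edgeMeasure a i)) :=
  (classSpace (edgeMeasure a i) (polySpace k))ᗮ ⊓ classSpace (edgeMeasure a i) (polySpace k ⊔ Ψ)

/-- The space `P_{k-2}(E) ⊕ 𝔓_E ⊆ L²(E)`. -/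
noncomputable def edgeMomentSpace {n : ℕ} (a : Polygon Plane n) (k : ℕ)
    (Ψ : Submodule ℝ (Plane → ℝ)) (i : Fin n) : Submodule ℝ (Lp ℝ 2 (edgeMeasure a i)) :=
  classSpace (edgeMeasure a i) (polySpace ((k : ℤ) - 2)) ⊔ edgeSingularSpace a k Ψ i

/-- The continuous functions `w` on `∂P` with `w|_E ∈ P_k(E) + Ψ(E)` for every edge `E`. -/
def boundarySpace {n : ℕ} (P : Set Plane) (a : Polygon Plane n) (k : ℕ)
    (Ψ : Submodule ℝ (Plane → ℝ)) : Submodule ℝ C(frontier P, ℝ) where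
  carrier := {w | ∀ i, ∃ g ∈ polySpace k ⊔ Ψ, ∀ x : frontier P, x.1 ∈ a.edgeSet ℝ i → w x = g x}
  zero_mem' := fun _ => ⟨0, Submodule.zero_mem _, fun _ _ => rfl⟩
  add_mem' := fun {w z} hw hz i => by
    obtain ⟨g, hg, hgw⟩ := hw i
    obtain ⟨h, hh, hhz⟩ := hz i
    exact ⟨g + h, Submodule.add_mem _ hg hh, fun x hx => by simp [hgw x hx, hhz x hx]⟩
  smul_mem' := fun c w hw i => by
    obtain ⟨g, hg, hgw⟩ := hw i
    exact ⟨c • g, Submodule.smul_mem _ c hg, fun x hx => by simp [hgw x hx]⟩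

/-- The local enriched virtual element space `V_h^k(P)`: the `v ∈ H¹(P)` with
`Δv ∈ P_l(P) + ΔΨ(P)`, `v|_∂P ∈ C⁰(∂P)` and `v|_E ∈ P_k(E) + Ψ(E)` for every edge `E`. -/
def virtualSpace {n : ℕ} (P : Set Plane) (a : Polygon Plane n) (k : ℕ)
    (Ψ : Submodule ℝ (Plane → ℝ)) : Submodule ℝ (Lp ℝ 2 (areaMeasure P)) where
  carrier := {v | (∃ f ∈ elementMomentSpace P k Ψ, HasWeakLaplacian P v f) ∧
    ∃ w ∈ boundarySpace P a k Ψ, HasTrace P a v w}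
  zero_mem' := by
    have hz := (Lp.coeFn_zero ℝ 2 (areaMeasure P)).symm
    refine ⟨⟨0, Submodule.zero_mem _, HasWeakLaplacian.congr
      ⟨_, hasWeakGradient_zero P, fun φ hφ => ?_⟩ (f := 0) hz hz⟩,
      0, Submodule.zero_mem _, (hasTrace_zero P a).congr hz⟩
    simp
  add_mem' := by
    rintro u v ⟨⟨f, hf, huf⟩, w, hw, huw⟩ ⟨⟨g, hg, hvg⟩, z, hz, hvz⟩
    refine ⟨⟨f + g, Submodule.add_mem _ hf hg,
      (huf.smul_add hvg (Lp.memLp _) (Lp.memLp _) 1).congr ?_ ?_⟩,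
      w + z, Submodule.add_mem _ hw hz, ?_⟩
    · filter_upwards [Lp.coeFn_add u v] with x hx
      rw [one_mul]
      exact hx.symm
    · filter_upwards [Lp.coeFn_add f g] with x hx
      rw [one_mul]
      exact hx.symm
    · have := huw.smul_add hvz 1
      rw [one_smul] at this
      refine this.congr ?_
      filter_upwards [Lp.coeFn_add u v] with x hx
      rw [one_mul]
      exact hx.symm
  smul_mem' := by
    rintro c u ⟨⟨f, hf, huf⟩, w, hw, huw⟩
    have h0 : HasWeakLaplacian P (fun _ => 0) (fun _ => 0) :=
      ⟨_, hasWeakGradient_zero P, fun φ hφ => by simp⟩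
    refine ⟨⟨c • f, Submodule.smul_mem _ c hf,
      (huf.smul_add h0 (Lp.memLp _) MemLp.zero' c).congr ?_ ?_⟩,
      c • w, Submodule.smul_mem _ c hw, ?_⟩
    · filter_upwards [Lp.coeFn_smul c u] with x hx
      simp [hx]
    · filter_upwards [Lp.coeFn_smul c f] with x hx
      simp [hx]
    · have := huw.smul_add (hasTrace_zero P a) c
      rw [add_zero] at this
      refine this.congr ?_
      filter_upwards [Lp.coeFn_smul c u] with x hx
      simp [hx]

instance (d : ℤ) : FiniteDimensional ℝ (polySpace d) := by
  by_cases h : d < 0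
  · rw [polySpace, if_pos h]
    infer_instance
  · rw [polySpace, if_neg h]
    infer_instance

instance (μ : Measure Plane) (S : Submodule ℝ (Plane → ℝ)) [FiniteDimensional ℝ S] :
    FiniteDimensional ℝ (classSpace μ S) :=
  finiteDimensional_map_snd S _ (fun _ hp => hp.1) fun _ hw =>
    (Lp.eq_zero_iff_ae_eq_zero).2 hw.2

instance (P : Set Plane) (Ψ : Submodule ℝ (Plane → ℝ)) [FiniteDimensional ℝ Ψ] :
    FiniteDimensional ℝ (laplacianSpace P Ψ) :=
  finiteDimensional_map_snd Ψ _ (fun _ hp => hp.1) fun _ hw =>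
    (Lp.eq_zero_iff_ae_eq_zero).2 (HasWeakLaplacian.eq_zero hw.2 (Lp.memLp _))

instance (P : Set Plane) (k : ℕ) (Ψ : Submodule ℝ (Plane → ℝ)) [FiniteDimensional ℝ Ψ] :
    FiniteDimensional ℝ (elementMomentSpace P k Ψ) := by
  unfold elementMomentSpace
  infer_instance

instance {n : ℕ} (a : Polygon Plane n) (k : ℕ) (Ψ : Submodule ℝ (Plane → ℝ))
    [FiniteDimensional ℝ Ψ] (i : Fin n) : FiniteDimensional ℝ (edgeMomentSpace a k Ψ i) := by
  unfold edgeMomentSpace edgeSingularSpace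
  infer_instance

instance (P : Set Plane) (k : ℕ) (Ψ : Submodule ℝ (Plane → ℝ)) [FiniteDimensional ℝ Ψ] :
    (elementMomentSpace P k Ψ).HasOrthogonalProjection :=
  have : CompleteSpace (elementMomentSpace P k Ψ) := FiniteDimensional.complete ℝ _
  inferInstance

instance {n : ℕ} (a : Polygon Plane n) (k : ℕ) (Ψ : Submodule ℝ (Plane → ℝ))
    [FiniteDimensional ℝ Ψ] (i : Fin n) : (edgeMomentSpace a k Ψ i).HasOrthogonalProjection :=
  have : CompleteSpace (edgeMomentSpace a k Ψ i) := FiniteDimensional.complete ℝ _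
  inferInstance

/-! ### Degrees of freedom -/

/-- The class in `L²(E)` of the restriction `w|_E` of `w ∈ C⁰(∂P)`. -/
noncomputable def edgeClass {n : ℕ} {P : Set Plane} (a : Polygon Plane n) (i : Fin n) :
    C(frontier P, ℝ) →ₗ[ℝ] Lp ℝ 2 (edgeMeasure a i) where
  toFun w := (memLp_extendZero a i w).toLp
  map_add' w z := by
    rw [← MemLp.toLp_add]
    congr 1
    funext x
    simpa using extendZero_smul_add 1 w z x
  map_smul' c w := by
    rw [RingHom.id_apply, ← MemLp.toLp_const_smul]
    congr 1
    funext x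
    have h0 : extendZero (0 : C(frontier P, ℝ)) x = 0 := by
      simpa using extendZero_smul_add (-1) (0 : C(frontier P, ℝ)) 0 x
    simpa [h0] using extendZero_smul_add c w 0 x

/-- The boundary degrees of freedom of `w ∈ C⁰(∂P)`: the values at the vertices, and for every
edge `E` the `L²(E)`-orthogonal projection of `w|_E` onto `P_{k-2}(E) ⊕ 𝔓_E`. -/
noncomputable def boundaryDofs {n : ℕ} (P : Set Plane) (a : Polygon Plane n) (k : ℕ)
    (Ψ : Submodule ℝ (Plane → ℝ)) [FiniteDimensional ℝ Ψ] :
    C(frontier P, ℝ) →ₗ[ℝ] (Fin n → ℝ) × (∀ i, edgeMomentSpace a k Ψ i) :=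
  LinearMap.prod
    { toFun := fun w i => extendZero w (a i)
      map_add' := fun w z => funext fun i => by simpa using extendZero_smul_add 1 w z (a i)
      map_smul' := fun c w => funext fun i => by
        have h0 : extendZero (0 : C(frontier P, ℝ)) (a i) = 0 := by
          simpa using extendZero_smul_add (-1) (0 : C(frontier P, ℝ)) 0 (a i)
        simpa [h0] using extendZero_smul_add c w 0 (a i) }
    (LinearMap.pi fun i =>
      (edgeMomentSpace a k Ψ i).orthogonalProjectionOnto.toLinearMap ∘ₗ edgeClass a i)

/-- The degrees of freedom of a function `v` on `P` with trace `w`: the boundary degrees of freedom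
of `w` and the `L²(P)`-orthogonal projection of `v` onto `P_l(P) + ΔΨ(P)`. -/
noncomputable def dofs {n : ℕ} (P : Set Plane) (a : Polygon Plane n) (k : ℕ)
    (Ψ : Submodule ℝ (Plane → ℝ)) [FiniteDimensional ℝ Ψ] :
    Lp ℝ 2 (areaMeasure P) × C(frontier P, ℝ) →ₗ[ℝ]
      ((Fin n → ℝ) × (∀ i, edgeMomentSpace a k Ψ i)) × elementMomentSpace P k Ψ :=
  LinearMap.prod (boundaryDofs P a k Ψ ∘ₗ LinearMap.snd ℝ _ _)
    ((elementMomentSpace P k Ψ).orthogonalProjectionOnto.toLinearMap ∘ₗ LinearMap.fst ℝ _ _)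

/-- `∫_P |ψ(x) - ψ(a)|² / |x - a|² dx < ∞` for every `ψ ∈ Ψ` and every vertex `a` of `P`. -/
def VertexRegular {n : ℕ} (P : Set Plane) (a : Polygon Plane n)
    (Ψ : Submodule ℝ (Plane → ℝ)) : Prop :=
  ∀ ψ ∈ Ψ, ∀ i, MemLp (fun x => (ψ x - ψ (a i)) / dist x (a i)) 2 (areaMeasure P)

/-! The problem splits into an edge-by-edge question on the boundary and a zero-trace question
inside, joined by the trace.

Boundary. On an edge `E`, let the moments against `P_{k-2}(E) ⊕ 𝔓_E` and both end values of `w`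
vanish. The component of `w` orthogonal to `P_k(E)` lies in `𝔓_E`, so it is orthogonal to itself and
`w` is a polynomial. Since it vanishes at the ends, it is `t (1 - t) q` with `q` of degree at most
`k - 2`, and testing with `q` gives `q = 0`. The same positive form `∫ t (1 - t) q q'` yields
polynomials with prescribed end values and moments, and these correct the singular part
(`boundaryDofs_injOn`, `boundaryDofs_surjOn`).

Interior. Put `M = P_l(P) + ΔΨ(P)`. If `v` has zero trace, `Δv = f ∈ M` and `v ⊥ M`, then `∫ |∇v|² =
-∫ f v = 0`, so `v = 0`. For existence let `S` solve `Δu = f` with zero boundary values, by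
Lax–Milgram. By the same identity, `f ↦ Π_M (S f)` is an injective endomorphism of the
finite-dimensional space `M`, hence onto.

Analysis. The triangles spanned by a star centre and the edges cover `P`. Integrating along parallel
segments in each triangle gives a weighted trace inequality (hence uniqueness of traces), Poincaré's
inequality, and the bound `‖v‖ ≤ C δ ‖∇v‖` on a strip of depth `δ` for zero trace. The factor `δ`
absorbs the gradient `O(1/δ)` of a cutoff, so zero-trace functions are limits of test functions
(`HasTrace.isTestLimit`), which justifies the energy identity.

Trace space. Under the vertex condition every `w ∈ B` lifts to `H¹(P) ∩ C⁰(P)`. After subtracting a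
smooth interpolant of the vertex values, the function on each edge comes from some `g` on `P`
vanishing at both ends with `g / |x - a|` square integrable. Such a `g` may be multiplied by angular
cutoffs whose gradient is `O(1/|x - a|)`, which removes it from the other edges. The trace of the
lift is its restriction, by contraction towards the centre and mollification. Subtracting a
zero-trace function with the same Dirichlet products makes the lift harmonic. -/

/-! ### Geometry of star-shaped polygons -/

/-- `P` is star-shaped with respect to the ball of radius `r > 0` around `c`. -/
structure IsStarCenter (P : Set Plane) (c : Plane) (r : ℝ) : Prop where
  pos : 0 < r
  starConvex : ∀ y ∈ Metric.ball c r, StarConvex ℝ y P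

theorem IsPolygonalElement.finRotate_ne {n : ℕ} {P : Set Plane} {a : Polygon Plane n}
    (hP : IsPolygonalElement P a) (i : Fin n) : finRotate n i ≠ i := by
  obtain ⟨m, rfl⟩ : ∃ m, n = m + 1 := ⟨n - 1, by have := hP.three_le; omega⟩
  have := hP.three_le
  intro h
  rw [finRotate_apply] at h
  have h1 : (1 : Fin (m + 1)) = 0 := by simpa using h
  rw [Fin.ext_iff, Fin.val_one', Fin.val_zero, Nat.mod_eq_of_lt (by omega)] at h1
  omega

theorem IsPolygonalElement.ne {n : ℕ} {P : Set Plane} {a : Polygon Plane n}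
    (hP : IsPolygonalElement P a) (i : Fin n) : a (finRotate n i) ≠ a i :=
  fun h => hP.finRotate_ne i (hP.injective h)

theorem IsPolygonalElement.edgeSet_subset {n : ℕ} {P : Set Plane} {a : Polygon Plane n}
    (hP : IsPolygonalElement P a) (i : Fin n) : a.edgeSet ℝ i ⊆ frontier P := by
  rw [hP.frontier_eq]
  exact subset_iUnion (fun i => a.edgeSet ℝ i) i

theorem IsPolygonalElement.frontier_subset {n : ℕ} {P : Set Plane} {a : Polygon Plane n}
    (hP : IsPolygonalElement P a) : frontier P ⊆ P :=
  hP.isCompact.isClosed.frontier_subset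

theorem Polygon.left_mem_edgeSet {n : ℕ} (a : Polygon Plane n) (i : Fin n) :
    a i ∈ a.edgeSet ℝ i := left_mem_affineSegment ℝ _ _

theorem Polygon.right_mem_edgeSet {n : ℕ} (a : Polygon Plane n) (i : Fin n) :
    a (finRotate n i) ∈ a.edgeSet ℝ i := right_mem_affineSegment ℝ _ _

theorem IsPolygonalElement.vertex_mem {n : ℕ} {P : Set Plane} {a : Polygon Plane n}
    (hP : IsPolygonalElement P a) (i : Fin n) : a i ∈ frontier P :=
  hP.edgeSet_subset i (a.left_mem_edgeSet i)

/-- Two distinct vertices make the diameter positive, so `ϱ h_P` is a genuine radius. -/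
theorem IsPolygonalElement.exists_isStarCenter {n : ℕ} {P : Set Plane} {a : Polygon Plane n}
    (hP : IsPolygonalElement P a) : ∃ c r, IsStarCenter P c r := by
  obtain ⟨ϱ, hϱ, c, h⟩ := hP.starShaped
  refine ⟨c, _, mul_pos hϱ (Metric.diam_pos ?_ hP.isCompact.isBounded), h⟩
  have i : Fin n := ⟨0, by have := hP.three_le; omega⟩
  exact ⟨_, hP.frontier_subset (hP.vertex_mem (finRotate n i)), _,
    hP.frontier_subset (hP.vertex_mem i), hP.ne i⟩

/-- The homothety with centre `y` and ratio `1 - s` keeps the image of the star ball inside `P`, and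
that image is the ball in question. This margin drives both the cutoffs and the mollification. -/
theorem IsStarCenter.ball_subset {P : Set Plane} {c : Plane} {r : ℝ} (h : IsStarCenter P c r)
    {y : Plane} (hy : y ∈ P) {s : ℝ} (hs0 : 0 ≤ s) (hs1 : s ≤ 1) :
    Metric.ball (c + s • (y - c)) ((1 - s) * r) ⊆ interior P := by
  refine interior_maximal (fun z hz => ?_) Metric.isOpen_ball
  rcases hs1.eq_or_lt with rfl | hs
  · simp at hz
  have hs' : 0 < 1 - s := sub_pos.2 hs
  have hz' : c + (1 - s)⁻¹ • (z - (c + s • (y - c))) ∈ Metric.ball c r := by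
    rw [mem_ball_iff_norm] at hz ⊢
    rw [add_sub_cancel_left, norm_smul, norm_inv, Real.norm_of_nonneg hs'.le,
      inv_mul_lt_iff₀ hs']
    exact hz
  have := h.starConvex _ hz' hy hs'.le hs0 (by ring)
  convert this using 1
  rw [smul_add, smul_inv_smul₀ hs'.ne']
  module

theorem IsStarCenter.mem_interior {P : Set Plane} {c : Plane} {r : ℝ} (h : IsStarCenter P c r)
    {y : Plane} (hy : y ∈ P) {s : ℝ} (hs0 : 0 ≤ s) (hs1 : s < 1) :
    c + s • (y - c) ∈ interior P :=
  h.ball_subset hy hs0 hs1.le (Metric.mem_ball_self (mul_pos (sub_pos.2 hs1) h.pos))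

theorem IsPolygonalElement.center_mem {n : ℕ} {P : Set Plane} {a : Polygon Plane n}
    (hP : IsPolygonalElement P a) {c : Plane} {r : ℝ} (hc : IsStarCenter P c r) :
    c ∈ interior P := by
  have i : Fin n := ⟨0, by have := hP.three_le; omega⟩
  simpa using hc.mem_interior (hP.frontier_subset (hP.vertex_mem i)) le_rfl zero_lt_one

/-- Every interior point other than the centre lies on an open segment from the centre to a
boundary point. -/
theorem exists_mem_frontier_of_mem_interior {P : Set Plane} (hP : IsCompact P) (c : Plane)
    {x : Plane} (hx : x ∈ interior P) (hxc : x ≠ c) :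
    ∃ y ∈ frontier P, ∃ s : ℝ, 0 < s ∧ s < 1 ∧ x = c + s • (y - c) := by
  have hn : 0 < ‖x - c‖ := norm_pos_iff.2 (sub_ne_zero.2 hxc)
  have hcont : Continuous fun t : ℝ => c + t • (x - c) := by fun_prop
  set K : Set ℝ := (fun t : ℝ => c + t • (x - c)) ⁻¹' P with hK
  have h1 : (1 : ℝ) ∈ K := by
    simpa [hK] using interior_subset hx
  have hKc : IsCompact K := by
    refine Metric.isCompact_of_isClosed_isBounded (hP.isClosed.preimage hcont) ?_
    obtain ⟨R, hR⟩ := hP.isBounded.subset_closedBall c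
    refine (Metric.isBounded_closedBall (x := (0 : ℝ)) (r := R / ‖x - c‖)).subset fun t ht => ?_
    have := hR ht
    rw [mem_closedBall_iff_norm, add_sub_cancel_left, norm_smul] at this
    rw [mem_closedBall_zero_iff, le_div_iff₀ hn]
    exact this
  -- The last parameter at which the ray from `c` through `x` is in `P`. An interior point there
  -- would let the ray continue inside `P`, so this is a boundary point, and `x` has parameter `1 <
  -- τ`.
  obtain ⟨τ, hτ, hmax⟩ := hKc.exists_isMaxOn ⟨1, h1⟩ continuousOn_id
  have hnot : ∀ t ≥ τ, c + t • (x - c) ∉ interior P := by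
    intro t ht hmem
    have : ∀ᶠ t' in 𝓝[>] t, c + t' • (x - c) ∈ interior P :=
      nhdsWithin_le_nhds (hcont.continuousAt.eventually (isOpen_interior.mem_nhds hmem))
    obtain ⟨t', ht', hgt⟩ := (this.and self_mem_nhdsWithin).exists
    have h2 : t' ≤ τ := hmax (show t' ∈ K from interior_subset (s := P) ht')
    exact absurd (ht.trans_lt hgt) (not_lt.2 h2)
  have hτ1 : 1 < τ := by
    by_contra hle
    exact hnot 1 (not_lt.1 hle) (by simpa using hx)
  have hτ0 : 0 < τ := zero_lt_one.trans hτ1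
  refine ⟨_, ⟨subset_closure hτ, hnot τ le_rfl⟩, τ⁻¹, inv_pos.2 hτ0, inv_lt_one_of_one_lt₀ hτ1, ?_⟩
  simp [smul_smul, inv_mul_cancel₀ hτ0.ne']

/-- The affine coordinates on the plane in which the triangle spanned by `c` and the `i`-th edge is
`{0 ≤ q ≤ p ≤ 1}`, with the edge on the line `p = 1`. -/
noncomputable def triangleMap {n : ℕ} (a : Polygon Plane n) (c : Plane) (i : Fin n) (z : ℝ × ℝ) :
    Plane := c + (z.1 • (a i - c) + z.2 • (a (finRotate n i) - a i))

theorem triangleMap_one {n : ℕ} (a : Polygon Plane n) (c : Plane) (i : Fin n) (q : ℝ) :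
    triangleMap a c i (1, q) = a.edgePath ℝ i q := by
  simp only [triangleMap, Polygon.edgePath, AffineMap.lineMap_apply, vsub_eq_sub, vadd_eq_add]
  module

theorem triangleMap_eq {n : ℕ} (a : Polygon Plane n) (c : Plane) (i : Fin n) {p : ℝ} (hp : p ≠ 0)
    (q : ℝ) : triangleMap a c i (p, q) = c + p • (a.edgePath ℝ i (q / p) - c) := by
  simp only [triangleMap, Polygon.edgePath, AffineMap.lineMap_apply, vsub_eq_sub, vadd_eq_add,
    smul_sub, smul_add, smul_smul, mul_div_cancel₀ _ hp]
  module

theorem edgePath_mem {n : ℕ} (a : Polygon Plane n) (i : Fin n) {t : ℝ} (h0 : 0 ≤ t) (h1 : t ≤ 1) :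
    a.edgePath ℝ i t ∈ a.edgeSet ℝ i := by
  rw [a.edgeSet_eq_image_edgePath ℝ]
  exact mem_image_of_mem _ ⟨h0, h1⟩

theorem continuous_edgePath {n : ℕ} (a : Polygon Plane n) (i : Fin n) :
    Continuous (a.edgePath ℝ i) := (a.edgePath ℝ i).continuous_of_finiteDimensional

/-- The centre does not lie on the line through an edge. -/
theorem IsPolygonalElement.independent {n : ℕ} {P : Set Plane} {a : Polygon Plane n}
    (hP : IsPolygonalElement P a) {c : Plane} {r : ℝ} (hc : IsStarCenter P c r) (i : Fin n)
    {p q : ℝ} (h : p • (a i - c) + q • (a (finRotate n i) - a i) = 0) : p = 0 ∧ q = 0 := by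
  have hp : p = 0 := by
    by_contra hp
    obtain ⟨τ, hτ⟩ : ∃ τ : ℝ, c = a i + τ • (a (finRotate n i) - a i) := by
      refine ⟨q / p, ?_⟩
      have h2 := congrArg (fun v => p⁻¹ • v) h
      simp only [smul_add, smul_smul, inv_mul_cancel₀ hp, one_smul, smul_zero] at h2
      rw [div_eq_inv_mul]
      have h3 : c = a i + (p⁻¹ * q) • (a (finRotate n i) - a i) -
        (a i - c + (p⁻¹ * q) • (a (finRotate n i) - a i)) := by module
      rwa [h2, sub_zero] at h3
    have hI : ∀ x ∈ frontier P, x ∉ interior P := fun x hx => hx.2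
    -- If `τ < 0`, the vertex `a i` lies strictly between `c` and the next vertex; if `τ > 1`, the
    -- roles are exchanged; otherwise `c` is on the edge. Each case puts a boundary point into the
    -- interior.
    rcases lt_or_ge τ 0 with h0 | h0
    · refine hI _ (hP.vertex_mem i) ?_
      have h1 : 0 < 1 - τ := by linarith
      have := hc.mem_interior (hP.frontier_subset (hP.vertex_mem (finRotate n i)))
        (s := -τ / (1 - τ)) (div_nonneg (by linarith) h1.le) ((div_lt_one h1).2 (by linarith))
      convert this using 1
      have e : c + (-τ / (1 - τ)) • (a (finRotate n i) - c) =
        (1 - τ)⁻¹ • (c - τ • a (finRotate n i)) := by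
        have : (-τ / (1 - τ)) = (1 - τ)⁻¹ * (-τ) := by rw [div_eq_inv_mul]
        have h5 : c = (1 - τ)⁻¹ • ((1 - τ) • c) := by rw [inv_smul_smul₀ h1.ne']
        rw [this, mul_smul]
        nth_rw 1 [h5]
        rw [← smul_add]
        congr 1
        module
      rw [e, eq_inv_smul_iff₀ h1.ne']
      nth_rw 1 [hτ]
      module
    · rcases le_or_gt τ 1 with h1 | h1
      · refine hI c ?_ (hP.center_mem hc)
        have := hP.edgeSet_subset i (edgePath_mem a i h0 h1)
        convert this using 1
        nth_rw 1 [hτ]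
        simp [Polygon.edgePath, AffineMap.lineMap_apply, add_comm]
      · refine hI _ (hP.vertex_mem (finRotate n i)) ?_
        have h2 : 0 < τ := by linarith
        have := hc.mem_interior (hP.frontier_subset (hP.vertex_mem i))
          (s := (τ - 1) / τ) (div_nonneg (by linarith) h2.le) ((div_lt_one h2).2 (by linarith))
        convert this using 1
        have e : c + ((τ - 1) / τ) • (a i - c) = τ⁻¹ • (c + (τ - 1) • a i) := by
          have h5 : c = τ⁻¹ • (τ • c) := by rw [inv_smul_smul₀ h2.ne']
          rw [div_eq_inv_mul, mul_smul]
          nth_rw 1 [h5]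
          rw [← smul_add]
          congr 1
          module
        rw [e, eq_inv_smul_iff₀ h2.ne']
        nth_rw 1 [hτ]
        module
  refine ⟨hp, ?_⟩
  rw [hp, zero_smul, zero_add] at h
  exact (smul_eq_zero.1 h).resolve_right (sub_ne_zero.2 (hP.ne i))

/-- Triangle coordinates are an affine isomorphism, so by uniqueness of Haar measure they carry
Lebesgue measure to a multiple of it. Only `0 < κ < ∞` matters, never the value of the Jacobian. -/
theorem IsPolygonalElement.exists_volume_eq {n : ℕ} {P : Set Plane} {a : Polygon Plane n}
    (hP : IsPolygonalElement P a) {c : Plane} {r : ℝ} (hc : IsStarCenter P c r) (i : Fin n) :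
    MeasurableEmbedding (triangleMap a c i) ∧ ∃ κ : ℝ≥0∞, κ ≠ 0 ∧ κ ≠ ⊤ ∧
      (volume : Measure Plane) = κ • (volume : Measure (ℝ × ℝ)).map (triangleMap a c i) := by
  let A : ℝ × ℝ →ₗ[ℝ] Plane :=
    (LinearMap.fst ℝ ℝ ℝ).smulRight (a i - c) +
      (LinearMap.snd ℝ ℝ ℝ).smulRight (a (finRotate n i) - a i)
  have hA : Function.Injective A := by
    rw [← LinearMap.ker_eq_bot, LinearMap.ker_eq_bot']
    rintro ⟨p, q⟩ h
    obtain ⟨rfl, rfl⟩ := hP.independent hc i h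
    rfl
  let e : (ℝ × ℝ) ≃L[ℝ] Plane :=
    (LinearEquiv.ofInjectiveOfFinrankEq A hA (by simp)).toContinuousLinearEquiv
  have he : triangleMap a c i = (fun x => c + x) ∘ e := rfl
  have hme : MeasurableEmbedding e := e.toHomeomorph.measurableEmbedding
  have hmc : MeasurableEmbedding (fun x : Plane => c + x) := measurableEmbedding_addLeft c
  refine ⟨he ▸ hmc.comp hme, ?_⟩
  have hmap : (volume : Measure (ℝ × ℝ)).map (triangleMap a c i) =
      (volume : Measure (ℝ × ℝ)).map e := by
    have : ((volume : Measure (ℝ × ℝ)).map e).IsAddHaarMeasure := e.isAddHaarMeasure_map _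
    rw [he, ← Measure.map_map hmc.measurable hme.measurable, map_add_left_eq_self]
  rw [hmap]
  have : ((volume : Measure (ℝ × ℝ)).map e).IsAddHaarMeasure := e.isAddHaarMeasure_map _
  refine ⟨Measure.addHaarScalarFactor volume ((volume : Measure (ℝ × ℝ)).map e), ?_, by simp, ?_⟩
  · exact_mod_cast (Measure.addHaarScalarFactor_pos_of_isAddHaarMeasure _ _).ne'
  · exact Measure.isAddLeftInvariant_eq_smul _ _

/-- The part `1 - δ < p < 1` of the triangle `{0 ≤ q ≤ p ≤ 1}`. -/
def triangleStrip (δ : ℝ) : Set (ℝ × ℝ) := {z | 1 - δ < z.1 ∧ z.1 < 1 ∧ 0 ≤ z.2 ∧ z.2 ≤ z.1}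

/-- The points of the polygon at relative depth less than `δ`, as seen from `c`. -/
def boundaryStrip {n : ℕ} (a : Polygon Plane n) (c : Plane) (δ : ℝ) : Set Plane :=
  ⋃ i, triangleMap a c i '' triangleStrip δ

theorem measurableSet_triangleStrip (δ : ℝ) : MeasurableSet (triangleStrip δ) := by
  unfold triangleStrip
  measurability

theorem IsPolygonalElement.measurableSet_boundaryStrip {n : ℕ} {P : Set Plane}
    {a : Polygon Plane n} (hP : IsPolygonalElement P a) {c : Plane} {r : ℝ}
    (hc : IsStarCenter P c r) (δ : ℝ) : MeasurableSet (boundaryStrip a c δ) :=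
  MeasurableSet.iUnion fun i =>
    (hP.exists_volume_eq hc i).1.measurableSet_image.2 (measurableSet_triangleStrip δ)

theorem IsPolygonalElement.boundaryStrip_subset {n : ℕ} {P : Set Plane}
    {a : Polygon Plane n} (hP : IsPolygonalElement P a) {c : Plane} {r : ℝ}
    (hc : IsStarCenter P c r) {δ : ℝ} (hδ : δ ≤ 1) : boundaryStrip a c δ ⊆ interior P := by
  refine iUnion_subset fun i => ?_
  rintro _ ⟨⟨p, q⟩, ⟨h1, h2, h3, h4⟩, rfl⟩
  simp only at h1 h2 h3 h4
  have hp : 0 < p := by linarith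
  rw [triangleMap_eq a c i hp.ne']
  exact hc.mem_interior (hP.frontier_subset (hP.edgeSet_subset i
    (edgePath_mem a i (div_nonneg h3 hp.le) ((div_le_one hp).2 h4)))) hp.le h2

theorem IsPolygonalElement.exists_of_notMem_boundaryStrip {n : ℕ} {P : Set Plane}
    {a : Polygon Plane n} (hP : IsPolygonalElement P a) (c : Plane) {δ : ℝ} {x : Plane}
    (hx : x ∈ interior P) (hxc : x ≠ c) (hxδ : x ∉ boundaryStrip a c δ) :
    ∃ y ∈ P, ∃ s : ℝ, 0 < s ∧ s < 1 ∧ s ≤ 1 - δ ∧ x = c + s • (y - c) := by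
  obtain ⟨y, hy, s, hs0, hs1, rfl⟩ := exists_mem_frontier_of_mem_interior hP.isCompact c hx hxc
  refine ⟨y, hP.frontier_subset hy, s, hs0, hs1, ?_, rfl⟩
  by_contra hlt
  refine hxδ ?_
  rw [hP.frontier_eq] at hy
  obtain ⟨i, hi⟩ := mem_iUnion.1 hy
  rw [a.edgeSet_eq_image_edgePath ℝ] at hi
  obtain ⟨t, ⟨ht0, ht1⟩, rfl⟩ := hi
  refine mem_iUnion.2 ⟨i, (s, s * t), ⟨not_le.1 hlt, hs1, mul_nonneg hs0.le ht0,
    mul_le_of_le_one_right hs0.le ht1⟩, ?_⟩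
  rw [triangleMap_eq a c i hs0.ne', mul_div_cancel_left₀ _ hs0.ne']

/-- At depth `1` the strips are the triangles without their common apex, so only `c` can be missed.
-/
theorem IsPolygonalElement.interior_subset_insert {n : ℕ} {P : Set Plane}
    {a : Polygon Plane n} (hP : IsPolygonalElement P a) (c : Plane) :
    interior P ⊆ insert c (boundaryStrip a c 1) := by
  intro x hx
  by_contra h
  rw [mem_insert_iff, not_or] at h
  obtain ⟨_, _, s, hs0, _, hs, _⟩ := hP.exists_of_notMem_boundaryStrip c hx h.1 h.2
  linarith

/-- Off the strip the radial parameter is at most `1 - δ`, so the homothetic ball of `ball_subset`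
has radius at least `δ r`. -/
theorem IsPolygonalElement.ball_subset_of_notMem_boundaryStrip {n : ℕ} {P : Set Plane}
    {a : Polygon Plane n} (hP : IsPolygonalElement P a) {c : Plane} {r : ℝ}
    (hc : IsStarCenter P c r) {δ : ℝ} (hδ : δ ≤ 1) {x : Plane} (hx : x ∈ interior P)
    (hxδ : x ∉ boundaryStrip a c δ) : Metric.ball x (δ * r) ⊆ interior P := by
  by_cases h : x = c
  · subst h
    have i : Fin n := ⟨0, by have := hP.three_le; omega⟩
    have := hc.ball_subset (hP.frontier_subset (hP.vertex_mem i)) le_rfl zero_le_one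
    simp only [zero_smul, add_zero, sub_zero, one_mul] at this
    exact (Metric.ball_subset_ball (mul_le_of_le_one_left hc.pos.le hδ)).trans this
  · obtain ⟨y, hy, s, hs0, hs1, hsδ, rfl⟩ := hP.exists_of_notMem_boundaryStrip c hx h hxδ
    exact (Metric.ball_subset_ball (mul_le_mul_of_nonneg_right (by linarith) hc.pos.le)).trans
      (hc.ball_subset hy hs0.le hs1.le)

/-- In triangle coordinates each piece of the strip lies in a rectangle with sides `δ` and `1`. -/
theorem IsPolygonalElement.exists_volume_boundaryStrip_le {n : ℕ} {P : Set Plane}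
    {a : Polygon Plane n} (hP : IsPolygonalElement P a) {c : Plane} {r : ℝ}
    (hc : IsStarCenter P c r) : ∃ C : ℝ≥0∞, C ≠ ⊤ ∧ ∀ δ ≤ 1,
      volume (boundaryStrip a c δ) ≤ C * ENNReal.ofReal δ := by
  choose hme κ h0 ht hv using hP.exists_volume_eq hc
  refine ⟨∑ i, κ i, by simp [ht], fun δ hδ => ?_⟩
  refine (measure_iUnion_le _).trans ?_
  rw [tsum_fintype, Finset.sum_mul]
  refine Finset.sum_le_sum fun i _ => ?_
  rw [hv i, Measure.smul_apply, smul_eq_mul, (hme i).map_apply,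
    preimage_image_eq _ (hme i).injective]
  refine mul_le_mul_right ?_ _
  have : triangleStrip δ ⊆ Ioo (1 - δ) 1 ×ˢ Icc 0 1 := by
    rintro ⟨p, q⟩ ⟨h1, h2, h3, h4⟩
    exact ⟨⟨h1, h2⟩, h3, h4.trans h2.le⟩
  refine (measure_mono this).trans ?_
  rw [Measure.volume_eq_prod, Measure.prod_prod]
  simp

/-! ### Estimates near the boundary -/

theorem ENNReal.add_sq_le_two_mul (a b : ℝ≥0∞) : (a + b) ^ 2 ≤ 2 * a ^ 2 + 2 * b ^ 2 := by
  induction a with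
  | top => simp
  | coe a =>
    induction b with
    | top => simp
    | coe b =>
      have : (a + b) ^ 2 ≤ 2 * (a ^ 2 + b ^ 2) := add_sq_le
      rw [mul_add] at this
      exact_mod_cast this

theorem sq_lintegral_le {α : Type*} [MeasurableSpace α] (μ : Measure α) {g : α → ℝ≥0∞}
    (hg : AEMeasurable g μ) : (∫⁻ x, g x ∂μ) ^ 2 ≤ μ univ * ∫⁻ x, g x ^ 2 ∂μ := by
  have h := ENNReal.lintegral_mul_le_Lp_mul_Lq μ (p := 2) (q := 2)
    Real.HolderConjugate.two_two (f := 1) aemeasurable_const hg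
  simp only [one_mul, Pi.one_apply, one_pow, lintegral_const, ENNReal.rpow_two] at h
  have hs : ∀ x : ℝ≥0∞, (x ^ (1 / 2 : ℝ)) ^ 2 = x := fun x => by
    rw [← ENNReal.rpow_two, ← ENNReal.rpow_mul]
    norm_num
  refine (pow_le_pow_left₀ zero_le h 2).trans_eq ?_
  rw [mul_pow, hs, hs]

theorem eLpNorm_two_sq {α F : Type*} [MeasurableSpace α] [NormedAddCommGroup F] (μ : Measure α)
    (f : α → F) : eLpNorm f 2 μ ^ 2 = ∫⁻ x, ‖f x‖ₑ ^ 2 ∂μ := by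
  have := eLpNorm_nnreal_pow_eq_lintegral (μ := μ) (f := f) (p := 2) two_ne_zero
  simpa using this

theorem enorm_sub_sq_le {f f' : ℝ → ℝ} (hf : ∀ x, HasDerivAt f (f' x) x) (hf' : Continuous f')
    {α p : ℝ} (h1 : α ≤ p) (h2 : p ≤ 1) :
    ‖f 1 - f p‖ₑ ^ 2 ≤ ENNReal.ofReal (1 - α) * ∫⁻ x in Ioo α 1, ‖f' x‖ₑ ^ 2 := by
  rw [← intervalIntegral.integral_eq_sub_of_hasDerivAt (fun x _ => hf x)
    (hf'.intervalIntegrable p 1), intervalIntegral.integral_of_le h2]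
  have h3 : ‖∫ x in Ioc p 1, f' x‖ₑ ≤ ∫⁻ x in Ioo α 1, ‖f' x‖ₑ := by
    refine (enorm_integral_le_lintegral_enorm _).trans ?_
    rw [setLIntegral_congr (Ioo_ae_eq_Ioc (a := α) (b := 1))]
    exact lintegral_mono_set (Ioc_subset_Ioc_left h1)
  refine (pow_le_pow_left₀ zero_le h3 2).trans ((sq_lintegral_le _ ?_).trans_eq ?_)
  · exact hf'.enorm.aemeasurable
  · simp

/-- The fundamental theorem of calculus and Cauchy–Schwarz bound `f p` by `f 1` and the derivative,
with one factor `δ` on the latter; integrating in `p` adds a factor `δ` to both terms. -/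
theorem lintegral_sq_le_of_hasDerivAt {f f' : ℝ → ℝ} (hf : ∀ x, HasDerivAt f (f' x) x)
    (hf' : Continuous f') {α δ : ℝ} (h2 : 1 - α ≤ δ) :
    ∫⁻ x in Ioo α 1, ‖f x‖ₑ ^ 2 ≤ 2 * ENNReal.ofReal δ * ‖f 1‖ₑ ^ 2 +
      2 * ENNReal.ofReal δ ^ 2 * ∫⁻ x in Ioo α 1, ‖f' x‖ₑ ^ 2 := by
  have hδ : ENNReal.ofReal (1 - α) ≤ ENNReal.ofReal δ := ENNReal.ofReal_le_ofReal h2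
  have h3 : ∀ p ∈ Ioo α 1, ‖f p‖ₑ ^ 2 ≤
      2 * ‖f 1‖ₑ ^ 2 + 2 * (ENNReal.ofReal δ * ∫⁻ x in Ioo α 1, ‖f' x‖ₑ ^ 2) := by
    intro p hp
    have h4 : ‖f p‖ₑ ≤ ‖f 1‖ₑ + ‖f 1 - f p‖ₑ := by
      have : f p = f 1 - (f 1 - f p) := by ring
      nth_rw 1 [this]
      exact enorm_sub_le
    refine (pow_le_pow_left₀ zero_le h4 2).trans ((ENNReal.add_sq_le_two_mul _ _).trans ?_)
    gcongr
    exact (enorm_sub_sq_le hf hf' hp.1.le hp.2.le).trans (mul_le_mul_left hδ _)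
  refine (setLIntegral_mono measurable_const h3).trans ?_
  rw [lintegral_const, Measure.restrict_apply_univ, Real.volume_Ioo]
  refine (mul_le_mul_right hδ _).trans_eq ?_
  ring

/-- The comparison of `f p` with `f 1` read in the other direction: integrating over `p` multiplies
the end value by the length `1 - α`. This is the source of the weight in the trace inequality. -/
theorem mul_enorm_sq_le_of_hasDerivAt {f f' : ℝ → ℝ} (hf : ∀ x, HasDerivAt f (f' x) x)
    (hf' : Continuous f') {α : ℝ} (h2 : 1 - α ≤ 1) :
    ENNReal.ofReal (1 - α) * ‖f 1‖ₑ ^ 2 ≤ 2 * (∫⁻ x in Ioo α 1, ‖f x‖ₑ ^ 2) +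
      2 * ∫⁻ x in Ioo α 1, ‖f' x‖ₑ ^ 2 := by
  have hδ : ENNReal.ofReal (1 - α) ≤ 1 := by simpa using h2
  have hfc : Continuous f := continuous_iff_continuousAt.2 fun x => (hf x).continuousAt
  have h3 : ∀ p ∈ Ioo α 1, ‖f 1‖ₑ ^ 2 ≤
      2 * ‖f p‖ₑ ^ 2 + 2 * (ENNReal.ofReal (1 - α) * ∫⁻ x in Ioo α 1, ‖f' x‖ₑ ^ 2) := by
    intro p hp
    have h4 : ‖f 1‖ₑ ≤ ‖f p‖ₑ + ‖f 1 - f p‖ₑ := by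
      have : f 1 = f p + (f 1 - f p) := by ring
      nth_rw 1 [this]
      exact enorm_add_le _ _
    refine (pow_le_pow_left₀ zero_le h4 2).trans ((ENNReal.add_sq_le_two_mul _ _).trans ?_)
    gcongr
    exact enorm_sub_sq_le hf hf' hp.1.le hp.2.le
  have h5 := setLIntegral_mono (μ := (volume : Measure ℝ)) ((hfc.enorm.measurable.pow_const 2).const_mul 2 |>.add_const _) h3
  rw [lintegral_const, Measure.restrict_apply_univ, Real.volume_Ioo, mul_comm,
    lintegral_add_right _ measurable_const, lintegral_const, Measure.restrict_apply_univ,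
    Real.volume_Ioo, lintegral_const_mul _ (hfc.enorm.measurable.pow_const 2)] at h5
  refine h5.trans ?_
  rw [mul_assoc]
  gcongr
  calc _ ≤ 1 * (∫⁻ x in Ioo α 1, ‖f' x‖ₑ ^ 2) * 1 := by gcongr
    _ = _ := by ring

/-- The horizontal slices of the strip. -/
theorem slice_triangleStrip_ae_eq {δ q : ℝ} (hq : 0 ≤ q) :
    {p | (p, q) ∈ triangleStrip δ} =ᵐ[volume] Ioo (max (1 - δ) q) 1 := by
  have h0 : Ico (max (1 - δ) q) 1 =ᵐ[volume] Ioo (max (1 - δ) q) 1 := Ioo_ae_eq_Ico.symm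
  refine (EventuallyLE.trans_eq (LE.le.eventuallyLE ?_) h0).antisymm (LE.le.eventuallyLE ?_)
  · rintro p ⟨h1, h2, h3, h4⟩
    exact ⟨max_le h1.le h4, h2⟩
  · rintro p ⟨h1, h2⟩
    obtain ⟨h3, h4⟩ := max_lt_iff.1 h1
    exact ⟨h3, h2, hq, h4.le⟩

/-- Tonelli with `q` outermost: the slices are segments parallel to `a i - c` ending on the edge `p
= 1`. They shorten to a point as `q` tends to `1`. -/
theorem setLIntegral_triangleStrip (δ : ℝ) {F : ℝ × ℝ → ℝ≥0∞} (hF : Measurable F) :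
    ∫⁻ z in triangleStrip δ, F z =
      ∫⁻ q in Icc (0 : ℝ) 1, ∫⁻ p in Ioo (max (1 - δ) q) 1, F (p, q) := by
  rw [← lintegral_indicator (measurableSet_triangleStrip δ), Measure.volume_eq_prod,
    lintegral_prod_symm' _ (hF.indicator (measurableSet_triangleStrip δ)),
    ← lintegral_indicator measurableSet_Icc]
  refine lintegral_congr fun q => ?_
  have hm : MeasurableSet {p | (p, q) ∈ triangleStrip δ} :=
    measurable_prodMk_right (measurableSet_triangleStrip δ)
  have h1 : ∀ p, (triangleStrip δ).indicator F (p, q) =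
      {p | (p, q) ∈ triangleStrip δ}.indicator (fun p => F (p, q)) p := fun p => rfl
  simp only [h1]
  rw [lintegral_indicator hm]
  by_cases hq : q ∈ Icc (0 : ℝ) 1
  · rw [indicator_of_mem hq, setLIntegral_congr (slice_triangleStrip_ae_eq hq.1)]
  · rw [indicator_of_notMem hq]
    have : {p | (p, q) ∈ triangleStrip δ} = ∅ := by
      refine eq_empty_of_forall_notMem ?_
      rintro p ⟨_, h2, h3, h4⟩
      exact hq ⟨h3, h4.trans h2.le⟩
    simp [this]

theorem continuous_triangleMap {n : ℕ} (a : Polygon Plane n) (c : Plane) (i : Fin n) :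
    Continuous (triangleMap a c i) := by
  unfold triangleMap
  fun_prop

theorem hasDerivAt_triangleMap {n : ℕ} (a : Polygon Plane n) (c : Plane) (i : Fin n)
    {φ : Plane → ℝ} (hφ : ContDiff ℝ ∞ φ) (q p : ℝ) :
    HasDerivAt (fun p => φ (triangleMap a c i (p, q)))
      (inner ℝ (∇ φ (triangleMap a c i (p, q))) (a i - c)) p := by
  have h1 : HasDerivAt (fun p => triangleMap a c i (p, q)) (a i - c) p := by
    unfold triangleMap
    have := ((hasDerivAt_id p).smul_const (a i - c)).add_const
      (q • (a (finRotate n i) - a i)) |>.const_add c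
    simpa using this
  have h2 := ((hφ.differentiable (by simp)) (triangleMap a c i (p, q))).hasGradientAt
  exact h2.hasFDerivAt.comp_hasDerivAt p h1

/-- The one-dimensional estimate on each slice, where the derivative is the component of the
gradient along `a i - c`. -/
theorem setLIntegral_triangleStrip_le {n : ℕ} (a : Polygon Plane n) (c : Plane) (i : Fin n)
    {φ : Plane → ℝ} (hφ : ContDiff ℝ ∞ φ) (δ : ℝ) :
    ∫⁻ z in triangleStrip δ, ‖φ (triangleMap a c i z)‖ₑ ^ 2 ≤
      2 * ENNReal.ofReal δ * (∫⁻ q in Icc (0 : ℝ) 1, ‖φ (a.edgePath ℝ i q)‖ₑ ^ 2) +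
      2 * ENNReal.ofReal δ ^ 2 * (‖a i - c‖ₑ ^ 2 *
        ∫⁻ z in triangleStrip δ, ‖∇ φ (triangleMap a c i z)‖ₑ ^ 2) := by
  have hT := continuous_triangleMap a c i
  have hg : Continuous fun z => ∇ φ (triangleMap a c i z) := (continuous_gradient hφ).comp hT
  have hm1 : Measurable fun z => ‖φ (triangleMap a c i z)‖ₑ ^ 2 :=
    (hφ.continuous.comp hT).enorm.measurable.pow_const 2
  have hm2 : Measurable fun z => ‖∇ φ (triangleMap a c i z)‖ₑ ^ 2 :=
    hg.enorm.measurable.pow_const 2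
  have hm3 : Measurable fun q => ‖φ (a.edgePath ℝ i q)‖ₑ ^ 2 :=
    (hφ.continuous.comp (continuous_edgePath a i)).enorm.measurable.pow_const 2
  rw [setLIntegral_triangleStrip δ hm1, ← lintegral_const_mul _ hm2,
    setLIntegral_triangleStrip δ (hm2.const_mul _), ← lintegral_const_mul _ hm3]
  have hm4 : Measurable fun q => 2 * ENNReal.ofReal δ * ‖φ (a.edgePath ℝ i q)‖ₑ ^ 2 :=
    hm3.const_mul _
  refine (le_of_le_of_eq ?_ (lintegral_add_left hm4 _)).trans (add_le_add le_rfl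
    (lintegral_const_mul' _ _ (by finiteness)).le)
  refine lintegral_mono fun q => ?_
  have h1 := lintegral_sq_le_of_hasDerivAt (fun p => hasDerivAt_triangleMap a c i hφ q p)
    ((hg.comp (by fun_prop : Continuous fun p : ℝ => (p, q))).inner continuous_const)
    (α := max (1 - δ) q) (δ := δ) (by linarith [le_max_left (1 - δ) q])
  rw [triangleMap_one] at h1
  refine h1.trans ?_
  gcongr with p
  rw [← mul_pow, mul_comm]
  gcongr
  simp only [← ofReal_norm]
  rw [← ENNReal.ofReal_mul (norm_nonneg _)]
  exact ENNReal.ofReal_le_ofReal (norm_inner_le_norm _ _)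

/-- The weight `1 - q` is the length of the full slice through the edge point of parameter `q`, and
it degenerates only at the vertex `q = 1`. -/
theorem lintegral_mul_enorm_edge_le {n : ℕ} (a : Polygon Plane n) (c : Plane) (i : Fin n)
    {φ : Plane → ℝ} (hφ : ContDiff ℝ ∞ φ) :
    ∫⁻ q in Icc (0 : ℝ) 1, ENNReal.ofReal (1 - q) * ‖φ (a.edgePath ℝ i q)‖ₑ ^ 2 ≤
      2 * (∫⁻ z in triangleStrip 1, ‖φ (triangleMap a c i z)‖ₑ ^ 2) +
      2 * (‖a i - c‖ₑ ^ 2 * ∫⁻ z in triangleStrip 1, ‖∇ φ (triangleMap a c i z)‖ₑ ^ 2) := by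
  have hT := continuous_triangleMap a c i
  have hg : Continuous fun z => ∇ φ (triangleMap a c i z) := (continuous_gradient hφ).comp hT
  have hm1 : Measurable fun z => ‖φ (triangleMap a c i z)‖ₑ ^ 2 :=
    (hφ.continuous.comp hT).enorm.measurable.pow_const 2
  have hm2 : Measurable fun z => ‖∇ φ (triangleMap a c i z)‖ₑ ^ 2 :=
    hg.enorm.measurable.pow_const 2
  have hm3 : Measurable fun z => 2 * ‖φ (triangleMap a c i z)‖ₑ ^ 2 +
      2 * (‖a i - c‖ₑ ^ 2 * ‖∇ φ (triangleMap a c i z)‖ₑ ^ 2) :=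
    (hm1.const_mul _).add ((hm2.const_mul _).const_mul _)
  rw [← lintegral_const_mul _ hm2, ← lintegral_const_mul _ hm1,
    ← lintegral_const_mul _ (hm2.const_mul _), ← lintegral_add_left (hm1.const_mul _),
    setLIntegral_triangleStrip 1 hm3]
  refine setLIntegral_mono' measurableSet_Icc fun q hq => ?_
  have h1 := mul_enorm_sq_le_of_hasDerivAt (fun p => hasDerivAt_triangleMap a c i hφ q p)
    ((hg.comp (by fun_prop : Continuous fun p : ℝ => (p, q))).inner continuous_const)
    (α := q) (by linarith [hq.1])
  rw [triangleMap_one] at h1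
  have hmax : max (1 - 1) q = q := by simpa using hq.1
  rw [hmax]
  refine le_trans ?_ (le_lintegral_add _ _)
  rw [lintegral_const_mul' _ _ (by finiteness), lintegral_const_mul' _ _ (by finiteness)]
  refine h1.trans ?_
  gcongr with p
  rw [← mul_pow, mul_comm]
  gcongr
  simp only [← ofReal_norm]
  rw [← ENNReal.ofReal_mul (norm_nonneg _)]
  exact ENNReal.ofReal_le_ofReal (norm_inner_le_norm _ _)

theorem lintegral_edgeMeasure {n : ℕ} (a : Polygon Plane n) (i : Fin n) {F : Plane → ℝ≥0∞}
    (hF : Measurable F) : ∫⁻ x, F x ∂(edgeMeasure a i) =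
      ENNReal.ofReal (dist (a i) (a (finRotate n i))) *
        ∫⁻ q in Icc (0 : ℝ) 1, F (a.edgePath ℝ i q) := by
  rw [edgeMeasure, lintegral_smul_measure, lintegral_map hF (continuous_edgePath a i).measurable,
    smul_eq_mul]

theorem edgeMeasure_le {n : ℕ} (a : Polygon Plane n) (i : Fin n) :
    edgeMeasure a i ≤ boundaryMeasure a :=
  Finset.single_le_sum (f := edgeMeasure a) (fun _ _ => Measure.zero_le _) (Finset.mem_univ i)

/-- In the strip of relative depth `δ`, a smooth function is controlled by its boundary values and
`δ` times its gradient. -/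
theorem IsPolygonalElement.exists_eLpNorm_boundaryStrip_le {n : ℕ} {P : Set Plane}
    {a : Polygon Plane n} (hP : IsPolygonalElement P a) {c : Plane} {r : ℝ}
    (hc : IsStarCenter P c r) : ∃ C : ℝ≥0∞, C ≠ ⊤ ∧ ∀ φ : Plane → ℝ, ContDiff ℝ ∞ φ →
      ∀ δ ≤ 1, eLpNorm φ 2 (volume.restrict (boundaryStrip a c δ)) ≤
        C * (eLpNorm φ 2 (boundaryMeasure a) +
          ENNReal.ofReal δ * eLpNorm (∇ φ) 2 (volume.restrict (boundaryStrip a c δ))) := by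
  choose hme κ h0 ht hv using hP.exists_volume_eq hc
  set L : Fin n → ℝ≥0∞ := fun i => ENNReal.ofReal (dist (a i) (a (finRotate n i))) with hL
  have hL0 : ∀ i, L i ≠ 0 := fun i => by simpa [hL] using (hP.ne i).symm
  have hLt : ∀ i, L i ≠ ⊤ := fun i => ENNReal.ofReal_ne_top
  -- `2 κ / L` turns the parameter integral on an edge into arc length, and `2 ‖a i - c‖²` comes
  -- from differentiating along the slices. The summand `1` ensures `K ≤ K²`, so `K` still serves
  -- after taking the square root.
  set K : ℝ≥0∞ := ∑ i, (2 * κ i / L i + 2 * ‖a i - c‖ₑ ^ 2) + 1 with hK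
  have hKt : K ≠ ⊤ := by
    refine ENNReal.add_ne_top.2 ⟨ENNReal.sum_ne_top.2 fun i _ => ?_, ENNReal.one_ne_top⟩
    refine ENNReal.add_ne_top.2 ⟨ENNReal.div_ne_top ?_ (hL0 i), by finiteness⟩
    exact ENNReal.mul_ne_top (by simp) (ht i)
  refine ⟨K, hKt, fun φ hφ δ hδ => ?_⟩
  have hcv : ∀ i, ∀ F : Plane → ℝ≥0∞,
      ∫⁻ x in triangleMap a c i '' triangleStrip δ, F x =
        κ i * ∫⁻ z in triangleStrip δ, F (triangleMap a c i z) := by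
    intro i F
    nth_rw 1 [hv i]
    rw [Measure.restrict_smul, lintegral_smul_measure, (hme i).restrict_map,
      (hme i).lintegral_map, preimage_image_eq _ (hme i).injective, smul_eq_mul]
  set Y := ∫⁻ x, ‖φ x‖ₑ ^ 2 ∂(boundaryMeasure a) with hY
  set Z := ∫⁻ x in boundaryStrip a c δ, ‖∇ φ x‖ₑ ^ 2 with hZ
  have hδ1 : ENNReal.ofReal δ ≤ 1 := by simpa using hδ
  have hi : ∀ i, ∫⁻ x in triangleMap a c i '' triangleStrip δ, ‖φ x‖ₑ ^ 2 ≤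
      (2 * κ i / L i + 2 * ‖a i - c‖ₑ ^ 2) * (Y + ENNReal.ofReal δ ^ 2 * Z) := by
    intro i
    rw [hcv i]
    refine (mul_le_mul_right (setLIntegral_triangleStrip_le a c i hφ δ) _).trans ?_
    have e1 : ∫⁻ q in Icc (0 : ℝ) 1, ‖φ (a.edgePath ℝ i q)‖ₑ ^ 2 ≤ Y / L i := by
      rw [ENNReal.le_div_iff_mul_le (Or.inl (hL0 i)) (Or.inl (hLt i)), mul_comm,
        ← lintegral_edgeMeasure a i (hφ.continuous.enorm.measurable.pow_const 2)]
      exact lintegral_mono' (edgeMeasure_le a i) le_rfl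
    have e2 : κ i * ∫⁻ z in triangleStrip δ, ‖∇ φ (triangleMap a c i z)‖ₑ ^ 2 ≤ Z := by
      rw [← hcv i fun x => ‖∇ φ x‖ₑ ^ 2]
      exact lintegral_mono_set (subset_iUnion_of_subset i subset_rfl)
    calc _ ≤ κ i * (2 * 1 * (Y / L i)) + 2 * ENNReal.ofReal δ ^ 2 * (‖a i - c‖ₑ ^ 2 *
          (κ i * ∫⁻ z in triangleStrip δ, ‖∇ φ (triangleMap a c i z)‖ₑ ^ 2)) := by
          rw [mul_add]
          refine add_le_add (by gcongr) (le_of_eq (by ring))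
      _ ≤ κ i * (2 * 1 * (Y / L i)) +
          2 * ENNReal.ofReal δ ^ 2 * (‖a i - c‖ₑ ^ 2 * Z) := by gcongr
      _ = (2 * κ i / L i) * Y + 2 * ‖a i - c‖ₑ ^ 2 * (ENNReal.ofReal δ ^ 2 * Z) := by
          simp only [div_eq_mul_inv]
          ring
      _ ≤ _ := by
          rw [add_mul]
          gcongr
          · exact le_self_add
          · exact le_add_self
  have hsum : ∫⁻ x in boundaryStrip a c δ, ‖φ x‖ₑ ^ 2 ≤ K * (Y + ENNReal.ofReal δ ^ 2 * Z) := by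
    refine (lintegral_iUnion_le _ _).trans ?_
    rw [tsum_fintype]
    refine (Finset.sum_le_sum fun i _ => hi i).trans ?_
    rw [← Finset.sum_mul]
    gcongr
    exact le_self_add
  rw [← ENNReal.pow_le_pow_left_iff two_ne_zero, eLpNorm_two_sq]
  refine hsum.trans ?_
  have hK1 : 1 ≤ K := le_add_self
  calc K * (Y + ENNReal.ofReal δ ^ 2 * Z) ≤ K ^ 2 * (Y + ENNReal.ofReal δ ^ 2 * Z) := by
        gcongr
        exact le_self_pow₀ hK1 two_ne_zero
    _ ≤ K ^ 2 * (eLpNorm φ 2 (boundaryMeasure a) + ENNReal.ofReal δ *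
          eLpNorm (∇ φ) 2 (volume.restrict (boundaryStrip a c δ))) ^ 2 := by
        gcongr
        rw [add_sq, mul_pow, eLpNorm_two_sq, eLpNorm_two_sq]
        gcongr
        exact le_self_add
    _ = _ := by ring

/-! ### Uniqueness of traces -/

theorem eqOn_edgeSet_of_ae_eq {n : ℕ} (a : Polygon Plane n) (i : Fin n)
    (hne : a (finRotate n i) ≠ a i) {F G : Plane → ℝ} (hF : ContinuousOn F (a.edgeSet ℝ i))
    (hG : ContinuousOn G (a.edgeSet ℝ i)) (h : F =ᵐ[edgeMeasure a i] G) :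
    EqOn F G (a.edgeSet ℝ i) := by
  have hL : ENNReal.ofReal (dist (a i) (a (finRotate n i))) ≠ 0 := by simpa using hne.symm
  have h1 := ae_of_ae_map (continuous_edgePath a i).aemeasurable
    ((Measure.ae_ennreal_smul_measure_iff hL).1 h)
  have hm : MapsTo (a.edgePath ℝ i) (Icc 0 1) (a.edgeSet ℝ i) :=
    fun t ht => edgePath_mem a i ht.1 ht.2
  have h2 := Measure.eqOn_Icc_of_ae_eq volume zero_ne_one h1
    (hF.comp (continuous_edgePath a i).continuousOn hm)
    (hG.comp (continuous_edgePath a i).continuousOn hm)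
  rintro _ ⟨t, ht, rfl⟩
  exact h2 ht

theorem continuousOn_extendZero {P : Set Plane} (w : C(frontier P, ℝ)) :
    ContinuousOn (extendZero w) (frontier P) := by
  rw [continuousOn_iff_continuous_domRestrict]
  convert w.continuous using 1
  funext x
  exact extendZero_apply w x

theorem IsPolygonalElement.eq_zero_of_extendZero {n : ℕ} {P : Set Plane} {a : Polygon Plane n}
    (hP : IsPolygonalElement P a) {w : C(frontier P, ℝ)}
    (h : ∀ i, extendZero w =ᵐ[edgeMeasure a i] fun _ => 0) : w = 0 := by
  ext ⟨x, hx⟩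
  have hx' := hx
  rw [hP.frontier_eq] at hx'
  obtain ⟨i, hi⟩ := mem_iUnion.1 hx'
  have := eqOn_edgeSet_of_ae_eq a i (hP.ne i)
    ((continuousOn_extendZero w).mono (hP.edgeSet_subset i)) continuousOn_const (h i) hi
  rw [← extendZero_apply w ⟨x, hx⟩]
  exact this

/-- A trace inequality with a weight that is positive almost everywhere; this suffices to identify a
continuous trace. -/
theorem IsPolygonalElement.exists_lintegral_edge_le {n : ℕ} {P : Set Plane}
    {a : Polygon Plane n} (hP : IsPolygonalElement P a) (i : Fin n) :
    ∃ C : ℝ≥0∞, C ≠ ⊤ ∧ ∀ φ : Plane → ℝ, ContDiff ℝ ∞ φ →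
      ∫⁻ q in Icc (0 : ℝ) 1, ENNReal.ofReal (1 - q) * ‖φ (a.edgePath ℝ i q)‖ₑ ^ 2 ≤
        C * (eLpNorm φ 2 (areaMeasure P) ^ 2 + eLpNorm (∇ φ) 2 (areaMeasure P) ^ 2) := by
  obtain ⟨c, r, hc⟩ := hP.exists_isStarCenter
  obtain ⟨hme, κ, h0, ht, hv⟩ := hP.exists_volume_eq hc i
  refine ⟨2 * (1 + ‖a i - c‖ₑ ^ 2) / κ, ENNReal.div_ne_top (by finiteness) h0, fun φ hφ => ?_⟩
  refine (lintegral_mul_enorm_edge_le a c i hφ).trans ?_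
  have hcv : ∀ F : Plane → ℝ≥0∞, ∫⁻ z in triangleStrip 1, F (triangleMap a c i z) ≤
      (∫⁻ x, F x ∂(areaMeasure P)) / κ := by
    intro F
    rw [ENNReal.le_div_iff_mul_le (Or.inl h0) (Or.inl ht), mul_comm]
    have : ∫⁻ x in triangleMap a c i '' triangleStrip 1, F x =
        κ * ∫⁻ z in triangleStrip 1, F (triangleMap a c i z) := by
      nth_rw 1 [hv]
      rw [Measure.restrict_smul, lintegral_smul_measure, hme.restrict_map,
        hme.lintegral_map, preimage_image_eq _ hme.injective, smul_eq_mul]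
    rw [← this]
    exact lintegral_mono_set ((subset_iUnion_of_subset i subset_rfl).trans
      (hP.boundaryStrip_subset hc le_rfl))
  rw [eLpNorm_two_sq, eLpNorm_two_sq]
  set X := ∫⁻ x, ‖φ x‖ₑ ^ 2 ∂(areaMeasure P)
  set Y := ∫⁻ x, ‖∇ φ x‖ₑ ^ 2 ∂(areaMeasure P)
  calc _ ≤ 2 * (X / κ) + 2 * (‖a i - c‖ₑ ^ 2 * (Y / κ)) := by
        gcongr
        · exact hcv fun x => ‖φ x‖ₑ ^ 2
        · exact hcv fun x => ‖∇ φ x‖ₑ ^ 2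
    _ ≤ 2 * ((1 + ‖a i - c‖ₑ ^ 2) * (X / κ)) + 2 * ((1 + ‖a i - c‖ₑ ^ 2) * (Y / κ)) := by
        gcongr
        · exact le_mul_of_one_le_left zero_le le_self_add
        · exact le_add_self
    _ = _ := by
        simp only [div_eq_mul_inv]
        ring

/-- The approximants tend to `0` in `H¹(P)`, hence in weighted `L²` on each edge, where they also
tend to `w`. So `w` vanishes almost everywhere on the edge, and everywhere by continuity. -/
theorem HasTrace.eq_zero {n : ℕ} {P : Set Plane} {a : Polygon Plane n}
    (hP : IsPolygonalElement P a) {v : Plane → ℝ} {w : C(frontier P, ℝ)} (h : HasTrace P a v w)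
    (hv : v =ᵐ[areaMeasure P] fun _ => 0) : w = 0 := by
  obtain ⟨G, hG, φ, hφ, h1, h2, h3⟩ := h.congr hv
  have hG0 := hG.unique (hasWeakGradient_zero P)
  have h1' : Tendsto (fun m => eLpNorm (φ m) 2 (areaMeasure P)) atTop (𝓝 0) := by
    simpa using h1
  have h2' : Tendsto (fun m => eLpNorm (∇ (φ m)) 2 (areaMeasure P)) atTop (𝓝 0) := by
    refine h2.congr fun m => eLpNorm_congr_ae (hG0.mono fun x hx => ?_)
    simp [hx]
  refine hP.eq_zero_of_extendZero fun i => ?_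
  obtain ⟨C, hC, hle⟩ := hP.exists_lintegral_edge_le i
  set L := ENNReal.ofReal (dist (a i) (a (finRotate n i))) with hL
  have hL0 : L ≠ 0 := by simpa [hL] using (hP.ne i).symm
  have hLt : L ≠ ⊤ := ENNReal.ofReal_ne_top
  have hγ := (continuous_edgePath a i).measurable
  have hw : Measurable fun q => extendZero w (a.edgePath ℝ i q) :=
    (measurable_extendZero w).comp hγ
  have hmain : ∫⁻ q in Icc (0 : ℝ) 1, ENNReal.ofReal (1 - q) *
      ‖extendZero w (a.edgePath ℝ i q)‖ₑ ^ 2 = 0 := by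
    -- Split `w = φ m - (φ m - w)`: the weighted trace inequality controls the first term, and `1 -
    -- q ≤ 1` lets the unweighted boundary convergence control the second.
    have hb : ∀ m, ∫⁻ q in Icc (0 : ℝ) 1, ENNReal.ofReal (1 - q) *
        ‖extendZero w (a.edgePath ℝ i q)‖ₑ ^ 2 ≤
        2 * (C * (eLpNorm (φ m) 2 (areaMeasure P) ^ 2 + eLpNorm (∇ (φ m)) 2 (areaMeasure P) ^ 2))
        + 2 * (eLpNorm (fun x => φ m x - extendZero w x) 2 (boundaryMeasure a) ^ 2 / L) := by
      intro m
      have hm : Measurable fun x => ‖φ m x - extendZero w x‖ₑ ^ 2 :=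
        ((hφ m).continuous.measurable.sub (measurable_extendZero w)).enorm.pow_const 2
      have hd : ∫⁻ q in Icc (0 : ℝ) 1,
          ‖φ m (a.edgePath ℝ i q) - extendZero w (a.edgePath ℝ i q)‖ₑ ^ 2 ≤
          eLpNorm (fun x => φ m x - extendZero w x) 2 (boundaryMeasure a) ^ 2 / L := by
        rw [ENNReal.le_div_iff_mul_le (Or.inl hL0) (Or.inl hLt), mul_comm,
          ← lintegral_edgeMeasure a i hm, eLpNorm_two_sq]
        exact lintegral_mono' (edgeMeasure_le a i) le_rfl
      refine le_trans ?_ (add_le_add (mul_le_mul_right (hle (φ m) (hφ m)) 2)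
        (mul_le_mul_right hd 2))
      rw [← lintegral_const_mul' _ _ (by finiteness), ← lintegral_const_mul' _ _ (by finiteness)]
      have hm1 : Measurable fun q =>
          2 * (ENNReal.ofReal (1 - q) * ‖φ m (a.edgePath ℝ i q)‖ₑ ^ 2) :=
        Measurable.const_mul ((by fun_prop : Measurable fun q : ℝ => ENNReal.ofReal (1 - q)).mul
          (((hφ m).continuous.measurable.comp hγ).enorm.pow_const 2)) 2
      rw [← lintegral_add_left hm1]
      refine setLIntegral_mono' measurableSet_Icc fun q hq => ?_
      have hq1 : ENNReal.ofReal (1 - q) ≤ 1 := by simpa using hq.1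
      set A := φ m (a.edgePath ℝ i q)
      set B := extendZero w (a.edgePath ℝ i q)
      have hAB : ‖B‖ₑ ≤ ‖A‖ₑ + ‖A - B‖ₑ := by
        have : B = A - (A - B) := by ring
        nth_rw 1 [this]
        exact enorm_sub_le
      calc _ ≤ ENNReal.ofReal (1 - q) * (2 * ‖A‖ₑ ^ 2 + 2 * ‖A - B‖ₑ ^ 2) := by
            gcongr
            exact (pow_le_pow_left₀ zero_le hAB 2).trans (ENNReal.add_sq_le_two_mul _ _)
        _ = 2 * (ENNReal.ofReal (1 - q) * ‖A‖ₑ ^ 2) +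
            2 * (ENNReal.ofReal (1 - q) * ‖A - B‖ₑ ^ 2) := by ring
        _ ≤ _ := by
            gcongr
            exact mul_le_of_le_one_left zero_le hq1
    have ht : Tendsto (fun m =>
        2 * (C * (eLpNorm (φ m) 2 (areaMeasure P) ^ 2 + eLpNorm (∇ (φ m)) 2 (areaMeasure P) ^ 2))
        + 2 * (eLpNorm (fun x => φ m x - extendZero w x) 2 (boundaryMeasure a) ^ 2 / L))
        atTop (𝓝 (2 * (C * (0 ^ 2 + 0 ^ 2)) + 2 * (0 ^ 2 / L))) := by
      have e1 : Tendsto (fun m => eLpNorm (φ m) 2 (areaMeasure P) ^ 2 +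
          eLpNorm (∇ (φ m)) 2 (areaMeasure P) ^ 2) atTop (𝓝 (0 ^ 2 + 0 ^ 2)) :=
        (ENNReal.Tendsto.pow h1').add (ENNReal.Tendsto.pow h2')
      have e2 := ENNReal.Tendsto.const_mul e1 (Or.inr hC)
      have e3 := ENNReal.Tendsto.const_mul e2 (Or.inr (ENNReal.ofNat_ne_top (n := 2)))
      have e4 := ENNReal.Tendsto.div_const (ENNReal.Tendsto.pow (n := 2) h3) (b := L) (Or.inr hL0)
      have e5 := ENNReal.Tendsto.const_mul e4 (Or.inr (ENNReal.ofNat_ne_top (n := 2)))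
      exact e3.add e5
    have := ge_of_tendsto' ht hb
    simpa using this
  have hm2 : Measurable fun q =>
      ENNReal.ofReal (1 - q) * ‖extendZero w (a.edgePath ℝ i q)‖ₑ ^ 2 :=
    (by fun_prop : Measurable fun q : ℝ => ENNReal.ofReal (1 - q)).mul (hw.enorm.pow_const 2)
  rw [lintegral_eq_zero_iff hm2] at hmain
  refine Measure.ae_smul_measure ?_ _
  refine (ae_map_iff hγ.aemeasurable
    (measurableSet_eq_fun (measurable_extendZero w) measurable_const)).2 ?_
  have hne : ∀ᵐ q ∂(volume.restrict (Icc (0 : ℝ) 1)), q ≠ 1 :=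
    ae_restrict_of_ae (Measure.ae_ne volume 1)
  filter_upwards [hmain, hne, ae_restrict_mem measurableSet_Icc] with q hq hq1 hqm
  have hpos : 0 < 1 - q := sub_pos.2 (lt_of_le_of_ne hqm.2 hq1)
  simp only [Pi.zero_apply, mul_eq_zero, ENNReal.ofReal_eq_zero, not_le.2 hpos,
    false_or] at hq
  simpa using hq

theorem HasTrace.unique {n : ℕ} {P : Set Plane} {a : Polygon Plane n}
    (hP : IsPolygonalElement P a) {v : Plane → ℝ} {w z : C(frontier P, ℝ)}
    (hw : HasTrace P a v w) (hz : HasTrace P a v z) : w = z := by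
  have := (hw.smul_add hz (-1)).eq_zero hP (.of_forall fun x => by ring)
  rw [neg_one_smul, neg_add_eq_zero] at this
  exact this

/-! ### Cutoff functions -/

/-- Convolution with a probability density preserves the Lipschitz constant and the range, and
changes nothing where `h` is constant on the scale `ε`. -/
theorem LipschitzWith.exists_contDiff_approx {h : Plane → ℝ} {K : NNReal} (hL : LipschitzWith K h)
    (h01 : ∀ x, h x ∈ Icc (0 : ℝ) 1) {ε : ℝ} (hε : 0 < ε) :
    ∃ χ : Plane → ℝ, ContDiff ℝ ∞ χ ∧ LipschitzWith K χ ∧ (∀ x, χ x ∈ Icc (0 : ℝ) 1) ∧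
      ∀ x, (∀ y ∈ Metric.ball x ε, h y = h x) → χ x = h x := by
  let φ : ContDiffBump (0 : Plane) := ⟨ε / 2, ε, half_pos hε, half_lt_self hε⟩
  have hint : ∀ x, Integrable fun t => φ.normed volume t * h (x - t) := fun x =>
    (φ.continuous_normed.mul (hL.continuous.comp (by fun_prop))).integrable_of_hasCompactSupport
      φ.hasCompactSupport_normed.mul_right
  refine ⟨convolution (φ.normed volume) h (ContinuousLinearMap.lsmul ℝ ℝ) volume, ?_, ?_, ?_, ?_⟩
  · exact φ.hasCompactSupport_normed.contDiff_convolution_left _ φ.contDiff_normed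
      hL.continuous.locallyIntegrable
  · refine LipschitzWith.of_dist_le_mul fun x y => ?_
    simp only [convolution_def, ContinuousLinearMap.lsmul_apply, smul_eq_mul, dist_eq_norm]
    rw [← integral_sub (hint x) (hint y)]
    refine (norm_integral_le_of_norm_le (φ.integrable_normed.mul_const (K * ‖x - y‖))
      (.of_forall fun t => ?_)).trans_eq ?_
    · rw [← mul_sub, norm_mul, Real.norm_of_nonneg (φ.nonneg_normed t)]
      refine mul_le_mul_of_nonneg_left ?_ (φ.nonneg_normed t)
      have := hL.dist_le_mul (x - t) (y - t)
      rwa [dist_eq_norm, dist_eq_norm, sub_sub_sub_cancel_right] at this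
    · rw [integral_mul_const, φ.integral_normed, one_mul]
  · intro x
    -- The interval `[0, 1]` is the closed ball of radius `1/2` about `1/2`, so staying in it is a
    -- distance bound.
    have := dist_convolution_le (μ := volume) (x₀ := x) (z₀ := (1 / 2 : ℝ)) (ε := 1 / 2) (g := h)
      (by norm_num) φ.support_normed_eq.subset φ.nonneg_normed φ.integral_normed
      hL.continuous.aestronglyMeasurable fun y _ => by
        rw [Real.dist_eq, abs_le]
        constructor <;> linarith [(h01 y).1, (h01 y).2]
    rw [Real.dist_eq, abs_le] at this
    constructor <;> linarith [this.1, this.2]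
  · exact fun x hx => φ.normed_convolution_eq_right hx

theorem norm_gradient_eq (φ : Plane → ℝ) (x : Plane) : ‖∇ φ x‖ = ‖fderiv ℝ φ x‖ := by
  simp [gradient]

/-- Cutoff functions which equal `1` outside the strip of relative depth `δ`, with gradient
`O(1/δ)`. -/
theorem IsPolygonalElement.exists_cutoff {n : ℕ} {P : Set Plane}
    {a : Polygon Plane n} (hP : IsPolygonalElement P a) {c : Plane} {r : ℝ}
    (hc : IsStarCenter P c r) {δ : ℝ} (hδ0 : 0 < δ) (hδ1 : δ ≤ 1) :
    ∃ χ : Plane → ℝ, IsTestFunction (interior P) χ ∧ (∀ x, χ x ∈ Icc (0 : ℝ) 1) ∧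
      (∀ x, ‖∇ χ x‖ ≤ 4 / r / δ) ∧
      ∀ x ∈ interior P, x ∉ boundaryStrip a c δ → χ x = 1 ∧ ∇ χ x = 0 := by
  set ρ := δ * r with hρ
  have hρ0 : 0 < ρ := mul_pos hδ0 hc.pos
  set D : Plane → ℝ := fun x => Metric.infDist x (interior P)ᶜ with hD
  have hDL : LipschitzWith 1 D := Metric.lipschitz_infDist_pt _
  have hne : (interior P)ᶜ.Nonempty :=
    ⟨a ⟨0, by have := hP.three_le; omega⟩, (hP.vertex_mem _).2⟩
  -- As a function of the distance `D` to the complement, `h` rises from `0` at `ρ/2` to `1` at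
  -- `3ρ/4`. Mollifying at scale `ρ/8` leaves `0` where `D < ρ/4` and `1` where `D ≥ ρ`.
  set h : Plane → ℝ := fun x => max 0 (min 1 (4 / ρ * D x - 2)) with hh
  have hK : (0 : ℝ) ≤ 4 / ρ := by positivity
  have hL : LipschitzWith (4 / ρ).toNNReal h := by
    refine LipschitzWith.const_max (LipschitzWith.const_min ?_ 1) 0
    refine LipschitzWith.of_dist_le_mul fun x y => ?_
    rw [Real.coe_toNNReal _ hK, Real.dist_eq, sub_sub_sub_cancel_right, ← mul_sub, abs_mul,
      abs_of_nonneg hK]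
    refine mul_le_mul_of_nonneg_left ?_ hK
    simpa [Real.dist_eq] using hDL.dist_le_mul x y
  have h01 : ∀ x, h x ∈ Icc (0 : ℝ) 1 := fun x =>
    ⟨le_max_left _ _, max_le zero_le_one (min_le_left _ _)⟩
  obtain ⟨χ, hχ, hχL, hχ01, hχeq⟩ := hL.exists_contDiff_approx h01 (ε := ρ / 8) (by positivity)
  have hDb : ∀ x, ∀ y ∈ Metric.ball x (ρ / 8), |D y - D x| < ρ / 8 := by
    intro x y hy
    have := hDL.dist_le_mul y x
    rw [NNReal.coe_one, one_mul, Real.dist_eq] at this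
    exact this.trans_lt hy
  have hzero : ∀ x, D x < ρ / 4 → χ x = 0 := by
    intro x hx
    have : ∀ y, D y < 3 / 8 * ρ → h y = 0 := by
      intro y hy
      refine max_eq_left (min_le_of_right_le ?_)
      rw [sub_nonpos, div_mul_eq_mul_div, div_le_iff₀ hρ0]
      linarith
    rw [hχeq x, this x (by linarith)]
    intro y hy
    have := (abs_lt.1 (hDb x y hy)).2
    rw [‹∀ y, D y < 3 / 8 * ρ → h y = 0› y (by linarith),
      ‹∀ y, D y < 3 / 8 * ρ → h y = 0› x (by linarith)]
  have hone : ∀ x, ρ ≤ D x → χ x = 1 := by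
    intro x hx
    have h1 : ∀ y, 3 / 4 * ρ ≤ D y → h y = 1 := by
      intro y hy
      have : 1 ≤ 4 / ρ * D y - 2 := by
        rw [le_sub_iff_add_le, div_mul_eq_mul_div, le_div_iff₀ hρ0]
        linarith
      simp [hh, min_eq_left this]
    rw [hχeq x, h1 x (by linarith)]
    intro y hy
    have := (abs_lt.1 (hDb x y hy)).1
    rw [h1 y (by linarith), h1 x (by linarith)]
  have hsupp : tsupport χ ⊆ {x | ρ / 4 ≤ D x} := by
    refine closure_minimal (fun x hx => ?_) (isClosed_le continuous_const hDL.continuous)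
    by_contra hlt
    exact hx (hzero x (not_le.1 hlt))
  have hsub : tsupport χ ⊆ interior P := by
    refine hsupp.trans fun x hx => ?_
    by_contra hnot
    have h0 : D x = 0 := Metric.infDist_zero_of_mem hnot
    have : ρ / 4 ≤ D x := hx
    linarith
  refine ⟨χ, ⟨hχ, ?_, hsub⟩, hχ01, fun x => ?_, fun x hx hxs => ?_⟩
  · exact hP.isCompact.of_isClosed_subset (isClosed_tsupport _) (hsub.trans interior_subset)
  · rw [norm_gradient_eq]
    refine (norm_fderiv_le_of_lipschitz ℝ hχL).trans_eq ?_
    rw [Real.coe_toNNReal _ hK, hρ, div_div, mul_comm r]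
  · have h1 : χ x = 1 := by
      refine hone x ((Metric.le_infDist hne).2 fun y hy => ?_)
      by_contra hlt
      refine hy (hP.ball_subset_of_notMem_boundaryStrip hc hδ1 hx hxs ?_)
      rw [Metric.mem_ball, dist_comm]
      exact not_le.1 hlt
    refine ⟨h1, ?_⟩
    -- The value `1` is a global maximum of `χ`, so the gradient vanishes there even if `χ` is not
    -- locally constant.
    have hmax : IsLocalMax χ x := .of_forall fun y => h1 ▸ (hχ01 y).2
    simp [gradient, hmax.fderiv_eq_zero]

/-! ### Weak gradients of smooth functions and of limits -/

theorem tendsto_integral_inner {F : Type*} [NormedAddCommGroup F] [InnerProductSpace ℝ F]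
    {μ : Measure Plane} {f : ℕ → Plane → F} {f₀ g : Plane → F} (hf : ∀ m, MemLp (f m) 2 μ)
    (hf₀ : MemLp f₀ 2 μ) (hg : MemLp g 2 μ)
    (h : Tendsto (fun m => eLpNorm (fun x => f m x - f₀ x) 2 μ) atTop (𝓝 0)) :
    Tendsto (fun m => ∫ x, inner ℝ (g x) (f m x) ∂μ) atTop (𝓝 (∫ x, inner ℝ (g x) (f₀ x) ∂μ)) := by
  have h1 := (Lp.tendsto_Lp_iff_tendsto_eLpNorm'' f hf f₀ hf₀).2 h
  have h2 : ∀ u (hu : MemLp u 2 μ), inner ℝ (hg.toLp g) (hu.toLp u) =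
      ∫ x, inner ℝ (g x) (u x) ∂μ := by
    intro u hu
    rw [L2.inner_def]
    refine integral_congr_ae ?_
    filter_upwards [hg.coeFn_toLp, hu.coeFn_toLp] with x hx hy
    rw [hx, hy]
  simp only [← h2 _ (hf _), ← h2 _ hf₀]
  exact tendsto_const_nhds.inner h1

theorem IsCompact.isFiniteMeasure_areaMeasure {P : Set Plane} (hP : IsCompact P) :
    IsFiniteMeasure (areaMeasure P) :=
  ⟨by
    rw [Measure.restrict_apply_univ]
    exact (measure_mono interior_subset).trans_lt hP.measure_lt_top⟩

theorem memLp_of_continuousOn {F : Type*} [NormedAddCommGroup F] {P : Set Plane}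
    (hP : IsCompact P) {f : Plane → F} (hf : ContinuousOn f P) (p : ℝ≥0∞) :
    MemLp f p (areaMeasure P) := by
  have := hP.isFiniteMeasure_areaMeasure
  obtain ⟨C, hC⟩ := hP.exists_bound_of_continuousOn hf
  have hm : AEStronglyMeasurable f (areaMeasure P) :=
    AEStronglyMeasurable.mono_measure
      (hf.aestronglyMeasurable_of_isCompact hP hP.measurableSet)
      (Measure.restrict_mono interior_subset le_rfl)
  refine MemLp.of_bound hm C ?_
  filter_upwards [ae_restrict_mem isOpen_interior.measurableSet] with x hx
  exact hC x (interior_subset hx)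

theorem inner_gradient (φ : Plane → ℝ) (x e : Plane) : inner ℝ e (∇ φ x) = fderiv ℝ φ x e := by
  rw [real_inner_comm]
  simp [gradient]

theorem IsTestFunction.gradient_eq_zero {D : Set Plane} {φ : Plane → ℝ}
    (h : IsTestFunction D φ) {x : Plane} (hx : x ∉ D) : ∇ φ x = 0 := by
  have : fderiv ℝ φ x = 0 := by
    by_contra hne
    exact hx (h.support_subset (support_fderiv_subset ℝ hne))
  simp [gradient, this]

theorem IsTestFunction.eq_zero {D : Set Plane} {φ : Plane → ℝ}
    (h : IsTestFunction D φ) {x : Plane} (hx : x ∉ D) : φ x = 0 :=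
  image_eq_zero_of_notMem_tsupport fun hx' => hx (h.support_subset hx')

theorem integrable_smul_of_memLp {F : Type*} [NormedAddCommGroup F] [NormedSpace ℝ F]
    {μ : Measure Plane} {f : Plane → ℝ} {g : Plane → F} (hf : MemLp f 2 μ) (hg : MemLp g 2 μ) :
    Integrable (fun x => f x • g x) μ :=
  memLp_one_iff_integrable.1 (hg.smul hf (p := 2) (q := 2) (r := 1))

theorem hasWeakGradient_of_contDiff {P : Set Plane} (hP : IsCompact P) {φ : Plane → ℝ}
    (hφ : ContDiff ℝ ∞ φ) : HasWeakGradient P φ (∇ φ) where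
  memLp := memLp_of_continuousOn hP hφ.continuous.continuousOn 2
  memLp_grad := memLp_of_continuousOn hP (continuous_gradient hφ).continuousOn 2
  integral_eq ψ hψ := by
    have hφc := hφ.continuous
    have hgφ := continuous_gradient hφ
    have hψc := hψ.smooth.continuous
    have hgψ := continuous_gradient hψ.smooth
    rw [setIntegral_eq_integral_of_forall_compl_eq_zero fun x hx => by
      rw [hψ.gradient_eq_zero hx, smul_zero],
      setIntegral_eq_integral_of_forall_compl_eq_zero fun x hx => by rw [hψ.eq_zero hx, zero_smul]]
    have i1 : Integrable (fun x => φ x • ∇ ψ x) :=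
      (hφc.smul hgψ).integrable_of_hasCompactSupport hψ.hasCompactSupport_gradient.smul_left
    have i2 : Integrable (fun x => ψ x • ∇ φ x) :=
      (hψc.smul hgφ).integrable_of_hasCompactSupport hψ.compactSupport.smul_right
    -- Testing the vector identity against each direction `e` reduces it to scalar integration by
    -- parts.
    refine ext_inner_left ℝ fun e => ?_
    rw [inner_neg_right, ← integral_inner i1, ← integral_inner i2]
    simp only [inner_smul_right, inner_gradient]
    have j1 := i1.const_inner (𝕜 := ℝ) e
    have j2 := i2.const_inner (𝕜 := ℝ) e
    simp only [inner_smul_right, inner_gradient] at j1 j2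
    rw [integral_mul_fderiv_eq_neg_fderiv_mul_of_integrable (by simpa only [mul_comm] using j2) j1
      ((hφc.mul hψc).integrable_of_hasCompactSupport hψ.compactSupport.mul_left)
      (fun x _ => hφ.differentiable (by simp) x) (fun x _ => hψ.smooth.differentiable (by simp) x)]
    simp only [mul_comm]

/-- For a fixed test function, both sides of the defining identity are continuous in `L²`. -/
theorem HasWeakGradient.of_tendsto {P : Set Plane} {v : Plane → ℝ} {G : Plane → Plane}
    {φ : ℕ → Plane → ℝ} {H : ℕ → Plane → Plane} (h : ∀ m, HasWeakGradient P (φ m) (H m))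
    (hv : MemLp v 2 (areaMeasure P)) (hG : MemLp G 2 (areaMeasure P))
    (h1 : Tendsto (fun m => eLpNorm (fun x => φ m x - v x) 2 (areaMeasure P)) atTop (𝓝 0))
    (h2 : Tendsto (fun m => eLpNorm (fun x => H m x - G x) 2 (areaMeasure P)) atTop (𝓝 0)) :
    HasWeakGradient P v G where
  memLp := hv
  memLp_grad := hG
  integral_eq ψ hψ := by
    have hψm := hψ.memLp (areaMeasure P)
    have hψg := hψ.memLp_gradient (areaMeasure P)
    refine ext_inner_left ℝ fun e => ?_
    rw [inner_neg_right, ← integral_inner (integrable_smul_of_memLp hv hψg),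
      ← integral_inner (integrable_smul_of_memLp hψm hG)]
    have hψe : MemLp (fun x => inner ℝ e (∇ ψ x)) 2 (areaMeasure P) := hψg.const_inner e
    have hψs : MemLp (fun x => ψ x • e) 2 (areaMeasure P) :=
      (hψ.smooth.continuous.smul continuous_const).memLp_of_hasCompactSupport
        hψ.compactSupport.smul_right
    have t1 := tendsto_integral_inner (fun m => (h m).memLp) hv hψe h1
    have t2 := tendsto_integral_inner (fun m => (h m).memLp_grad) hG hψs h2
    have e1 : ∀ m, ∫ x, inner ℝ (inner ℝ e (∇ ψ x)) (φ m x) ∂(areaMeasure P) =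
        - ∫ x, inner ℝ (ψ x • e) (H m x) ∂(areaMeasure P) := by
      intro m
      have := congrArg (fun z => inner ℝ e z) ((h m).integral_eq ψ hψ)
      simp only [inner_neg_right] at this
      rw [← integral_inner (integrable_smul_of_memLp (h m).memLp hψg),
        ← integral_inner (integrable_smul_of_memLp hψm (h m).memLp_grad)] at this
      simp only [inner_smul_right] at this
      simpa [real_inner_smul_left] using this
    simp only [e1] at t1
    have := tendsto_nhds_unique t1 t2.neg
    simpa [real_inner_smul_left, inner_smul_right] using this

/-! ### Functions with vanishing trace -/

/-- `v ∈ H¹₀(P)` with weak gradient `G`: the pair is a limit of test functions. -/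
structure IsTestLimit (P : Set Plane) (v : Plane → ℝ) (G : Plane → Plane) : Prop where
  memLp : MemLp v 2 (areaMeasure P)
  memLp_grad : MemLp G 2 (areaMeasure P)
  exists_seq : ∃ φ : ℕ → Plane → ℝ, (∀ m, IsTestFunction (interior P) (φ m)) ∧
    Tendsto (fun m => eLpNorm (fun x => φ m x - v x) 2 (areaMeasure P)) atTop (𝓝 0) ∧
    Tendsto (fun m => eLpNorm (fun x => ∇ (φ m) x - G x) 2 (areaMeasure P)) atTop (𝓝 0)

theorem IsTestLimit.of_forall {P : Set Plane} {v : Plane → ℝ} {G : Plane → Plane}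
    (hv : MemLp v 2 (areaMeasure P)) (hG : MemLp G 2 (areaMeasure P))
    (h : ∀ ε : ℝ≥0∞, ε ≠ 0 → ∃ φ, IsTestFunction (interior P) φ ∧
      eLpNorm (fun x => φ x - v x) 2 (areaMeasure P) ≤ ε ∧
      eLpNorm (fun x => ∇ φ x - G x) 2 (areaMeasure P) ≤ ε) : IsTestLimit P v G := by
  choose φ h1 h2 h3 using fun m : ℕ => h ((m : ℝ≥0∞)⁻¹) (by simp)
  exact ⟨hv, hG, φ, h1,
    tendsto_of_tendsto_of_tendsto_of_le_of_le tendsto_const_nhds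
      ENNReal.tendsto_inv_nat_nhds_zero (fun _ => zero_le) h2,
    tendsto_of_tendsto_of_tendsto_of_le_of_le tendsto_const_nhds
      ENNReal.tendsto_inv_nat_nhds_zero (fun _ => zero_le) h3⟩

theorem IsPolygonalElement.areaMeasure_restrict_boundaryStrip {n : ℕ} {P : Set Plane}
    {a : Polygon Plane n} (hP : IsPolygonalElement P a) {c : Plane} {r : ℝ}
    (hc : IsStarCenter P c r) {δ : ℝ} (hδ : δ ≤ 1) :
    (areaMeasure P).restrict (boundaryStrip a c δ) = volume.restrict (boundaryStrip a c δ) := by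
  rw [areaMeasure, Measure.restrict_restrict (hP.measurableSet_boundaryStrip hc δ),
    inter_eq_left.2 (hP.boundaryStrip_subset hc hδ)]

/-- The centre is a null set, so strip estimates at depth `1` are estimates on all of `P`. -/
theorem IsPolygonalElement.areaMeasure_eq {n : ℕ} {P : Set Plane}
    {a : Polygon Plane n} (hP : IsPolygonalElement P a) {c : Plane} {r : ℝ}
    (hc : IsStarCenter P c r) : areaMeasure P = volume.restrict (boundaryStrip a c 1) := by
  refine Measure.restrict_congr_set ?_
  refine Filter.EventuallyLE.antisymm ?_
    (LE.le.eventuallyLE (hP.boundaryStrip_subset hc le_rfl))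
  filter_upwards [Measure.ae_ne volume c] with x hx hxP
  exact (hP.interior_subset_insert c hxP).resolve_left hx

theorem IsPolygonalElement.eLpNorm_boundary_eq_zero {n : ℕ} {P : Set Plane}
    {a : Polygon Plane n} (hP : IsPolygonalElement P a) {φ : Plane → ℝ}
    (hφ : ∀ x ∈ frontier P, φ x = 0) : eLpNorm φ 2 (boundaryMeasure a) = 0 := by
  have : φ =ᵐ[boundaryMeasure a] 0 := by
    rw [boundaryMeasure, ← Measure.sum_fintype, Filter.EventuallyEq, Measure.ae_sum_iff]
    intro i
    filter_upwards [ae_mem_edgeSet a i] with x hx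
    exact hφ x (hP.edgeSet_subset i hx)
  rw [eLpNorm_congr_ae this, eLpNorm_zero]

theorem IsTestFunction.eq_zero_of_mem_frontier {P : Set Plane} {φ : Plane → ℝ}
    (hφ : IsTestFunction (interior P) φ) {x : Plane} (hx : x ∈ frontier P) : φ x = 0 :=
  image_eq_zero_of_notMem_tsupport fun h => hx.2 (hφ.support_subset h)

/-- Poincaré's inequality. -/
theorem IsPolygonalElement.exists_poincare {n : ℕ} {P : Set Plane}
    {a : Polygon Plane n} (hP : IsPolygonalElement P a) :
    ∃ C : ℝ≥0∞, C ≠ ⊤ ∧ ∀ φ, IsTestFunction (interior P) φ →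
      eLpNorm φ 2 (areaMeasure P) ≤ C * eLpNorm (∇ φ) 2 (areaMeasure P) := by
  obtain ⟨c, r, hc⟩ := hP.exists_isStarCenter
  obtain ⟨C, hC, h⟩ := hP.exists_eLpNorm_boundaryStrip_le hc
  refine ⟨C, hC, fun φ hφ => ?_⟩
  -- At depth `1` the strip is all of `P` up to a null set, and the boundary term vanishes.
  have := h φ hφ.smooth 1 le_rfl
  rwa [hP.eLpNorm_boundary_eq_zero fun x hx => hφ.eq_zero_of_mem_frontier hx, zero_add,
    ENNReal.ofReal_one, one_mul, ← hP.areaMeasure_eq hc] at this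

theorem IsTestLimit.hasWeakGradient {P : Set Plane} (hP : IsCompact P) {v : Plane → ℝ}
    {G : Plane → Plane} (h : IsTestLimit P v G) : HasWeakGradient P v G := by
  obtain ⟨φ, hφ, h1, h2⟩ := h.exists_seq
  exact HasWeakGradient.of_tendsto (fun m => hasWeakGradient_of_contDiff hP (hφ m).smooth)
    h.memLp h.memLp_grad h1 h2

theorem IsTestLimit.hasTrace_zero {n : ℕ} {P : Set Plane} {a : Polygon Plane n}
    (hP : IsPolygonalElement P a) {v : Plane → ℝ} {G : Plane → Plane}
    (h : IsTestLimit P v G) : HasTrace P a v 0 := by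
  obtain ⟨φ, hφ, h1, h2⟩ := h.exists_seq
  refine ⟨G, h.hasWeakGradient hP.isCompact, φ, fun m => (hφ m).smooth, h1, h2, ?_⟩
  have : ∀ m, eLpNorm (fun x => φ m x - extendZero (0 : C(frontier P, ℝ)) x) 2
      (boundaryMeasure a) = 0 := by
    intro m
    refine hP.eLpNorm_boundary_eq_zero fun x hx => ?_
    rw [(hφ m).eq_zero_of_mem_frontier hx, zero_sub, neg_eq_zero]
    exact extendZero_apply 0 ⟨x, hx⟩
  simp [this]

theorem gradient_mul {φ ψ : Plane → ℝ} {x : Plane} (hφ : DifferentiableAt ℝ φ x)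
    (hψ : DifferentiableAt ℝ ψ x) :
    ∇ (fun x => φ x * ψ x) x = φ x • ∇ ψ x + ψ x • ∇ φ x := by
  simp only [gradient]
  rw [fderiv_fun_mul hφ hψ]
  simp

/-- The strip estimate passes to the limit along the smooth approximants, whose boundary norms tend
to `0`. The surviving factor `δ` later cancels the `1/δ` in the gradient of the cutoff. -/
theorem IsPolygonalElement.exists_eLpNorm_boundaryStrip_le_of_hasTrace {n : ℕ} {P : Set Plane}
    {a : Polygon Plane n} (hP : IsPolygonalElement P a) {c : Plane} {r : ℝ}
    (hc : IsStarCenter P c r) : ∃ C : ℝ≥0∞, C ≠ ⊤ ∧ ∀ (v : Plane → ℝ) (G : Plane → Plane),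
      HasTrace P a v 0 → HasWeakGradient P v G → ∀ δ ≤ 1,
      eLpNorm v 2 (volume.restrict (boundaryStrip a c δ)) ≤
        C * (ENNReal.ofReal δ * eLpNorm G 2 (volume.restrict (boundaryStrip a c δ))) := by
  obtain ⟨C, hC, hle⟩ := hP.exists_eLpNorm_boundaryStrip_le hc
  refine ⟨C, hC, fun v G hv hG δ hδ => ?_⟩
  obtain ⟨G', hG', φ, hφ, h1, h2, h3⟩ := hv
  have hGG := hG'.unique hG
  have hν : volume.restrict (boundaryStrip a c δ) ≤ areaMeasure P :=
    Measure.restrict_mono (hP.boundaryStrip_subset hc hδ) le_rfl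
  set ν : Measure Plane := volume.restrict (boundaryStrip a c δ) with hνdef
  have h2' : Tendsto (fun m => eLpNorm (fun x => ∇ (φ m) x - G x) 2 (areaMeasure P))
      atTop (𝓝 0) := by
    refine h2.congr fun m => eLpNorm_congr_ae (hGG.mono fun x hx => ?_)
    simp only [hx]
  have hext : ∀ x, extendZero (0 : C(frontier P, ℝ)) x = 0 := fun x => by
    simpa using extendZero_smul_add (-1) (0 : C(frontier P, ℝ)) 0 x
  simp only [hext, sub_zero] at h3
  have hb : ∀ m, eLpNorm v 2 ν ≤ eLpNorm (fun x => φ m x - v x) 2 (areaMeasure P) +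
      C * (eLpNorm (φ m) 2 (boundaryMeasure a) + ENNReal.ofReal δ *
        (eLpNorm (fun x => ∇ (φ m) x - G x) 2 (areaMeasure P) + eLpNorm G 2 ν)) := by
    intro m
    have hvm := hG.memLp.1.mono_measure hν
    have hGm := hG.memLp_grad.1.mono_measure hν
    have hφm : AEStronglyMeasurable (φ m) ν := (hφ m).continuous.aestronglyMeasurable
    have hgm : AEStronglyMeasurable (∇ (φ m)) ν := (continuous_gradient (hφ m)).aestronglyMeasurable
    have e1 : eLpNorm v 2 ν ≤ eLpNorm (fun x => φ m x - v x) 2 ν + eLpNorm (φ m) 2 ν := by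
      have : v = fun x => φ m x - (φ m x - v x) := by funext x; ring
      nth_rw 1 [this]
      rw [add_comm]
      exact eLpNorm_sub_le hφm (hφm.sub hvm) (by norm_num)
    have e2 : eLpNorm (∇ (φ m)) 2 ν ≤ eLpNorm (fun x => ∇ (φ m) x - G x) 2 ν + eLpNorm G 2 ν := by
      have : ∇ (φ m) = fun x => (∇ (φ m) x - G x) + G x := by funext x; simp
      nth_rw 1 [this]
      exact eLpNorm_add_le (hgm.sub hGm) hGm (by norm_num)
    refine e1.trans (add_le_add (eLpNorm_mono_measure _ hν) ?_)
    refine (hle (φ m) (hφ m) δ hδ).trans ?_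
    gcongr
    exact e2.trans (add_le_add (eLpNorm_mono_measure _ hν) le_rfl)
  have ht : Tendsto (fun m => eLpNorm (fun x => φ m x - v x) 2 (areaMeasure P) +
      C * (eLpNorm (φ m) 2 (boundaryMeasure a) + ENNReal.ofReal δ *
        (eLpNorm (fun x => ∇ (φ m) x - G x) 2 (areaMeasure P) + eLpNorm G 2 ν))) atTop
      (𝓝 (0 + C * (0 + ENNReal.ofReal δ * (0 + eLpNorm G 2 ν)))) := by
    refine h1.add (ENNReal.Tendsto.const_mul (h3.add (ENNReal.Tendsto.const_mul
      (h2'.add tendsto_const_nhds) (Or.inr ENNReal.ofReal_ne_top))) (Or.inr hC))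
  have := ge_of_tendsto' ht hb
  simpa using this

theorem eLpNorm_le_of_eq_zero_off {F : Type*} [NormedAddCommGroup F] {n : ℕ} {P : Set Plane}
    {a : Polygon Plane n} (hP : IsPolygonalElement P a) {c : Plane} {r : ℝ}
    (hc : IsStarCenter P c r) {δ : ℝ} (hδ : δ ≤ 1) {K : ℝ} {f : Plane → F} {E : Type*}
    [NormedAddCommGroup E] {g : Plane → E}
    (h0 : ∀ x ∈ interior P, x ∉ boundaryStrip a c δ → f x = 0) (hfg : ∀ x, ‖f x‖ ≤ K * ‖g x‖) :
    eLpNorm f 2 (areaMeasure P) ≤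
      ENNReal.ofReal K * eLpNorm g 2 (volume.restrict (boundaryStrip a c δ)) := by
  rw [← hP.areaMeasure_restrict_boundaryStrip hc hδ]
  have : f =ᵐ[areaMeasure P] (boundaryStrip a c δ).indicator f := by
    filter_upwards [ae_restrict_mem isOpen_interior.measurableSet] with x hx
    by_cases hxs : x ∈ boundaryStrip a c δ
    · rw [indicator_of_mem hxs]
    · rw [indicator_of_notMem hxs, h0 x hx hxs]
  rw [eLpNorm_congr_ae this,
    eLpNorm_indicator_eq_eLpNorm_restrict (hP.measurableSet_boundaryStrip hc δ)]
  exact eLpNorm_le_mul_eLpNorm_of_ae_le_mul (.of_forall hfg) 2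

/-- Absolute continuity of the integral, since the strip has area `O(δ)`. -/
theorem IsPolygonalElement.exists_eLpNorm_strip_le {n : ℕ} {P : Set Plane}
    {a : Polygon Plane n} (hP : IsPolygonalElement P a) {c : Plane} {r : ℝ}
    (hc : IsStarCenter P c r) {G : Plane → Plane} (hG : MemLp G 2 (areaMeasure P)) {ε : ℝ≥0∞}
    (hε : ε ≠ 0) : ∃ δ : ℝ, 0 < δ ∧ δ ≤ 1 ∧
      eLpNorm G 2 (volume.restrict (boundaryStrip a c δ)) ≤ ε := by
  obtain ⟨ε', hε', hle⟩ : ∃ ε' : ℝ, 0 < ε' ∧ ENNReal.ofReal ε' ≤ ε := by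
    rcases eq_or_ne ε ⊤ with rfl | ht
    · exact ⟨1, one_pos, le_top⟩
    · exact ⟨ε.toReal, ENNReal.toReal_pos hε ht, ENNReal.ofReal_toReal_le⟩
  obtain ⟨η, hη, h⟩ := hG.eLpNorm_indicator_le (by norm_num) (by norm_num) hε'
  obtain ⟨C, hC, hvol⟩ := hP.exists_volume_boundaryStrip_le hc
  refine ⟨min 1 (η / (C.toReal + 1)), lt_min one_pos (by positivity), min_le_left _ _, ?_⟩
  set δ := min 1 (η / (C.toReal + 1)) with hδ
  have hm := hP.measurableSet_boundaryStrip hc δ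
  rw [← hP.areaMeasure_restrict_boundaryStrip hc (min_le_left _ _),
    ← eLpNorm_indicator_eq_eLpNorm_restrict hm]
  refine (h _ hm ?_).trans hle
  refine (Measure.restrict_apply_le _ _).trans ((hvol δ (min_le_left _ _)).trans ?_)
  rw [← ENNReal.ofReal_toReal hC, ← ENNReal.ofReal_mul ENNReal.toReal_nonneg]
  refine ENNReal.ofReal_le_ofReal ?_
  calc C.toReal * δ ≤ C.toReal * (η / (C.toReal + 1)) := by gcongr; exact min_le_right _ _
    _ = η * (C.toReal / (C.toReal + 1)) := by ring
    _ ≤ η * 1 := by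
        gcongr
        rw [div_le_one (by positivity)]
        linarith
    _ = η := mul_one η

/-- A function in `H¹(P)` with vanishing trace is a limit of test functions. -/
theorem HasTrace.isTestLimit {n : ℕ} {P : Set Plane} {a : Polygon Plane n}
    (hP : IsPolygonalElement P a) {v : Plane → ℝ} {G : Plane → Plane} (hv : HasTrace P a v 0)
    (hG : HasWeakGradient P v G) : IsTestLimit P v G := by
  obtain ⟨c, r, hc⟩ := hP.exists_isStarCenter
  obtain ⟨C, hC, hstrip⟩ := hP.exists_eLpNorm_boundaryStrip_le_of_hasTrace hc
  have hr := hc.pos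
  obtain ⟨G', hG', φ, hφ, h1, h2, -⟩ := id hv
  have hGG := hG'.unique hG
  have h2' : Tendsto (fun m => eLpNorm (fun x => ∇ (φ m) x - G x) 2 (areaMeasure P))
      atTop (𝓝 0) := by
    refine h2.congr fun m => eLpNorm_congr_ae (hGG.mono fun x hx => ?_)
    simp only [hx]
  refine IsTestLimit.of_forall hG.memLp hG.memLp_grad fun ε hε => ?_
  -- The three summands pay for `(χ - 1) G`, for `(χ - 1) v`, and for `v ∇χ`; in the last, `4 / (r
  -- δ)` meets the bound `C δ ‖G‖` for `v` on the strip.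
  set K : ℝ≥0∞ := 1 + C + ENNReal.ofReal (4 / r) * C with hK
  have hKt : K ≠ ⊤ := by finiteness
  have hK0 : K ≠ 0 := by
    rw [hK, add_assoc]
    exact (add_pos_of_pos_of_nonneg one_pos zero_le).ne'
  obtain ⟨δ, hδ0, hδ1, hδ⟩ := hP.exists_eLpNorm_strip_le hc hG.memLp_grad (ε := ε / 2 / K)
    (ENNReal.div_ne_zero.2 ⟨ENNReal.div_ne_zero.2 ⟨hε, by norm_num⟩, hKt⟩)
  obtain ⟨χ, hχ, hχ01, hχg, hχ1⟩ := hP.exists_cutoff hc hδ0 hδ1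
  set ν : Measure Plane := volume.restrict (boundaryStrip a c δ) with hνdef
  have hGν : K * eLpNorm G 2 ν ≤ ε / 2 := by
    rw [mul_comm]
    exact ENNReal.mul_le_of_le_div hδ
  have hvν : eLpNorm v 2 ν ≤ C * (ENNReal.ofReal δ * eLpNorm G 2 ν) := hstrip v G hv hG δ hδ1
  have hδ1' : ENNReal.ofReal δ ≤ 1 := by simpa using hδ1
  have hχa : ∀ x, ‖χ x‖ ≤ 1 := fun x => by
    rw [Real.norm_of_nonneg (hχ01 x).1]; exact (hχ01 x).2
  have hχb : ∀ x, ‖χ x - 1‖ ≤ 1 := fun x => by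
    rw [Real.norm_eq_abs, abs_le]; constructor <;> linarith [(hχ01 x).1, (hχ01 x).2]
  have hχc : Continuous χ := hχ.smooth.continuous
  have hχgc := continuous_gradient hχ.smooth
  have hb1 : ∀ m, eLpNorm (fun x => χ x * φ m x - v x) 2 (areaMeasure P) ≤
      eLpNorm (fun x => φ m x - v x) 2 (areaMeasure P) + K * eLpNorm G 2 ν := by
    intro m
    have hφm := (hφ m).continuous.aestronglyMeasurable (μ := areaMeasure P)
    have : (fun x => χ x * φ m x - v x) =
        fun x => χ x * (φ m x - v x) + (χ x - 1) * v x := by funext x; ring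
    rw [this]
    have m1 : AEStronglyMeasurable (fun x => χ x * (φ m x - v x)) (areaMeasure P) :=
      hχc.aestronglyMeasurable.mul (hφm.sub hG.memLp.1)
    have m2 : AEStronglyMeasurable (fun x => (χ x - 1) * v x) (areaMeasure P) :=
      (hχc.sub continuous_const).aestronglyMeasurable.mul hG.memLp.1
    refine (eLpNorm_add_le m1 m2 (by norm_num)).trans ?_
    refine add_le_add ?_ ?_
    · refine eLpNorm_mono fun x => ?_
      rw [norm_mul]
      exact mul_le_of_le_one_left (norm_nonneg _) (hχa x)
    · refine (eLpNorm_le_of_eq_zero_off hP hc hδ1 (K := 1) (g := v) (fun x hx hxs => ?_)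
        fun x => ?_).trans ?_
      · rw [(hχ1 x hx hxs).1, sub_self, zero_mul]
      · rw [norm_mul]
        gcongr
        exact hχb x
      · rw [ENNReal.ofReal_one, one_mul]
        refine hvν.trans ?_
        calc C * (ENNReal.ofReal δ * eLpNorm G 2 ν) ≤ C * (1 * eLpNorm G 2 ν) := by gcongr
          _ = C * eLpNorm G 2 ν := by rw [one_mul]
          _ ≤ K * eLpNorm G 2 ν := by
            gcongr
            exact le_add_self.trans le_self_add
  have hb2 : ∀ m, eLpNorm (fun x => ∇ (fun x => χ x * φ m x) x - G x) 2 (areaMeasure P) ≤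
      eLpNorm (fun x => ∇ (φ m) x - G x) 2 (areaMeasure P) +
      ENNReal.ofReal (4 / r / δ) * eLpNorm (fun x => φ m x - v x) 2 (areaMeasure P) +
      K * eLpNorm G 2 ν := by
    intro m
    have hφm := (hφ m).continuous.aestronglyMeasurable (μ := areaMeasure P)
    have hgm := (continuous_gradient (hφ m)).aestronglyMeasurable (μ := areaMeasure P)
    -- The first bracket tends to `0` as `m → ∞` for fixed `δ`, even with the factor `1/δ` from
    -- `∇χ`. The second does not depend on `m`, vanishes off the strip and is small by the choice of
    -- `δ`.
    have : (fun x => ∇ (fun x => χ x * φ m x) x - G x) =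
        fun x => ((χ x • (∇ (φ m) x - G x)) + ((φ m x - v x) • ∇ χ x)) +
          ((χ x - 1) • G x + v x • ∇ χ x) := by
      funext x
      rw [gradient_mul (hχ.smooth.differentiable (by simp) x)
        ((hφ m).differentiable (by simp) x)]
      module
    rw [this]
    have m1 : AEStronglyMeasurable (fun x => χ x • (∇ (φ m) x - G x)) (areaMeasure P) :=
      hχc.aestronglyMeasurable.smul (hgm.sub hG.memLp_grad.1)
    have m2 : AEStronglyMeasurable (fun x => (φ m x - v x) • ∇ χ x) (areaMeasure P) :=
      (hφm.sub hG.memLp.1).smul hχgc.aestronglyMeasurable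
    have m3 : AEStronglyMeasurable (fun x => (χ x - 1) • G x) (areaMeasure P) :=
      (hχc.sub continuous_const).aestronglyMeasurable.smul hG.memLp_grad.1
    have m4 : AEStronglyMeasurable (fun x => v x • ∇ χ x) (areaMeasure P) :=
      hG.memLp.1.smul hχgc.aestronglyMeasurable
    refine (eLpNorm_add_le (m1.add m2) (m3.add m4) (by norm_num)).trans ?_
    refine add_le_add ((eLpNorm_add_le m1 m2 (by norm_num)).trans (add_le_add ?_ ?_))
      ((eLpNorm_add_le m3 m4 (by norm_num)).trans ?_)
    · refine eLpNorm_mono fun x => ?_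
      rw [norm_smul]
      exact mul_le_of_le_one_left (norm_nonneg _) (hχa x)
    · refine eLpNorm_le_mul_eLpNorm_of_ae_le_mul (.of_forall fun x => ?_) 2
      rw [norm_smul, mul_comm]
      gcongr
      exact hχg x
    · have b3 : eLpNorm (fun x => (χ x - 1) • G x) 2 (areaMeasure P) ≤ eLpNorm G 2 ν := by
        refine (eLpNorm_le_of_eq_zero_off hP hc hδ1 (K := 1) (g := G) (fun x hx hxs => ?_)
          fun x => ?_).trans (by rw [ENNReal.ofReal_one, one_mul])
        · rw [(hχ1 x hx hxs).1, sub_self, zero_smul]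
        · rw [norm_smul]
          gcongr
          exact hχb x
      have b4 : eLpNorm (fun x => v x • ∇ χ x) 2 (areaMeasure P) ≤
          ENNReal.ofReal (4 / r) * C * eLpNorm G 2 ν := by
        refine (eLpNorm_le_of_eq_zero_off hP hc hδ1 (K := 4 / r / δ) (g := v)
          (fun x hx hxs => ?_) fun x => ?_).trans ?_
        · rw [(hχ1 x hx hxs).2, smul_zero]
        · rw [norm_smul, mul_comm]
          gcongr
          exact hχg x
        · refine (mul_le_mul_right hvν _).trans_eq ?_
          have : ENNReal.ofReal (4 / r / δ) * ENNReal.ofReal δ = ENNReal.ofReal (4 / r) := by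
            rw [← ENNReal.ofReal_mul (by positivity), div_mul_cancel₀ _ hδ0.ne']
          rw [← this]
          ring
      refine (add_le_add b3 b4).trans ?_
      calc _ = (1 + ENNReal.ofReal (4 / r) * C) * eLpNorm G 2 ν := by ring
        _ ≤ K * eLpNorm G 2 ν := by
          gcongr
          rw [hK, add_right_comm]
          exact le_self_add
  have t1 : Tendsto (fun m => eLpNorm (fun x => φ m x - v x) 2 (areaMeasure P) +
      K * eLpNorm G 2 ν) atTop (𝓝 (0 + K * eLpNorm G 2 ν)) := h1.add tendsto_const_nhds
  have t2 : Tendsto (fun m => eLpNorm (fun x => ∇ (φ m) x - G x) 2 (areaMeasure P) +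
      ENNReal.ofReal (4 / r / δ) * eLpNorm (fun x => φ m x - v x) 2 (areaMeasure P) +
      K * eLpNorm G 2 ν) atTop
      (𝓝 (0 + ENNReal.ofReal (4 / r / δ) * 0 + K * eLpNorm G 2 ν)) :=
    (h2'.add (ENNReal.Tendsto.const_mul h1 (Or.inr ENNReal.ofReal_ne_top))).add tendsto_const_nhds
  rw [zero_add] at t1
  rw [mul_zero, zero_add, zero_add] at t2
  rcases eq_or_ne ε ⊤ with rfl | hεt
  · exact ⟨χ, hχ, le_top, le_top⟩
  have hlt : K * eLpNorm G 2 ν < ε := hGν.trans_lt (ENNReal.half_lt_self hε hεt)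
  obtain ⟨m, hm1, hm2⟩ := ((t1.eventually_lt_const hlt).and (t2.eventually_lt_const hlt)).exists
  refine ⟨fun x => χ x * φ m x, ⟨hχ.smooth.mul (hφ m), hχ.compactSupport.mul_right,
    (tsupport_mul_subset_left).trans hχ.support_subset⟩, (hb1 m).trans hm1.le,
    (hb2 m).trans hm2.le⟩

/-! ### The Dirichlet problem -/

/-- The pairs `(φ, ∇φ)` with `φ` a test function, in `L²(P) × L²(P)²`. -/
def testSpace (P : Set Plane) :
    Submodule ℝ (WithLp 2 (Lp ℝ 2 (areaMeasure P) × Lp Plane 2 (areaMeasure P))) where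
  carrier := {z | ∃ φ, IsTestFunction (interior P) φ ∧ z.fst =ᵐ[areaMeasure P] φ ∧
    z.snd =ᵐ[areaMeasure P] ∇ φ}
  zero_mem' := by
    refine ⟨fun _ => 0, ⟨contDiff_const, HasCompactSupport.zero, by simp [tsupport]⟩,
      Lp.coeFn_zero _ _ _, ?_⟩
    have hg : ∇ (fun _ : Plane => (0 : ℝ)) = 0 := by
      funext x
      simp [gradient]
    rw [hg]
    exact Lp.coeFn_zero _ _ _
  add_mem' := by
    rintro z z' ⟨φ, hφ, h1, h2⟩ ⟨ψ, hψ, h3, h4⟩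
    refine ⟨fun x => 1 * φ x + ψ x, ⟨(contDiff_const.mul hφ.smooth).add hψ.smooth,
      hφ.compactSupport.mul_left.add hψ.compactSupport, ?_⟩, ?_, ?_⟩
    · refine (tsupport_add _ _).trans (union_subset ?_ hψ.support_subset)
      exact tsupport_mul_subset_right.trans hφ.support_subset
    · refine (Lp.coeFn_add _ _).trans ?_
      filter_upwards [h1, h3] with x hx hy
      simp [hx, hy]
    · refine (Lp.coeFn_add _ _).trans ?_
      filter_upwards [h2, h4] with x hx hy
      rw [gradient_smul_add hφ.smooth hψ.smooth]
      simp [hx, hy]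
  smul_mem' := by
    rintro c z ⟨φ, hφ, h1, h2⟩
    refine ⟨fun x => c * φ x + 0, ⟨(contDiff_const.mul hφ.smooth).add contDiff_const, ?_, ?_⟩,
      ?_, ?_⟩
    · simp only [add_zero]
      exact hφ.compactSupport.mul_left
    · simp only [add_zero]
      exact tsupport_mul_subset_right.trans hφ.support_subset
    · refine (Lp.coeFn_smul _ _).trans ?_
      filter_upwards [h1] with x hx
      simp [hx]
    · refine (Lp.coeFn_smul _ _).trans ?_
      filter_upwards [h2] with x hx
      rw [gradient_smul_add hφ.smooth contDiff_const]
      simp [hx, gradient]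

theorem isTestLimit_of_mem_closure {P : Set Plane}
    {z : WithLp 2 (Lp ℝ 2 (areaMeasure P) × Lp Plane 2 (areaMeasure P))}
    (hz : z ∈ (testSpace P).topologicalClosure) : IsTestLimit P z.fst z.snd := by
  obtain ⟨y, hy, hlim⟩ := mem_closure_iff_seq_limit.1 hz
  choose φ hφ h1 h2 using hy
  have hl : Tendsto (fun m => (y m).fst) atTop (𝓝 z.fst) :=
    ((WithLp.prod_continuous_ofLp 2 _ _).fst.tendsto z).comp hlim
  have hr : Tendsto (fun m => (y m).snd) atTop (𝓝 z.snd) :=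
    ((WithLp.prod_continuous_ofLp 2 _ _).snd.tendsto z).comp hlim
  refine ⟨Lp.memLp _, Lp.memLp _, φ, hφ, ?_, ?_⟩
  · refine ((Lp.tendsto_Lp_iff_tendsto_eLpNorm' _ _).1 hl).congr fun m => eLpNorm_congr_ae ?_
    filter_upwards [h1 m] with x hx
    simp [hx]
  · refine ((Lp.tendsto_Lp_iff_tendsto_eLpNorm' _ _).1 hr).congr fun m => eLpNorm_congr_ae ?_
    filter_upwards [h2 m] with x hx
    simp [hx]

/-- Poincaré's inequality is a closed condition on pairs, so it survives the closure. -/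
theorem IsPolygonalElement.exists_norm_fst_le {n : ℕ} {P : Set Plane} {a : Polygon Plane n}
    (hP : IsPolygonalElement P a) : ∃ C : ℝ, 0 ≤ C ∧ ∀ z ∈ (testSpace P).topologicalClosure,
      ‖z.fst‖ ≤ C * ‖z.snd‖ := by
  obtain ⟨C, hC, h⟩ := hP.exists_poincare
  refine ⟨C.toReal, ENNReal.toReal_nonneg, fun z hz => ?_⟩
  have hcl : IsClosed {z : WithLp 2 (Lp ℝ 2 (areaMeasure P) × Lp Plane 2 (areaMeasure P)) |
      ‖z.fst‖ ≤ C.toReal * ‖z.snd‖} :=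
    isClosed_le (WithLp.prod_continuous_ofLp 2 _ _).fst.norm
      ((WithLp.prod_continuous_ofLp 2 _ _).snd.norm.const_mul _)
  refine closure_minimal ?_ hcl hz
  rintro y ⟨φ, hφ, h1, h2⟩
  have := h φ hφ
  rw [← eLpNorm_congr_ae h1, ← eLpNorm_congr_ae h2] at this
  show ‖y.fst‖ ≤ C.toReal * ‖y.snd‖
  rw [Lp.norm_def, Lp.norm_def, ← ENNReal.toReal_mul]
  exact ENNReal.toReal_mono (ENNReal.mul_ne_top hC (Lp.eLpNorm_ne_top _)) this

/-- Lax–Milgram on the closure of the pairs `(φ, ∇φ)`, where Poincaré's inequality makes the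
Dirichlet form coercive. Allowing an arbitrary `z` covers two uses: `(-f, 0)` solves Poisson's
equation, and `(0, H)` matches the products of `H` with gradients of test functions. -/
theorem IsPolygonalElement.exists_dirichlet_solution {n : ℕ} {P : Set Plane}
    {a : Polygon Plane n} (hP : IsPolygonalElement P a) :
    ∃ R : WithLp 2 (Lp ℝ 2 (areaMeasure P) × Lp Plane 2 (areaMeasure P)) →ₗ[ℝ]
        (testSpace P).topologicalClosure,
      ∀ z, ∀ h ∈ testSpace P, inner ℝ (R z).1.snd h.snd = inner ℝ z h := by
  set H := (testSpace P).topologicalClosure with hH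
  have : CompleteSpace H := (testSpace P).isClosed_topologicalClosure.completeSpace_coe
  let s : H →L[ℝ] Lp Plane 2 (areaMeasure P) :=
    (WithLp.sndL 2 ℝ (Lp ℝ 2 (areaMeasure P)) (Lp Plane 2 (areaMeasure P))).comp H.subtypeL
  let B : H →L[ℝ] H →L[ℝ] ℝ := (innerSL ℝ).bilinearComp s s
  have hBs : ∀ u v : H, B u v = inner ℝ (s u) (s v) := fun u v => by
    rw [ContinuousLinearMap.bilinearComp_apply, innerSL_apply_apply]
  have hs : ∀ u : H, s u = u.1.snd := fun u => rfl
  clear_value B s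
  have hB : IsCoercive B := by
    obtain ⟨C, hC, h⟩ := hP.exists_norm_fst_le
    -- `‖u‖² = ‖u.fst‖² + ‖u.snd‖² ≤ (C² + 1) ‖u.snd‖²`.
    refine ⟨(C ^ 2 + 1)⁻¹, by positivity, fun u => ?_⟩
    rw [hBs, real_inner_self_eq_norm_sq, hs, mul_assoc, inv_mul_le_iff₀ (by positivity), ← sq]
    have e2 : ‖u‖ ^ 2 = ‖u.1.fst‖ ^ 2 + ‖u.1.snd‖ ^ 2 := WithLp.prod_norm_sq_eq_of_L2 _
    rw [e2]
    have := pow_le_pow_left₀ (norm_nonneg _) (h u.1 u.2) 2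
    rw [mul_pow] at this
    linarith
  obtain ⟨E, hE⟩ : ∃ E : H ≃L[ℝ] H, ∀ v w, inner ℝ (E v) w = B v w :=
    ⟨hB.continuousLinearEquivOfBilin, hB.continuousLinearEquivOfBilin_apply⟩
  -- Projecting `z` onto the closure does not change its products with test pairs, and `E` turns the
  -- Dirichlet form into the inner product.
  refine ⟨E.symm.toLinearEquiv.toLinearMap ∘ₗ H.orthogonalProjectionOnto.toLinearMap,
    fun z h hh => ?_⟩
  have h1 := hE (E.symm (H.orthogonalProjectionOnto z)) ⟨h, Submodule.le_topologicalClosure _ hh⟩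
  rw [ContinuousLinearEquiv.apply_symm_apply,
    Submodule.inner_orthogonalProjectionOnto_eq_of_mem_right, hBs, hs, hs] at h1
  exact h1.symm

theorem L2_inner_eq_integral {F : Type*} [NormedAddCommGroup F] [InnerProductSpace ℝ F]
    {μ : Measure Plane} {u v : Lp F 2 μ} {f g : Plane → F} (hf : u =ᵐ[μ] f) (hg : v =ᵐ[μ] g) :
    inner ℝ u v = ∫ x, inner ℝ (f x) (g x) ∂μ := by
  rw [L2.inner_def]
  refine integral_congr_ae ?_
  filter_upwards [hf, hg] with x hx hy
  rw [hx, hy]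

/-- When `H` is the gradient of some `u`, the difference `u - z` is harmonic and keeps the trace of
`u`. -/
theorem IsPolygonalElement.exists_isTestLimit_inner_eq {n : ℕ} {P : Set Plane}
    {a : Polygon Plane n} (hP : IsPolygonalElement P a) {H : Plane → Plane}
    (hH : MemLp H 2 (areaMeasure P)) :
    ∃ z G, IsTestLimit P z G ∧ ∀ φ, IsTestFunction (interior P) φ →
      ∫ x in interior P, inner ℝ (G x) (∇ φ x) = ∫ x in interior P, inner ℝ (H x) (∇ φ x) := by
  obtain ⟨R, hR⟩ := hP.exists_dirichlet_solution
  set y := R (WithLp.toLp 2 (0, hH.toLp H)) with hy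
  refine ⟨_, _, isTestLimit_of_mem_closure y.2, fun φ hφ => ?_⟩
  have hg := (hφ.memLp_gradient (areaMeasure P)).coeFn_toLp
  have h := hR (WithLp.toLp 2 (0, hH.toLp H)) (WithLp.toLp 2 ((hφ.memLp _).toLp φ,
    (hφ.memLp_gradient _).toLp (∇ φ))) ⟨φ, hφ, (hφ.memLp _).coeFn_toLp, hg⟩
  rw [WithLp.prod_inner_apply] at h
  simp only [inner_zero_left, zero_add] at h
  rw [← L2_inner_eq_integral (ae_eq_refl _) hg, ← L2_inner_eq_integral hH.coeFn_toLp hg]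
  exact h

/-- The solution operator of `Δu = f` in `P`, `u = 0` on `∂P`. -/
theorem IsPolygonalElement.exists_solution_operator {n : ℕ} {P : Set Plane}
    {a : Polygon Plane n} (hP : IsPolygonalElement P a) :
    ∃ S : Lp ℝ 2 (areaMeasure P) →ₗ[ℝ] Lp ℝ 2 (areaMeasure P), ∀ f,
      HasWeakLaplacian P (S f) f ∧ HasTrace P a (S f) 0 := by
  obtain ⟨R, hR⟩ := hP.exists_dirichlet_solution
  refine ⟨(WithLp.fstₗ 2 ℝ _ _) ∘ₗ Submodule.subtype _ ∘ₗ R ∘ₗ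
    (WithLp.linearEquiv 2 ℝ _).symm.toLinearMap ∘ₗ LinearMap.inl ℝ _ _ ∘ₗ (-LinearMap.id),
    fun f => ?_⟩
  -- The datum is `-f` because the weak form of `Δu = f` reads `∫ ∇u · ∇φ = -∫ f φ`.
  have hlim := isTestLimit_of_mem_closure (R (WithLp.toLp 2 (-f, 0))).2
  refine ⟨⟨_, hlim.hasWeakGradient hP.isCompact, fun φ hφ => ?_⟩, hlim.hasTrace_zero hP⟩
  have hg := (hφ.memLp_gradient (areaMeasure P)).coeFn_toLp
  have h := hR (WithLp.toLp 2 (-f, 0)) (WithLp.toLp 2 ((hφ.memLp _).toLp φ,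
    (hφ.memLp_gradient _).toLp (∇ φ))) ⟨φ, hφ, (hφ.memLp _).coeFn_toLp, hg⟩
  rw [WithLp.prod_inner_apply] at h
  simp only [inner_zero_left, add_zero, inner_neg_left] at h
  rw [← L2_inner_eq_integral (ae_eq_refl _) hg]
  refine h.trans ?_
  rw [L2_inner_eq_integral (ae_eq_refl _) (hφ.memLp (areaMeasure P)).coeFn_toLp]
  simp [mul_comm]

/-- A function with vanishing trace which is orthogonal to its Laplacian vanishes. -/
theorem HasWeakLaplacian.eq_zero_of_hasTrace {n : ℕ} {P : Set Plane} {a : Polygon Plane n}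
    (hP : IsPolygonalElement P a) {v f : Plane → ℝ} (h : HasWeakLaplacian P v f)
    (hf : MemLp f 2 (areaMeasure P)) (ht : HasTrace P a v 0)
    (hfv : ∫ x in interior P, f x * v x = 0) : v =ᵐ[areaMeasure P] fun _ => 0 := by
  obtain ⟨G, hG, hL⟩ := h
  -- Approximation by test functions allows `v` itself as a test function: `∫ |G|² = -∫ f v = 0`.
  obtain ⟨φ, hφ, h1, h2⟩ := (ht.isTestLimit hP hG).exists_seq
  have t1 := tendsto_integral_inner (fun m => (hφ m).memLp_gradient _) hG.memLp_grad
    hG.memLp_grad h2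
  have t2 := tendsto_integral_inner (fun m => (hφ m).memLp _) hG.memLp hf h1
  have e : ∀ m, ∫ x, inner ℝ (G x) (∇ (φ m) x) ∂(areaMeasure P) =
      - ∫ x, inner ℝ (f x) (φ m x) ∂(areaMeasure P) := by
    intro m
    rw [hL _ (hφ m)]
    simp [mul_comm]
  simp only [e] at t1
  have h3 := tendsto_nhds_unique t1 t2.neg
  have h4 : ∫ x, inner ℝ (f x) (v x) ∂(areaMeasure P) = 0 := by
    rw [← hfv]
    simp [mul_comm]
  rw [h4, neg_zero, integral_eq_zero_iff_of_nonneg (fun x => real_inner_self_nonneg)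
    (integrable_inner_of_memLp hG.memLp_grad hG.memLp_grad)] at h3
  have hG0 : G =ᵐ[areaMeasure P] 0 := h3.mono fun x hx => inner_self_eq_zero.1 hx
  obtain ⟨c, r, hc⟩ := hP.exists_isStarCenter
  obtain ⟨C, hC, hle⟩ := hP.exists_eLpNorm_boundaryStrip_le_of_hasTrace hc
  -- The strip estimate at depth `1` is Poincaré's inequality for zero-trace functions, and here `G
  -- = 0`.
  have h5 := hle v G ht hG 1 le_rfl
  rw [← hP.areaMeasure_eq hc, eLpNorm_congr_ae hG0, eLpNorm_zero, mul_zero, mul_zero] at h5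
  exact (eLpNorm_eq_zero_iff hG.memLp.1 (by norm_num)).1 (le_antisymm h5 zero_le)

theorem inner_eq_zero_of_orthogonalProjection_eq_zero {E : Type*} [NormedAddCommGroup E]
    [InnerProductSpace ℝ E] {K : Submodule ℝ E} [K.HasOrthogonalProjection] {v f : E}
    (h : K.orthogonalProjectionOnto v = 0) (hf : f ∈ K) : inner ℝ f v = 0 :=
  (K.orthogonalProjectionOnto_eq_zero_iff.1 h) f hf

/-- The Laplacian lies in `M` while `v` is orthogonal to `M`, which is exactly the cancellation in
the energy identity. -/
theorem eq_zero_of_hasTrace_of_orthogonalProjection {n : ℕ} {P : Set Plane}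
    {a : Polygon Plane n} (hP : IsPolygonalElement P a)
    {M : Submodule ℝ (Lp ℝ 2 (areaMeasure P))} [M.HasOrthogonalProjection]
    {v f : Lp ℝ 2 (areaMeasure P)} (hf : f ∈ M) (h : HasWeakLaplacian P v f)
    (ht : HasTrace P a v 0) (hv : M.orthogonalProjectionOnto v = 0) : v = 0 := by
  have h0 := inner_eq_zero_of_orthogonalProjection_eq_zero hv hf
  rw [Lp.eq_zero_iff_ae_eq_zero]
  refine h.eq_zero_of_hasTrace hP (Lp.memLp f) ht ?_
  rw [← h0, L2.inner_def]
  simp [mul_comm]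

/-- Functions with vanishing trace and Laplacian in a finite-dimensional space `M` attain all
projections onto `M`. -/
theorem exists_hasTrace_zero_orthogonalProjection_eq {n : ℕ} {P : Set Plane}
    {a : Polygon Plane n} (hP : IsPolygonalElement P a)
    (M : Submodule ℝ (Lp ℝ 2 (areaMeasure P))) [FiniteDimensional ℝ M]
    [M.HasOrthogonalProjection] (s : M) :
    ∃ v : Lp ℝ 2 (areaMeasure P), (∃ f ∈ M, HasWeakLaplacian P v f) ∧ HasTrace P a v 0 ∧
      M.orthogonalProjectionOnto v = s := by
  obtain ⟨S, hS⟩ := hP.exists_solution_operator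
  -- If `A f = 0`, then `S f` has zero trace and is orthogonal to its Laplacian `f`, so `S f = 0`
  -- and hence `f = 0`. Injectivity gives surjectivity because `M` is finite-dimensional.
  let A : M →ₗ[ℝ] M := M.orthogonalProjectionOnto.toLinearMap ∘ₗ S ∘ₗ M.subtype
  have hA : Function.Injective A := by
    rw [← LinearMap.ker_eq_bot, LinearMap.ker_eq_bot']
    intro f hf
    have h0 : S f = 0 :=
      eq_zero_of_hasTrace_of_orthogonalProjection hP f.2 (hS f).1 (hS f).2 hf
    have h1 := (hS f).1.congr (v := fun _ => 0) (by
      rw [h0]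
      exact Lp.coeFn_zero _ _ _) (ae_eq_refl _)
    exact Subtype.ext ((Lp.eq_zero_iff_ae_eq_zero).2 (h1.eq_zero (Lp.memLp _)))
  obtain ⟨f, hf⟩ := (LinearMap.injective_iff_surjective.1 hA) s
  exact ⟨S f, ⟨f, f.2, (hS f).1⟩, (hS f).2, hf⟩

/-! ### Polynomials on edges -/

theorem mem_polySpace_iff {d : ℤ} {f : Plane → ℝ} : f ∈ polySpace d ↔
    f = 0 ∨ 0 ≤ d ∧ ∃ p : MvPolynomial (Fin 2) ℝ, p.totalDegree ≤ d.toNat ∧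
      ∀ x : Plane, f x = MvPolynomial.aeval (fun i => x i) p := by
  unfold polySpace
  split_ifs with h
  · simp [not_le.2 h]
  · simp only [Submodule.mem_map, MvPolynomial.mem_restrictTotalDegree, not_lt.1 h, true_and]
    constructor
    · rintro ⟨p, hp, rfl⟩
      exact Or.inr ⟨p, hp, fun x => rfl⟩
    · rintro (rfl | ⟨p, hp, hf⟩)
      · exact ⟨0, by simp, map_zero _⟩
      · exact ⟨p, hp, funext fun x => (hf x).symm⟩

theorem contDiff_of_mem_polySpace {d : ℤ} {f : Plane → ℝ} (hf : f ∈ polySpace d) :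
    ContDiff ℝ ∞ f := by
  rcases mem_polySpace_iff.1 hf with rfl | ⟨-, p, -, h⟩
  · exact contDiff_const
  · rw [funext h]
    clear h hf
    induction p using MvPolynomial.induction_on with
    | C c => simpa using contDiff_const
    | add p q hp hq => simpa using hp.add hq
    | mul_X p i hp =>
      simp only [map_mul, MvPolynomial.aeval_X]
      exact hp.mul (by fun_prop)

theorem polySpace_mono {d e : ℤ} (h : d ≤ e) : polySpace d ≤ polySpace e := by
  intro f hf
  rcases mem_polySpace_iff.1 hf with rfl | ⟨h0, p, hp, hpf⟩
  · exact Submodule.zero_mem _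
  · exact mem_polySpace_iff.2 (Or.inr ⟨h0.trans h, p, hp.trans (Int.toNat_le_toNat h), hpf⟩)

/-- The bound is written `m - 1` so that `m = 0` is the zero space: both `degreeLT ℝ m` and
`polySpace (m - 1)` then include the convention `P_{-1} = {0}`. -/
theorem exists_polynomial_edgePath {n : ℕ} (a : Polygon Plane n) (i : Fin n) {m : ℕ}
    {f : Plane → ℝ} (hf : f ∈ polySpace ((m : ℤ) - 1)) :
    ∃ q ∈ Polynomial.degreeLT ℝ m, ∀ t, f (a.edgePath ℝ i t) = q.eval t := by
  rcases mem_polySpace_iff.1 hf with rfl | ⟨h0, p, hp, hpf⟩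
  · exact ⟨0, Submodule.zero_mem _, fun t => by simp⟩
  · let F : Fin 2 → Polynomial ℝ := fun j =>
      Polynomial.C (a i j) + Polynomial.X * Polynomial.C (a (finRotate n i) j - a i j)
    have hF : ∀ j, (F j).natDegree ≤ 1 := fun j => by
      refine Polynomial.natDegree_add_le_of_degree_le (by simp) ?_
      exact (Polynomial.natDegree_mul_C_le _ _).trans Polynomial.natDegree_X_le
    refine ⟨MvPolynomial.aeval F p, ?_, fun t => ?_⟩
    · rw [Polynomial.mem_degreeLT]
      refine (Polynomial.degree_le_of_natDegree_le
        (MvPolynomial.aeval_natDegree_le p hp F hF)).trans_lt ?_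
      rw [mul_one]
      exact_mod_cast (by omega : ((m : ℤ) - 1).toNat < m)
    · rw [hpf]
      have e : ∀ r : MvPolynomial (Fin 2) ℝ, (MvPolynomial.aeval F r).eval t =
          MvPolynomial.aeval (fun j => (F j).eval t) r := by
        intro r
        rw [← Polynomial.coe_evalRingHom, MvPolynomial.aeval_def, MvPolynomial.aeval_def,
          MvPolynomial.hom_eval₂]
        congr 1
        ext c
        simp
      rw [e]
      congr 2
      funext j
      simp [F, Polygon.edgePath, AffineMap.lineMap_apply]
      ring

/-- The affine coordinate on the plane which parametrizes the `i`-th edge by `[0, 1]`. -/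
noncomputable def edgeCoord {n : ℕ} (a : Polygon Plane n) (i : Fin n) (x : Plane) : ℝ :=
  inner ℝ (a (finRotate n i) - a i) (x - a i) / ‖a (finRotate n i) - a i‖ ^ 2

theorem edgeCoord_edgePath {n : ℕ} {a : Polygon Plane n} {i : Fin n}
    (hne : a (finRotate n i) ≠ a i) (t : ℝ) : edgeCoord a i (a.edgePath ℝ i t) = t := by
  have : ‖a (finRotate n i) - a i‖ ^ 2 ≠ 0 := by
    simpa using sub_ne_zero.2 hne
  simp only [edgeCoord, Polygon.edgePath, AffineMap.lineMap_apply, vsub_eq_sub, vadd_eq_add,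
    add_sub_cancel_right, inner_smul_right, real_inner_self_eq_norm_sq]
  rw [mul_div_cancel_right₀ _ this]

/-- The function on the plane which on the `i`-th edge is a given polynomial of the parameter. -/
noncomputable def edgePoly {n : ℕ} (a : Polygon Plane n) (i : Fin n) :
    Polynomial ℝ →ₗ[ℝ] (Plane → ℝ) where
  toFun q x := q.eval (edgeCoord a i x)
  map_add' p q := by funext x; simp
  map_smul' c q := by funext x; simp

theorem edgePoly_apply {n : ℕ} (a : Polygon Plane n) (i : Fin n) (q : Polynomial ℝ) (x : Plane) :
    edgePoly a i q x = q.eval (edgeCoord a i x) := rfl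

theorem continuous_edgePoly {n : ℕ} (a : Polygon Plane n) (i : Fin n) (q : Polynomial ℝ) :
    Continuous (edgePoly a i q) := by
  have : Continuous (edgeCoord a i) := by
    unfold edgeCoord
    fun_prop
  exact q.continuous.comp this

/-- The edge parameter extends to an affine function on the plane, and substituting it into `q` does
not raise the degree. -/
theorem edgePoly_mem {n : ℕ} (a : Polygon Plane n) (i : Fin n) {m : ℕ} {q : Polynomial ℝ}
    (hq : q ∈ Polynomial.degreeLT ℝ m) : edgePoly a i q ∈ polySpace ((m : ℤ) - 1) := by
  rcases eq_or_ne q 0 with rfl | hq0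
  · rw [map_zero]
    exact Submodule.zero_mem _
  rw [Polynomial.mem_degreeLT, ← Polynomial.natDegree_lt_iff_degree_lt hq0] at hq
  set e := a (finRotate n i) - a i with he
  let T : MvPolynomial (Fin 2) ℝ := MvPolynomial.C (-(inner ℝ e (a i)) / ‖e‖ ^ 2) +
    MvPolynomial.C (e 0 / ‖e‖ ^ 2) * MvPolynomial.X 0 +
    MvPolynomial.C (e 1 / ‖e‖ ^ 2) * MvPolynomial.X 1
  have hCX : ∀ (c : ℝ) (j : Fin 2), (MvPolynomial.C c * MvPolynomial.X j).totalDegree ≤ 1 := by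
    intro c j
    refine (MvPolynomial.totalDegree_mul _ _).trans ?_
    simp
  have hT : T.totalDegree ≤ 1 := by
    refine (MvPolynomial.totalDegree_add _ _).trans (max_le ?_ (hCX _ _))
    refine (MvPolynomial.totalDegree_add _ _).trans (max_le ?_ (hCX _ _))
    simp
  refine mem_polySpace_iff.2 (Or.inr ⟨by omega, Polynomial.aeval T q, ?_, fun x => ?_⟩)
  · rw [Polynomial.aeval_eq_sum_range]
    refine (MvPolynomial.totalDegree_finsetSum _ _).trans (Finset.sup_le fun j hj => ?_)
    refine (MvPolynomial.totalDegree_smul_le _ _).trans ((MvPolynomial.totalDegree_pow _ _).trans ?_)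
    rw [Finset.mem_range] at hj
    calc j * T.totalDegree ≤ j * 1 := by gcongr
      _ ≤ _ := by omega
  · rw [← Polynomial.aeval_algHom_apply, edgePoly_apply, ← Polynomial.coe_aeval_eq_eval]
    congr 2
    simp only [T, edgeCoord, inner_sub_right, map_add, map_mul, MvPolynomial.aeval_X,
      MvPolynomial.algHom_C, Algebra.algebraMap_self, RingHom.id_apply]
    rw [← he]
    have : inner ℝ e x = e 0 * x 0 + e 1 * x 1 := by
      simp [PiLp.inner_apply, Fin.sum_univ_two, mul_comm]
    rw [this]
    ring

theorem isCompact_edgeSet {n : ℕ} (a : Polygon Plane n) (i : Fin n) :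
    IsCompact (a.edgeSet ℝ i) := by
  rw [a.edgeSet_eq_image_edgePath ℝ]
  exact isCompact_Icc.image (continuous_edgePath a i)

theorem memLp_edgeMeasure_of_continuousOn {n : ℕ} (a : Polygon Plane n) (i : Fin n)
    {f : Plane → ℝ} (hf : ContinuousOn f (a.edgeSet ℝ i)) : MemLp f 2 (edgeMeasure a i) := by
  have hK := isCompact_edgeSet a i
  obtain ⟨C, hC⟩ := hK.exists_bound_of_continuousOn hf
  have hm := hf.aestronglyMeasurable_of_isCompact hK hK.measurableSet (μ := edgeMeasure a i)
  rw [Measure.restrict_eq_self_of_ae_mem (ae_mem_edgeSet a i)] at hm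
  exact MemLp.of_bound hm C ((ae_mem_edgeSet a i).mono fun x hx => hC x hx)

/-- The class in `L²(E)` of a polynomial of the edge parameter. -/
noncomputable def edgePolyClass {n : ℕ} (a : Polygon Plane n) (i : Fin n) :
    Polynomial ℝ →ₗ[ℝ] Lp ℝ 2 (edgeMeasure a i) where
  toFun q := (memLp_edgeMeasure_of_continuousOn a i
    (continuous_edgePoly a i q).continuousOn).toLp
  map_add' p q := by
    rw [← MemLp.toLp_add]
    congr 1
    exact map_add _ _ _
  map_smul' c q := by
    rw [RingHom.id_apply, ← MemLp.toLp_const_smul]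
    congr 1
    exact map_smul _ _ _

theorem edgePolyClass_ae_eq {n : ℕ} (a : Polygon Plane n) (i : Fin n) (q : Polynomial ℝ) :
    edgePolyClass a i q =ᵐ[edgeMeasure a i] edgePoly a i q :=
  (memLp_edgeMeasure_of_continuousOn a i (continuous_edgePoly a i q).continuousOn).coeFn_toLp

theorem mem_classSpace_iff {μ : Measure Plane} {S : Submodule ℝ (Plane → ℝ)} {y : Lp ℝ 2 μ} :
    y ∈ classSpace μ S ↔ ∃ f ∈ S, y =ᵐ[μ] f := by
  simp only [classSpace, Submodule.mem_map, Prod.exists]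
  constructor
  · rintro ⟨f, z, h, rfl⟩
    exact ⟨f, h.1, h.2⟩
  · rintro ⟨f, hf, hy⟩
    exact ⟨f, y, ⟨hf, hy⟩, rfl⟩

/-- Restrictions to the edge of polynomials in two variables are exactly the polynomials of the edge
parameter with the same degree bound. -/
theorem mem_classSpace_polySpace_iff {n : ℕ} {a : Polygon Plane n} {i : Fin n}
    (hne : a (finRotate n i) ≠ a i) {m : ℕ} {y : Lp ℝ 2 (edgeMeasure a i)} :
    y ∈ classSpace (edgeMeasure a i) (polySpace ((m : ℤ) - 1)) ↔
      ∃ q ∈ Polynomial.degreeLT ℝ m, y = edgePolyClass a i q := by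
  rw [mem_classSpace_iff]
  constructor
  · rintro ⟨f, hf, hy⟩
    obtain ⟨q, hq, hfq⟩ := exists_polynomial_edgePath a i hf
    refine ⟨q, hq, Lp.ext (hy.trans (EventuallyEq.trans ?_ (edgePolyClass_ae_eq a i q).symm))⟩
    filter_upwards [ae_mem_edgeSet a i] with x hx
    obtain ⟨t, -, rfl⟩ := hx
    change f (a.edgePath ℝ i t) = edgePoly a i q (a.edgePath ℝ i t)
    rw [hfq, edgePoly_apply, edgeCoord_edgePath hne]
  · rintro ⟨q, hq, rfl⟩
    exact ⟨_, edgePoly_mem a i hq, edgePolyClass_ae_eq a i q⟩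

theorem inner_edgePolyClass {n : ℕ} {a : Polygon Plane n} {i : Fin n}
    (hne : a (finRotate n i) ≠ a i) (p q : Polynomial ℝ) :
    inner ℝ (edgePolyClass a i p) (edgePolyClass a i q) =
      dist (a i) (a (finRotate n i)) * ∫ t in Icc (0 : ℝ) 1, p.eval t * q.eval t := by
  rw [L2_inner_eq_integral (edgePolyClass_ae_eq a i p) (edgePolyClass_ae_eq a i q), edgeMeasure,
    integral_smul_measure, integral_map (continuous_edgePath a i).aemeasurable
      ((continuous_edgePoly a i p).inner (continuous_edgePoly a i q)).aestronglyMeasurable]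
  simp [edgePoly_apply, edgeCoord_edgePath hne, mul_comm]

/-- The bubble polynomial `t (1 - t)`. -/
noncomputable def bubble : Polynomial ℝ := Polynomial.X * (1 - Polynomial.X)

/-- The integrand `t (1 - t) q²` is continuous and nonnegative on `[0, 1]`, so `q` has every point
of `(0, 1)` as a root. -/
theorem eq_zero_of_inner_bubble_eq_zero {n : ℕ} {a : Polygon Plane n} {i : Fin n}
    (hne : a (finRotate n i) ≠ a i) {q : Polynomial ℝ}
    (h : inner ℝ (edgePolyClass a i (bubble * q)) (edgePolyClass a i q) = 0) : q = 0 := by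
  rw [inner_edgePolyClass hne, mul_eq_zero, or_iff_right (dist_ne_zero.2 hne.symm)] at h
  have hc : Continuous fun t => (bubble * q).eval t * q.eval t :=
    (Polynomial.continuous _).mul (Polynomial.continuous _)
  have he : ∀ t, (bubble * q).eval t * q.eval t = t * (1 - t) * q.eval t ^ 2 := fun t => by
    simp [bubble]
    ring
  rw [setIntegral_eq_zero_iff_of_nonneg_ae] at h
  · have h1 := Measure.eqOn_Icc_of_ae_eq volume zero_ne_one h hc.continuousOn continuousOn_const
    refine q.eq_zero_of_infinite_isRoot ((Ioo_infinite (zero_lt_one' ℝ)).mono fun t ht => ?_)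
    have h2 := h1 (Ioo_subset_Icc_self ht)
    simp only [he, Pi.zero_apply] at h2
    have h3 : t * (1 - t) ≠ 0 := (mul_pos ht.1 (sub_pos.2 ht.2)).ne'
    simpa [h3] using h2
  · filter_upwards [ae_restrict_mem measurableSet_Icc] with t ht
    rw [he]
    exact mul_nonneg (mul_nonneg ht.1 (sub_nonneg.2 ht.2)) (sq_nonneg _)
  · exact hc.continuousOn.integrableOn_Icc

theorem natDegree_bubble : bubble.natDegree = 2 ∧ bubble ≠ 0 := by
  have h : bubble = -(Polynomial.X * (Polynomial.X - Polynomial.C 1)) := by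
    simp only [bubble, map_one]
    ring
  have h1 : (Polynomial.X - Polynomial.C (1 : ℝ)) ≠ 0 := Polynomial.X_sub_C_ne_zero 1
  constructor
  · rw [h, Polynomial.natDegree_neg, Polynomial.natDegree_mul Polynomial.X_ne_zero h1,
      Polynomial.natDegree_X, Polynomial.natDegree_X_sub_C]
  · rw [h, neg_ne_zero]
    exact mul_ne_zero Polynomial.X_ne_zero h1

theorem bubble_mul_mem {m : ℕ} {q : Polynomial ℝ} (hq : q ∈ Polynomial.degreeLT ℝ m) :
    bubble * q ∈ Polynomial.degreeLT ℝ (m + 2) := by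
  rcases eq_or_ne q 0 with rfl | hq0
  · rw [mul_zero]
    exact Submodule.zero_mem _
  rw [Polynomial.mem_degreeLT, ← Polynomial.natDegree_lt_iff_degree_lt hq0] at hq
  rw [Polynomial.mem_degreeLT,
    ← Polynomial.natDegree_lt_iff_degree_lt (mul_ne_zero natDegree_bubble.2 hq0),
    Polynomial.natDegree_mul natDegree_bubble.2 hq0, natDegree_bubble.1]
  omega

theorem exists_eq_bubble_mul {m : ℕ} {p : Polynomial ℝ} (hp : p ∈ Polynomial.degreeLT ℝ (m + 2))
    (h0 : p.eval 0 = 0) (h1 : p.eval 1 = 0) :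
    ∃ q ∈ Polynomial.degreeLT ℝ m, p = bubble * q := by
  obtain ⟨r, rfl⟩ : Polynomial.X ∣ p := by
    rw [← sub_zero Polynomial.X, ← map_zero Polynomial.C]
    exact Polynomial.dvd_iff_isRoot.2 h0
  have hr : r.eval 1 = 0 := by simpa using h1
  obtain ⟨q, rfl⟩ := Polynomial.dvd_iff_isRoot.2 hr
  -- The sign comes from `bubble = -X (X - 1)`.
  have e : Polynomial.X * ((Polynomial.X - Polynomial.C 1) * q) = bubble * (-q) := by
    simp only [bubble, map_one]
    ring
  rw [e] at hp
  refine ⟨-q, ?_, e⟩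
  rcases eq_or_ne (-q) 0 with h | hq0
  · rw [h]
    exact Submodule.zero_mem _
  rw [Polynomial.mem_degreeLT,
    ← Polynomial.natDegree_lt_iff_degree_lt (mul_ne_zero natDegree_bubble.2 hq0),
    Polynomial.natDegree_mul natDegree_bubble.2 hq0, natDegree_bubble.1] at hp
  rw [Polynomial.mem_degreeLT, ← Polynomial.natDegree_lt_iff_degree_lt hq0]
  omega

/-- There is a polynomial of degree `m + 1` on an edge with given values at the end points and
given moments against the polynomials of degree less than `m`. -/
theorem exists_polynomial_interpolation {n : ℕ} {a : Polygon Plane n} {i : Fin n}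
    (hne : a (finRotate n i) ≠ a i) (m : ℕ) (y₀ y₁ : ℝ) (r : Lp ℝ 2 (edgeMeasure a i)) :
    ∃ p ∈ Polynomial.degreeLT ℝ (m + 2), p.eval 0 = y₀ ∧ p.eval 1 = y₁ ∧
      ∀ q ∈ Polynomial.degreeLT ℝ m,
        inner ℝ (edgePolyClass a i p - r) (edgePolyClass a i q) = 0 := by
  set V := Polynomial.degreeLT ℝ m
  -- The form `⟨bubble * q, q'⟩` is definite, so it identifies `V` with its dual, and any moments
  -- can be attained by a multiple of `bubble`.
  let b : V →ₗ[ℝ] Module.Dual ℝ V :=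
    (innerₗ (Lp ℝ 2 (edgeMeasure a i))).compl₁₂
      (edgePolyClass a i ∘ₗ LinearMap.mulLeft ℝ bubble ∘ₗ V.subtype)
      (edgePolyClass a i ∘ₗ V.subtype)
  have hb : Function.Injective b := by
    rw [← LinearMap.ker_eq_bot, LinearMap.ker_eq_bot']
    intro q hq
    have : b q q = 0 := by rw [hq]; rfl
    exact Subtype.ext (eq_zero_of_inner_bubble_eq_zero hne this)
  have hs : Function.Surjective b :=
    (LinearMap.injective_iff_surjective_of_finrank_eq_finrank
      Subspace.dual_finrank_eq.symm).1 hb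
  -- The affine interpolant fixes the end values; adding multiples of `bubble` leaves them
  -- unchanged.
  let ℓ : Polynomial ℝ := Polynomial.C y₀ + Polynomial.C (y₁ - y₀) * Polynomial.X
  obtain ⟨q, hq⟩ := hs ((innerₗ (Lp ℝ 2 (edgeMeasure a i))
    (r - edgePolyClass a i ℓ)) ∘ₗ edgePolyClass a i ∘ₗ V.subtype)
  refine ⟨ℓ + bubble * q, Submodule.add_mem _ ?_ (bubble_mul_mem q.2), ?_, ?_, fun q' hq' => ?_⟩
  · rw [Polynomial.mem_degreeLT]
    have h1 : ℓ.degree ≤ 1 := by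
      show (Polynomial.C y₀ + Polynomial.C (y₁ - y₀) * Polynomial.X).degree ≤ 1
      rw [add_comm]
      exact Polynomial.degree_linear_le
    refine h1.trans_lt ?_
    exact_mod_cast (by omega : 1 < m + 2)
  · simp [ℓ, bubble]
  · simp [ℓ, bubble]
  · have h1 := LinearMap.congr_fun hq ⟨q', hq'⟩
    have h2 : inner ℝ (edgePolyClass a i (bubble * q)) (edgePolyClass a i q') =
        inner ℝ (r - edgePolyClass a i ℓ) (edgePolyClass a i q') := h1
    rw [map_add, inner_sub_left, inner_add_left, h2, inner_sub_left]
    ring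

/-! ### Unisolvence on the boundary -/

theorem continuousOn_of_mem_sup {P : Set Plane} {k : ℤ} {Ψ : Submodule ℝ (Plane → ℝ)}
    (hΨ : ∀ ψ ∈ Ψ, ContinuousOn ψ P) {g : Plane → ℝ} (hg : g ∈ polySpace k ⊔ Ψ) :
    ContinuousOn g P := by
  obtain ⟨p, hp, ψ, hψ, rfl⟩ := Submodule.mem_sup.1 hg
  exact (contDiff_of_mem_polySpace hp).continuous.continuousOn.add (hΨ ψ hψ)

theorem edgeClass_ae_eq {n : ℕ} {P : Set Plane} (a : Polygon Plane n) (i : Fin n)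
    (w : C(frontier P, ℝ)) : edgeClass a i w =ᵐ[edgeMeasure a i] extendZero w :=
  (memLp_extendZero a i w).coeFn_toLp

theorem edgeClass_ae_eq_of_forall {n : ℕ} {P : Set Plane} {a : Polygon Plane n}
    (hP : IsPolygonalElement P a) {i : Fin n} {w : C(frontier P, ℝ)} {g : Plane → ℝ}
    (h : ∀ x : frontier P, x.1 ∈ a.edgeSet ℝ i → w x = g x) :
    edgeClass a i w =ᵐ[edgeMeasure a i] g := by
  refine (edgeClass_ae_eq a i w).trans ?_
  filter_upwards [ae_mem_edgeSet a i] with x hx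
  rw [← h ⟨x, hP.edgeSet_subset i hx⟩ hx, ← extendZero_apply]

theorem Submodule.orthogonalProjectionOnto_eq_of_mem {E : Type*} [NormedAddCommGroup E]
    [InnerProductSpace ℝ E] {K : Submodule ℝ E} [K.HasOrthogonalProjection] {u : E} {v : K}
    (h : u - v ∈ Kᗮ) : K.orthogonalProjectionOnto u = v :=
  Subtype.ext (Submodule.eq_starProjection_of_mem_orthogonal v.2 h)

/-- Continuous functions on the edges which agree at the vertices define a continuous function on
the boundary. -/
theorem IsPolygonalElement.exists_glue {n : ℕ} {P : Set Plane} {a : Polygon Plane n}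
    (hP : IsPolygonalElement P a) (g : Fin n → Plane → ℝ) (m : Fin n → ℝ)
    (hg : ∀ i, ContinuousOn (g i) (a.edgeSet ℝ i)) (h0 : ∀ i, g i (a i) = m i)
    (h1 : ∀ i, g i (a (finRotate n i)) = m (finRotate n i)) :
    ∃ w : C(frontier P, ℝ), ∀ i (x : frontier P), x.1 ∈ a.edgeSet ℝ i → w x = g i x := by
  have hcov : ∀ x : frontier P, ∃ i, x.1 ∈ a.edgeSet ℝ i := by
    rintro ⟨x, hx⟩
    rw [hP.frontier_eq] at hx
    exact mem_iUnion.1 hx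
  choose e he using hcov
  have hv : ∀ i l, a l ∈ ({a i, a (finRotate n i)} : Set Plane) → g i (a l) = m l := by
    rintro i l (h | h)
    · rw [h, h0, hP.injective h]
    · rw [h, h1, hP.injective h]
  -- Distinct edges meet only at common vertices, where both functions take the value `m`. The edges
  -- form a finite closed cover, so agreement on overlaps gives continuity.
  have hcompat : ∀ i j (x : Plane), x ∈ a.edgeSet ℝ i → x ∈ a.edgeSet ℝ j → g i x = g j x := by
    intro i j x hi hj
    rcases eq_or_ne i j with rfl | hij
    · rfl
    obtain ⟨hxi, hxj⟩ := hP.simple i j hij ⟨hi, hj⟩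
    obtain ⟨l, rfl⟩ : ∃ l, x = a l := by
      rcases hxi with h | h
      exacts [⟨_, h⟩, ⟨_, h⟩]
    rw [hv i l hxi, hv j l hxj]
  have heq : ∀ i (x : frontier P), x.1 ∈ a.edgeSet ℝ i → g (e x) x = g i x :=
    fun i x hx => hcompat _ _ _ (he x) hx
  refine ⟨⟨fun x => g (e x) x, ?_⟩, heq⟩
  refine (locallyFinite_of_finite fun i : Fin n =>
    (Subtype.val ⁻¹' a.edgeSet ℝ i : Set (frontier P))).continuous ?_ ?_ ?_
  · exact eq_univ_of_forall fun x => mem_iUnion.2 ⟨e x, he x⟩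
  · exact fun i => (isCompact_edgeSet a i).isClosed.preimage continuous_subtype_val
  · intro i
    refine ContinuousOn.congr ?_ fun x hx => heq i x hx
    exact (hg i).comp continuous_subtype_val.continuousOn fun x hx => hx

/-- With `k = m + 1`, the space `P_{k-2}(E)` corresponds to `degreeLT ℝ m` and `P_k(E)` to `degreeLT
ℝ (m + 2)`. -/
theorem edgeMomentSpace_left {n : ℕ} {a : Polygon Plane n} {m : ℕ}
    {Ψ : Submodule ℝ (Plane → ℝ)} {i : Fin n} (hne : a (finRotate n i) ≠ a i) {q : Polynomial ℝ}
    (hq : q ∈ Polynomial.degreeLT ℝ m) :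
    edgePolyClass a i q ∈ edgeMomentSpace a (m + 1) Ψ i := by
  refine Submodule.mem_sup_left ?_
  have : ((m + 1 : ℕ) : ℤ) - 2 = (m : ℤ) - 1 := by push_cast; ring
  rw [this]
  exact (mem_classSpace_polySpace_iff hne).2 ⟨q, hq, rfl⟩

theorem classSpace_mono {μ : Measure Plane} {S T : Submodule ℝ (Plane → ℝ)} (h : S ≤ T) :
    classSpace μ S ≤ classSpace μ T := fun y hy => by
  obtain ⟨f, hf, hy⟩ := mem_classSpace_iff.1 hy
  exact mem_classSpace_iff.2 ⟨f, h hf, hy⟩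

/-- The moments against `𝔓_E` remove the non-polynomial part, the vertex values factor out `bubble`,
and the moments against `P_{k-2}(E)` remove the cofactor. -/
theorem boundaryDofs_injOn {n : ℕ} {P : Set Plane} {a : Polygon Plane n}
    (hP : IsPolygonalElement P a) {m : ℕ} {Ψ : Submodule ℝ (Plane → ℝ)} [FiniteDimensional ℝ Ψ]
    {w : C(frontier P, ℝ)} (hw : w ∈ boundarySpace P a (m + 1) Ψ)
    (h : boundaryDofs P a (m + 1) Ψ w = 0) : w = 0 := by
  have hvert : ∀ i, extendZero w (a i) = 0 := fun i => congrFun (congrArg Prod.fst h) i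
  have hproj : ∀ i, (edgeMomentSpace a (m + 1) Ψ i).orthogonalProjectionOnto (edgeClass a i w) = 0 :=
    fun i => congrFun (congrArg Prod.snd h) i
  refine hP.eq_zero_of_extendZero fun i => ?_
  have hne := hP.ne i
  obtain ⟨g, hg, hgw⟩ := hw i
  set x := edgeClass a i w with hx
  have hxW : x ∈ classSpace (edgeMeasure a i) (polySpace (m + 1 : ℕ) ⊔ Ψ) :=
    mem_classSpace_iff.2 ⟨g, hg, edgeClass_ae_eq_of_forall hP hgw⟩
  have horth : ∀ y ∈ edgeMomentSpace a (m + 1) Ψ i, inner ℝ y x = 0 := fun y hy =>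
    inner_eq_zero_of_orthogonalProjection_eq_zero (hproj i) hy
  set Pk := classSpace (edgeMeasure a i) (polySpace (m + 1 : ℕ)) with hPk
  have : CompleteSpace Pk := FiniteDimensional.complete ℝ _
  have hxP : x ∈ Pk := by
    have hy : Pk.starProjection x ∈ Pk := Pk.starProjection_apply_mem x
    have hz : x - Pk.starProjection x ∈ Pkᗮ := Pk.sub_starProjection_mem_orthogonal x
    -- The component of `x` orthogonal to `P_k(E)` belongs to `𝔓_E`, so it is an admissible test for
    -- its own vanishing.
    have hzs : x - Pk.starProjection x ∈ edgeMomentSpace a (m + 1) Ψ i :=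
      Submodule.mem_sup_right ⟨hz, Submodule.sub_mem _ hxW (classSpace_mono le_sup_left hy)⟩
    have h1 := horth _ hzs
    have h2 : inner ℝ (x - Pk.starProjection x) (Pk.starProjection x) = 0 :=
      Submodule.inner_left_of_mem_orthogonal hy hz
    have h3 : inner ℝ (x - Pk.starProjection x) (x - Pk.starProjection x) = 0 := by
      rw [inner_sub_right, h1, h2, sub_zero]
    rw [inner_self_eq_zero, sub_eq_zero] at h3
    rw [h3]
    exact hy
  have hcast : ((m + 1 : ℕ) : ℤ) = ((m + 2 : ℕ) : ℤ) - 1 := by push_cast; ring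
  rw [hPk, hcast] at hxP
  obtain ⟨p, hp, hxp⟩ := (mem_classSpace_polySpace_iff hne).1 hxP
  have hae : extendZero w =ᵐ[edgeMeasure a i] edgePoly a i p :=
    (edgeClass_ae_eq a i w).symm.trans (hx ▸ hxp ▸ edgePolyClass_ae_eq a i p)
  have heq := eqOn_edgeSet_of_ae_eq a i hne
    ((continuousOn_extendZero w).mono (hP.edgeSet_subset i))
    (continuous_edgePoly a i p).continuousOn hae
  have hev : ∀ t ∈ Icc (0 : ℝ) 1, extendZero w (a.edgePath ℝ i t) = p.eval t := by
    intro t ht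
    rw [heq (edgePath_mem a i ht.1 ht.2), edgePoly_apply, edgeCoord_edgePath hne]
  have hp0 : p.eval 0 = 0 := by
    rw [← hev 0 (by simp)]
    simpa [Polygon.edgePath] using hvert i
  have hp1 : p.eval 1 = 0 := by
    rw [← hev 1 (by simp)]
    simpa [Polygon.edgePath] using hvert (finRotate n i)
  obtain ⟨q, hq, rfl⟩ := exists_eq_bubble_mul hp hp0 hp1
  have hq0 : q = 0 := by
    refine eq_zero_of_inner_bubble_eq_zero hne (i := i) ?_
    rw [← hxp, real_inner_comm]
    exact horth _ (edgeMomentSpace_left hne hq)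
  rw [hq0, mul_zero, map_zero] at hae
  exact hae

/-- Split the moment datum as `r₁ + r₂` with `r₂ ∈ 𝔓_E` represented by `f`, and take `p + f` with a
polynomial `p` that corrects the end values of `f`. The error `p - r₁` is in `P_k(E)`, hence
orthogonal to `𝔓_E`, and the choice of `p` makes it orthogonal to `P_{k-2}(E)`. -/
theorem boundaryDofs_surjOn {n : ℕ} {P : Set Plane} {a : Polygon Plane n}
    (hP : IsPolygonalElement P a) {m : ℕ} {Ψ : Submodule ℝ (Plane → ℝ)} [FiniteDimensional ℝ Ψ]
    (hΨ : ∀ ψ ∈ Ψ, ContinuousOn ψ P)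
    (d : (Fin n → ℝ) × (∀ i, edgeMomentSpace a (m + 1) Ψ i)) :
    ∃ w ∈ boundarySpace P a (m + 1) Ψ, boundaryDofs P a (m + 1) Ψ w = d := by
  obtain ⟨v, r⟩ := d
  have hcast : ((m + 1 : ℕ) : ℤ) = ((m + 2 : ℕ) : ℤ) - 1 := by push_cast; ring
  have hcast2 : ((m + 1 : ℕ) : ℤ) - 2 = (m : ℤ) - 1 := by push_cast; ring
  have hedge : ∀ i, ∃ g ∈ polySpace (m + 1 : ℕ) ⊔ Ψ, g (a i) = v i ∧
      g (a (finRotate n i)) = v (finRotate n i) ∧ ∀ y : Lp ℝ 2 (edgeMeasure a i),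
        y =ᵐ[edgeMeasure a i] g → y - r i ∈ (edgeMomentSpace a (m + 1) Ψ i)ᗮ := by
    intro i
    have hne := hP.ne i
    obtain ⟨r₁, hr₁, r₂, hr₂, hr⟩ := Submodule.mem_sup.1 (r i).2
    rw [hcast2] at hr₁
    obtain ⟨f, hf, hfr⟩ := mem_classSpace_iff.1 hr₂.2
    obtain ⟨p, hp, hp0, hp1, hpo⟩ := exists_polynomial_interpolation hne m (v i - f (a i))
      (v (finRotate n i) - f (a (finRotate n i))) r₁
    have hc0 : edgeCoord a i (a i) = 0 := by
      have := edgeCoord_edgePath hne 0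
      simpa [Polygon.edgePath] using this
    have hc1 : edgeCoord a i (a (finRotate n i)) = 1 := by
      have := edgeCoord_edgePath hne 1
      simpa [Polygon.edgePath] using this
    refine ⟨edgePoly a i p + f, Submodule.add_mem _ (Submodule.mem_sup_left ?_) hf, ?_, ?_, ?_⟩
    · rw [hcast]
      exact edgePoly_mem a i hp
    · simp [edgePoly_apply, hc0, hp0]
    · rw [Pi.add_apply, edgePoly_apply, hc1, hp1, sub_add_cancel]
    · intro y hy
      have hyr : y = edgePolyClass a i p + r₂ := by
        refine Lp.ext (hy.trans (EventuallyEq.trans ?_ (Lp.coeFn_add _ _).symm))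
        exact ((edgePolyClass_ae_eq a i p).add hfr).symm
      rw [hyr, ← hr, add_sub_add_right_eq_sub, edgeMomentSpace, Submodule.mem_orthogonal']
      intro z hz
      obtain ⟨z₁, hz₁, z₂, hz₂, rfl⟩ := Submodule.mem_sup.1 hz
      rw [hcast2] at hz₁
      obtain ⟨q, hq, rfl⟩ := (mem_classSpace_polySpace_iff hne).1 hz₁
      rw [inner_add_right, hpo q hq, zero_add]
      refine Submodule.inner_right_of_mem_orthogonal (K := classSpace (edgeMeasure a i)
        (polySpace (m + 1 : ℕ))) (Submodule.sub_mem _ ?_ ?_) hz₂.1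
      · rw [hcast]
        exact (mem_classSpace_polySpace_iff hne).2 ⟨p, hp, rfl⟩
      · exact classSpace_mono (polySpace_mono (by push_cast; linarith)) hr₁
  choose g hg hg0 hg1 hgr using hedge
  obtain ⟨w, hw⟩ := hP.exists_glue g v
    (fun i => (continuousOn_of_mem_sup hΨ (hg i)).mono
      ((hP.edgeSet_subset i).trans hP.frontier_subset)) hg0 hg1
  refine ⟨w, fun i => ⟨g i, hg i, hw i⟩, Prod.ext (funext fun i => ?_) (funext fun i => ?_)⟩
  · show extendZero w (a i) = v i
    have := extendZero_apply w ⟨a i, hP.vertex_mem i⟩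
    simp only at this
    rw [this, hw i _ (a.left_mem_edgeSet i), hg0]
  · show (edgeMomentSpace a (m + 1) Ψ i).orthogonalProjectionOnto (edgeClass a i w) = r i
    exact Submodule.orthogonalProjectionOnto_eq_of_mem
      (hgr i _ (edgeClass_ae_eq_of_forall hP (hw i)))

/-! ### Approximation by smooth functions -/

/-- Contraction towards `c` followed by mollification. -/
noncomputable def starMollify {E : Type*} [NormedAddCommGroup E] [NormedSpace ℝ E] (c : Plane)
    (s : ℝ) (φ : ContDiffBump (0 : Plane)) (F : Plane → E) (x : Plane) : E :=
  convolution (φ.normed volume) F (ContinuousLinearMap.lsmul ℝ ℝ) volume (c + s • (x - c))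

theorem contDiff_starMollify {E : Type*} [NormedAddCommGroup E] [NormedSpace ℝ E] (c : Plane)
    (s : ℝ) (φ : ContDiffBump (0 : Plane)) {F : Plane → E} (hF : LocallyIntegrable F) :
    ContDiff ℝ ∞ (starMollify c s φ F) := by
  have h := φ.hasCompactSupport_normed.contDiff_convolution_left (n := ⊤)
    (ContinuousLinearMap.lsmul ℝ ℝ : ℝ →L[ℝ] E →L[ℝ] E) (φ.contDiff_normed (μ := volume)) hF
  have h2 : ContDiff ℝ ∞ fun x : Plane => c + s • (x - c) := by fun_prop
  exact h.comp h2

theorem norm_starMollify_sub_le {E : Type*} [NormedAddCommGroup E] [NormedSpace ℝ E]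
    [CompleteSpace E] {c : Plane}
    {s : ℝ} {φ : ContDiffBump (0 : Plane)} {F : Plane → E} (hF : AEStronglyMeasurable F volume)
    {x : Plane} {v : E} {ε : ℝ} (hε : 0 ≤ ε)
    (h : ∀ y ∈ Metric.ball (c + s • (x - c)) φ.rOut, ‖F y - v‖ ≤ ε) :
    ‖starMollify c s φ F x - v‖ ≤ ε := by
  rw [← dist_eq_norm]
  refine dist_convolution_le hε φ.support_normed_eq.subset φ.nonneg_normed φ.integral_normed
    hF fun y hy => ?_
  rw [dist_eq_norm]
  exact h y hy

/-- The Jacobian of a homothety of ratio `s` in the plane is `s ^ 2`. -/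
theorem lintegral_comp_affine (c : Plane) {s : ℝ} (hs : s ≠ 0) (t : Plane) {H : Plane → ℝ≥0∞}
    (hH : Measurable H) : ∫⁻ x, H (c + s • (x - c) - t) =
      ENNReal.ofReal |(s ^ 2)⁻¹| * ∫⁻ x, H x := by
  have h1 : ∀ x : Plane, c + s • (x - c) - t = s • x + (c - s • c - t) := fun x => by module
  simp only [h1]
  have h2 := lintegral_map (μ := (volume : Measure Plane)) (g := fun x : Plane => s • x)
    (hH.comp (measurable_add_const (c - s • c - t))) (measurable_const_smul s)
  rw [Measure.map_addHaar_smul volume hs, lintegral_smul_measure, finrank_euclideanSpace_fin] at h2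
  simp only [Function.comp_def] at h2
  rw [← h2, lintegral_add_right_eq_self H, smul_eq_mul]

/-- The mollifier is a probability density, so Cauchy–Schwarz moves the square inside the average;
then Tonelli and rescaling apply. The squared constant is `1 / s² ≤ 4`. -/
theorem eLpNorm_starMollify_le {E : Type*} [NormedAddCommGroup E] [NormedSpace ℝ E]
    [MeasurableSpace E] [BorelSpace E] (c : Plane) {s : ℝ} (hs : 1 / 2 ≤ s)
    (φ : ContDiffBump (0 : Plane)) {F : Plane → E} (hF : Measurable F) :
    eLpNorm (starMollify c s φ F) 2 volume ≤ 2 * eLpNorm F 2 volume := by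
  have hs0 : 0 < s := by linarith
  set ν : Measure Plane := volume.withDensity fun t => ENNReal.ofReal (φ.normed volume t) with hν
  have hφm : Measurable fun t => ENNReal.ofReal (φ.normed volume t) :=
    φ.continuous_normed.measurable.ennreal_ofReal
  have hν1 : ν univ = 1 := by
    rw [hν, withDensity_apply _ MeasurableSet.univ, Measure.restrict_univ,
      ← ofReal_integral_eq_lintegral_ofReal φ.integrable_normed
        (.of_forall fun x => φ.nonneg_normed x), φ.integral_normed, ENNReal.ofReal_one]
  have : IsProbabilityMeasure ν := ⟨hν1⟩
  have hpt : ∀ x, ‖starMollify c s φ F x‖ₑ ^ 2 ≤ ∫⁻ t, ‖F (c + s • (x - c) - t)‖ₑ ^ 2 ∂ν := by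
    intro x
    have hm : Measurable fun t => ‖F (c + s • (x - c) - t)‖ₑ :=
      (hF.comp (measurable_const_sub _)).enorm
    have h1 : ‖starMollify c s φ F x‖ₑ ≤ ∫⁻ t, ‖F (c + s • (x - c) - t)‖ₑ ∂ν := by
      rw [hν, lintegral_withDensity_eq_lintegral_mul _ hφm hm]
      refine (enorm_integral_le_lintegral_enorm _).trans_eq (lintegral_congr fun t => ?_)
      simp only [ContinuousLinearMap.lsmul_apply, enorm_smul, Pi.mul_apply]
      rw [Real.enorm_of_nonneg (φ.nonneg_normed t)]
    refine (pow_le_pow_left₀ zero_le h1 2).trans ((sq_lintegral_le ν hm.aemeasurable).trans_eq ?_)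
    rw [hν1, one_mul]
  rw [← ENNReal.pow_le_pow_left_iff two_ne_zero, mul_pow, eLpNorm_two_sq, eLpNorm_two_sq]
  refine (lintegral_mono hpt).trans ?_
  have hm2 : Measurable fun p : Plane × Plane => ‖F (c + s • (p.1 - c) - p.2)‖ₑ ^ 2 :=
    ((hF.comp (by fun_prop : Measurable fun p : Plane × Plane => c + s • (p.1 - c) - p.2)).enorm
      ).pow_const 2
  rw [lintegral_lintegral_swap hm2.aemeasurable]
  simp only [lintegral_comp_affine c hs0.ne' _ (hF.enorm.pow_const 2)]
  rw [lintegral_const, hν1, mul_one]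
  gcongr
  have : |(s ^ 2)⁻¹| ≤ 4 := by
    rw [abs_of_pos (by positivity), inv_le_comm₀ (by positivity) (by norm_num)]
    nlinarith
  refine (ENNReal.ofReal_le_ofReal this).trans_eq ?_
  norm_num

theorem fderiv_convolution_apply {g : Plane → ℝ} (hg : LocallyIntegrable g)
    (φ : ContDiffBump (0 : Plane)) (z e : Plane) :
    fderiv ℝ (convolution (φ.normed volume) g (ContinuousLinearMap.lsmul ℝ ℝ) volume) z e =
      ∫ t, fderiv ℝ (φ.normed volume) (z - t) e * g t := by
  have hφ : ContDiff ℝ 1 (φ.normed volume) := φ.contDiff_normed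
  have h := φ.hasCompactSupport_normed.hasFDerivAt_convolution_left
    (ContinuousLinearMap.lsmul ℝ ℝ : ℝ →L[ℝ] ℝ →L[ℝ] ℝ) hφ hg z
  rw [h.fderiv]
  have hex : ConvolutionExistsAt (fderiv ℝ (φ.normed volume)) g z
      ((ContinuousLinearMap.lsmul ℝ ℝ : ℝ →L[ℝ] ℝ →L[ℝ] ℝ).precompL Plane) volume :=
    (φ.hasCompactSupport_normed.fderiv (𝕜 := ℝ)).convolutionExists_left _
      (hφ.continuous_fderiv (by norm_num)) hg z
  rw [convolution_def, ContinuousLinearMap.integral_apply hex,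
    ← integral_sub_left_eq_self _ volume z]
  simp

/-- While the mollification ball stays inside `P`, the translated and reflected kernel is a test
function, so the weak gradient identity moves the derivative onto `G`. The factor `s` is the chain
rule for the contraction. -/
theorem gradient_starMollify {P : Set Plane} (hP : IsCompact P) {g : Plane → ℝ}
    {G : Plane → Plane} (hg : HasWeakGradient P g G) {c : Plane} {s : ℝ}
    {φ : ContDiffBump (0 : Plane)} {x : Plane}
    (hx : Metric.closedBall (c + s • (x - c)) φ.rOut ⊆ interior P) :
    ∇ (starMollify c s φ ((interior P).indicator g)) x =
      s • starMollify c s φ ((interior P).indicator G) x := by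
  have := hP.isFiniteMeasure_areaMeasure
  have hgi : LocallyIntegrable ((interior P).indicator g) :=
    ((integrable_indicator_iff isOpen_interior.measurableSet).2
      (hg.memLp.integrable (by norm_num))).locallyIntegrable
  set z := c + s • (x - c) with hz
  set ψ : Plane → ℝ := fun t => φ.normed volume (z - t) with hψ
  have hφs : ContDiff ℝ ∞ (φ.normed volume) := φ.contDiff_normed
  have hsub : ContDiff ℝ ∞ fun t : Plane => z - t := by fun_prop
  have hψs : ContDiff ℝ ∞ ψ := hφs.comp hsub
  have hsupp : tsupport ψ ⊆ Metric.closedBall z φ.rOut := by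
    refine closure_minimal (fun t ht => ?_) Metric.isClosed_closedBall
    have h1 : z - t ∈ Function.support (φ.normed volume) := ht
    rw [φ.support_normed_eq, mem_ball_zero_iff, ← dist_eq_norm, dist_comm] at h1
    exact h1.le
  have hψt : IsTestFunction (interior P) ψ :=
    ⟨hψs, (isCompact_closedBall z φ.rOut).of_isClosed_subset (isClosed_tsupport _) hsupp,
      hsupp.trans hx⟩
  have hψg : ∀ t e, inner ℝ e (∇ ψ t) = - fderiv ℝ (φ.normed volume) (z - t) e := by
    intro t e
    have h1 : HasFDerivAt (fun t : Plane => z - t) (-ContinuousLinearMap.id ℝ Plane) t :=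
      (hasFDerivAt_id t).const_sub z
    have h2 := ((hφs.differentiable (by simp)) (z - t)).hasFDerivAt.comp t h1
    rw [inner_gradient]
    change fderiv ℝ (φ.normed volume ∘ fun t => z - t) t e = _
    rw [h2.fderiv]
    simp
  have haff : HasFDerivAt (fun x : Plane => c + s • (x - c)) (s • ContinuousLinearMap.id ℝ Plane) x :=
    (((hasFDerivAt_id x).sub_const c).const_smul s).const_add c
  have hconv : ContDiff ℝ 1 (convolution (φ.normed volume) ((interior P).indicator g)
      (ContinuousLinearMap.lsmul ℝ ℝ) volume) :=
    φ.hasCompactSupport_normed.contDiff_convolution_left (n := 1) _ φ.contDiff_normed hgi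
  have hcomp := ((hconv.differentiable (by norm_num)) z).hasFDerivAt.comp x haff
  refine ext_inner_left ℝ fun e => ?_
  rw [inner_gradient]
  change fderiv ℝ ((convolution (φ.normed volume) ((interior P).indicator g)
      (ContinuousLinearMap.lsmul ℝ ℝ) volume) ∘ fun x => c + s • (x - c)) x e = _
  rw [hcomp.fderiv]
  simp only [ContinuousLinearMap.comp_apply, smul_apply,
    ContinuousLinearMap.id_apply, map_smul, smul_eq_mul, inner_smul_right]
  congr 1
  rw [fderiv_convolution_apply hgi]
  have e1 : ∫ t, fderiv ℝ (φ.normed volume) (z - t) e * (interior P).indicator g t =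
      - ∫ t in interior P, inner ℝ e (g t • ∇ ψ t) := by
    rw [← integral_neg, ← integral_indicator isOpen_interior.measurableSet]
    refine integral_congr_ae (.of_forall fun t => ?_)
    by_cases ht : t ∈ interior P
    · simp only [indicator_of_mem ht, inner_smul_right, hψg]
      ring
    · simp [indicator_of_notMem ht]
  have e2 : starMollify c s φ ((interior P).indicator G) x = ∫ t in interior P, ψ t • G t := by
    rw [starMollify, convolution_def, ← integral_sub_left_eq_self _ volume z,
      ← integral_indicator isOpen_interior.measurableSet]
    refine integral_congr_ae (.of_forall fun t => ?_)
    by_cases ht : t ∈ interior P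
    · simp [indicator_of_mem ht, ← hz, hψ]
    · simp [indicator_of_notMem ht, ← hz]
  have hψm := hψt.memLp (areaMeasure P)
  have hψgm := hψt.memLp_gradient (areaMeasure P)
  rw [e1, e2, integral_inner (integrable_smul_of_memLp hg.memLp hψgm), hg.integral_eq ψ hψt,
    inner_neg_right, neg_neg]

theorem HasWeakGradient.congr_grad {P : Set Plane} {u : Plane → ℝ} {G H : Plane → Plane}
    (hu : HasWeakGradient P u G) (h : G =ᵐ[areaMeasure P] H) : HasWeakGradient P u H where
  memLp := hu.memLp
  memLp_grad := (memLp_congr_ae h).1 hu.memLp_grad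
  integral_eq φ hφ := by
    rw [hu.integral_eq φ hφ]
    congr 1
    refine integral_congr_ae (h.mono fun x hx => ?_)
    simp only [hx]

theorem tendsto_eLpNorm_of_tendstoUniformlyOn {α E : Type*} [MeasurableSpace α]
    [NormedAddCommGroup E] {μ : Measure α} [IsFiniteMeasure μ] {S : Set α}
    (hS : ∀ᵐ x ∂μ, x ∈ S) {F : ℕ → α → E} {f g : α → E} (hF : TendstoUniformlyOn F f atTop S)
    (hfg : ∀ x ∈ S, f x = g x) (p : ℝ≥0∞) :
    Tendsto (fun m => eLpNorm (fun x => F m x - g x) p μ) atTop (𝓝 0) := by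
  refine ENNReal.tendsto_nhds_zero.2 fun ε hε => ?_
  have hM : μ univ ^ p.toReal⁻¹ ≠ ⊤ := by finiteness
  obtain ⟨δ, hδ, hδε⟩ := ENNReal.exists_nnreal_pos_mul_lt hM hε.ne'
  filter_upwards [Metric.tendstoUniformlyOn_iff.1 hF δ hδ] with m hm
  refine (eLpNorm_le_of_ae_bound (C := δ) ?_).trans ?_
  · filter_upwards [hS] with x hx
    have := hm x hx
    rw [dist_comm, dist_eq_norm, hfg x hx] at this
    exact this.le
  · rw [ENNReal.ofReal_coe_nnreal, mul_comm]
    exact hδε.le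

/-- The mollifier used for the `m`-th approximation of a function on a set that is star-shaped
with respect to a ball of radius `r`. -/
noncomputable def starBump {r : ℝ} (hr : 0 < r) (m : ℕ) : ContDiffBump (0 : Plane) where
  rIn := 1 / ((m : ℝ) + 2) * r / 4
  -- Half the margin `(1 - s) r` of `ball_subset` at `s = 1 - 1/(m + 2)`, so even the closed ball is
  -- interior. The shift by `2` keeps `s ≥ 1/2` from `m = 0` on.
  rOut := 1 / ((m : ℝ) + 2) * r / 2
  rIn_pos := by positivity
  rIn_lt_rOut := by
    have : 0 < 1 / ((m : ℝ) + 2) * r := by positivity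
    linarith

/-- The `m`-th smooth approximation of a function on a set that is star-shaped with respect to the
ball of radius `r` about `c`. -/
noncomputable def starApprox {E : Type*} [NormedAddCommGroup E] [NormedSpace ℝ E] (c : Plane)
    {r : ℝ} (hr : 0 < r) (F : Plane → E) (m : ℕ) : Plane → E :=
  starMollify c (1 - 1 / ((m : ℝ) + 2)) (starBump hr m) F

theorem starScale_mem (m : ℕ) : 1 / 2 ≤ 1 - 1 / ((m : ℝ) + 2) ∧ 1 - 1 / ((m : ℝ) + 2) ≤ 1 := by
  have h : 1 / ((m : ℝ) + 2) ≤ 1 / 2 :=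
    one_div_le_one_div_of_le (by norm_num) (by linarith [m.cast_nonneg (α := ℝ)])
  have h2 : 0 < 1 / ((m : ℝ) + 2) := by positivity
  constructor <;> linarith

theorem tendsto_starScale : Tendsto (fun m : ℕ => 1 / ((m : ℝ) + 2)) atTop (𝓝 0) := by
  have h := (tendsto_one_div_add_atTop_nhds_zero_nat (𝕜 := ℝ)).comp (tendsto_add_atTop_nat 1)
  refine h.congr fun m => ?_
  simp only [Function.comp_apply, Nat.cast_add, Nat.cast_one]
  ring

theorem IsStarCenter.closedBall_starBump_subset {P : Set Plane} {c : Plane} {r : ℝ}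
    (hc : IsStarCenter P c r) (m : ℕ) {x : Plane} (hx : x ∈ P) :
    Metric.closedBall (c + (1 - 1 / ((m : ℝ) + 2)) • (x - c)) (starBump hc.pos m).rOut ⊆
      interior P := by
  refine Subset.trans ?_ (hc.ball_subset hx (by linarith [(starScale_mem m).1]) (starScale_mem m).2)
  refine Metric.closedBall_subset_ball ?_
  have := hc.pos
  have h : 0 < 1 / ((m : ℝ) + 2) * r := by positivity
  simp only [starBump, sub_sub_cancel]
  linarith

/-- At any `x ∈ P`, boundary points included, the approximation averages `f` over interior points at
distance `O(1/m)` from `x`, and `f` is uniformly continuous on `P`. -/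
theorem tendstoUniformlyOn_starApprox {E : Type*} [NormedAddCommGroup E] [NormedSpace ℝ E]
    [CompleteSpace E] {P : Set Plane} (hP : IsCompact P) {c : Plane} {r : ℝ}
    (hc : IsStarCenter P c r) {f F : Plane → E} (hf : ContinuousOn f P)
    (hF : AEStronglyMeasurable F volume) (hFf : ∀ x ∈ interior P, F x = f x) :
    TendstoUniformlyOn (starApprox c hc.pos F) f atTop P := by
  refine Metric.tendstoUniformlyOn_iff.2 fun ε hε => ?_
  obtain ⟨δ, hδ, hfδ⟩ := Metric.uniformContinuousOn_iff.1
    (hP.uniformContinuousOn_of_continuous hf) (ε / 2) (half_pos hε)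
  obtain ⟨D, hD⟩ := hP.isBounded.subset_closedBall c
  -- The contraction moves `x` by at most `D / (m + 2)`, and the mollifier reaches a further `r / (2
  -- (m + 2))`.
  have hlim : Tendsto (fun m : ℕ => 1 / ((m : ℝ) + 2) * (r / 2 + D)) atTop (𝓝 0) := by
    simpa using tendsto_starScale.mul_const (r / 2 + D)
  filter_upwards [hlim.eventually_lt_const hδ] with m hm x hx
  rw [dist_comm, dist_eq_norm]
  refine (norm_starMollify_sub_le hF (half_pos hε).le fun y hy => ?_).trans_lt (half_lt_self hε)
  have hyP : y ∈ interior P :=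
    hc.closedBall_starBump_subset m hx (Metric.ball_subset_closedBall hy)
  rw [hFf y hyP, ← dist_eq_norm]
  refine (hfδ y (interior_subset hyP) x hx ?_).le
  have h1 : dist (c + (1 - 1 / ((m : ℝ) + 2)) • (x - c)) x = 1 / ((m : ℝ) + 2) * dist x c := by
    rw [dist_eq_norm, dist_eq_norm, ← norm_neg (x - c),
      ← Real.norm_of_nonneg (by positivity : 0 ≤ 1 / ((m : ℝ) + 2)), ← norm_smul,
      Real.norm_of_nonneg (by positivity : 0 ≤ 1 / ((m : ℝ) + 2))]
    congr 1
    module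
  have h2 : dist x c ≤ D := hD hx
  refine (dist_triangle y (c + (1 - 1 / ((m : ℝ) + 2)) • (x - c)) x).trans_lt ?_
  rw [h1]
  have h3 : dist y (c + (1 - 1 / ((m : ℝ) + 2)) • (x - c)) < 1 / ((m : ℝ) + 2) * r / 2 := hy
  have h4 : 1 / ((m : ℝ) + 2) * dist x c ≤ 1 / ((m : ℝ) + 2) * D := by gcongr
  linarith

theorem starMollify_add {E : Type*} [NormedAddCommGroup E] [NormedSpace ℝ E] (c : Plane) (s : ℝ)
    (φ : ContDiffBump (0 : Plane)) {F K : Plane → E} (hF : LocallyIntegrable F)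
    (hK : LocallyIntegrable K) :
    starMollify c s φ (F + K) = starMollify c s φ F + starMollify c s φ K := by
  have h : ∀ {H : Plane → E}, LocallyIntegrable H →
      ConvolutionExists (φ.normed volume) H (ContinuousLinearMap.lsmul ℝ ℝ) volume := fun hH =>
    φ.hasCompactSupport_normed.convolutionExists_left _ φ.continuous_normed hH
  funext x
  simp only [starMollify, (h hF).distrib_add (h hK), Pi.add_apply]

/-- The operators are bounded on `L²` by `2` uniformly in `m` and converge uniformly on `P` for
continuous functions, so density of `C_c` suffices. The shares of `ε` are `2/4` for the operator on
`F - K`, and `1/4` each for the convergence on `K` and for `K - F`. -/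
theorem tendsto_eLpNorm_starApprox {P : Set Plane} (hP : IsCompact P) {c : Plane} {r : ℝ}
    (hc : IsStarCenter P c r) {G : Plane → Plane} (hGm : Measurable G)
    (hG : MemLp G 2 (areaMeasure P)) :
    Tendsto (fun m => eLpNorm (fun x => starApprox c hc.pos ((interior P).indicator G) m x - G x) 2
      (areaMeasure P)) atTop (𝓝 0) := by
  have := hP.isFiniteMeasure_areaMeasure
  set F := (interior P).indicator G with hF
  have hFm : Measurable F := hGm.indicator isOpen_interior.measurableSet
  have hFp : MemLp F 2 volume := (memLp_indicator_iff_restrict isOpen_interior.measurableSet).2 hG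
  refine ENNReal.tendsto_nhds_zero.2 fun ε hε => ?_
  have hε4 : ε / 4 ≠ 0 := (ENNReal.div_pos hε.ne' (by norm_num)).ne'
  obtain ⟨K, hKc, hFK, hKcont, hKp⟩ := hFp.exists_hasCompactSupport_eLpNorm_sub_le
    ENNReal.ofNat_ne_top hε4
  have hKlim := tendsto_eLpNorm_of_tendstoUniformlyOn
    (ae_restrict_mem isOpen_interior.measurableSet |>.mono fun x hx => interior_subset hx)
    (tendstoUniformlyOn_starApprox hP hc hKcont.continuousOn hKcont.aestronglyMeasurable
      fun _ _ => rfl) (fun _ _ => rfl) 2 (μ := areaMeasure P)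
  filter_upwards [ENNReal.tendsto_nhds_zero.1 hKlim (ε / 4) hε4.bot_lt] with m hm
  have hFKi : LocallyIntegrable (F - K) := (hFp.sub hKp).locallyIntegrable (by norm_num)
  have hKi : LocallyIntegrable K := hKp.locallyIntegrable (by norm_num)
  have hsplit : ∀ x, starApprox c hc.pos F m x =
      starApprox c hc.pos (F - K) m x + starApprox c hc.pos K m x := by
    intro x
    have := congrFun (starMollify_add c (1 - 1 / ((m : ℝ) + 2)) (starBump hc.pos m) hFKi hKi) x
    rwa [sub_add_cancel] at this
  have m1 : AEStronglyMeasurable (starApprox c hc.pos (F - K) m) (areaMeasure P) :=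
    (contDiff_starMollify c _ _ hFKi).continuous.aestronglyMeasurable
  have m2 : AEStronglyMeasurable (fun x => starApprox c hc.pos K m x - K x) (areaMeasure P) :=
    ((contDiff_starMollify c _ _ hKi).continuous.sub hKcont).aestronglyMeasurable
  have m3 : AEStronglyMeasurable (fun x => K x - F x) (areaMeasure P) :=
    (hKcont.measurable.sub hFm).aestronglyMeasurable
  have e1 : eLpNorm (starApprox c hc.pos (F - K) m) 2 (areaMeasure P) ≤ 2 * (ε / 4) :=
    (eLpNorm_mono_measure _ Measure.restrict_le_self).trans
      ((eLpNorm_starMollify_le c (starScale_mem m).1 _ (hFm.sub hKcont.measurable)).trans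
        (by gcongr))
  have e3 : eLpNorm (fun x => K x - F x) 2 (areaMeasure P) ≤ ε / 4 := by
    refine (eLpNorm_mono_measure _ Measure.restrict_le_self).trans (le_of_eq_of_le ?_ hFK)
    exact eLpNorm_sub_comm K F 2 volume
  calc eLpNorm (fun x => starApprox c hc.pos F m x - G x) 2 (areaMeasure P)
      = eLpNorm (starApprox c hc.pos (F - K) m + ((fun x => starApprox c hc.pos K m x - K x) +
          fun x => K x - F x)) 2 (areaMeasure P) := by
        refine eLpNorm_congr_ae ?_
        filter_upwards [ae_restrict_mem isOpen_interior.measurableSet] with x hx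
        have : F x = G x := indicator_of_mem hx G
        simp only [Pi.add_apply, hsplit, this]
        abel
    _ ≤ 2 * (ε / 4) + (ε / 4 + ε / 4) :=
        (eLpNorm_add_le m1 (m2.add m3) (by norm_num)).trans
          (add_le_add e1 ((eLpNorm_add_le m2 m3 (by norm_num)).trans (add_le_add hm e3)))
    _ = ε := by
        rw [← two_mul, ← two_mul, ← mul_assoc]
        norm_num
        exact ENNReal.mul_div_cancel (by norm_num) (by norm_num)

instance {n : ℕ} (a : Polygon Plane n) : IsFiniteMeasure (boundaryMeasure a) := by
  unfold boundaryMeasure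
  infer_instance

theorem IsPolygonalElement.ae_mem_frontier {n : ℕ} {P : Set Plane} {a : Polygon Plane n}
    (hP : IsPolygonalElement P a) : ∀ᵐ x ∂(boundaryMeasure a), x ∈ frontier P := by
  rw [boundaryMeasure, ae_finsetSum_measure_iff]
  exact fun i _ => (ae_mem_edgeSet a i).mono fun x hx => hP.edgeSet_subset i hx

/-- The trace of a function of `H¹(P) ∩ C⁰(P)` is its restriction to the boundary. -/
theorem HasWeakGradient.hasTrace_of_continuousOn {n : ℕ} {P : Set Plane} {a : Polygon Plane n}
    (hP : IsPolygonalElement P a) {g : Plane → ℝ} {G : Plane → Plane}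
    (hG : HasWeakGradient P g G) (hg : ContinuousOn g P) {w : C(frontier P, ℝ)}
    (hw : ∀ x : frontier P, w x = g x) : HasTrace P a g w := by
  -- The operator bound takes a Borel function; the weak gradient may be changed on a null set.
  wlog hGm : Measurable G generalizing G
  · obtain ⟨H, hH, hGH⟩ := hG.memLp_grad.aestronglyMeasurable.aemeasurable
    exact this (hG.congr_grad hGH) hH
  obtain ⟨c, r, hc⟩ := hP.exists_isStarCenter
  have := hP.isCompact.isFiniteMeasure_areaMeasure
  set F := (interior P).indicator g with hF
  have hFi : Integrable F := (integrable_indicator_iff isOpen_interior.measurableSet).2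
    (hG.memLp.integrable (by norm_num))
  have hlim := tendstoUniformlyOn_starApprox hP.isCompact hc hg hFi.1
    fun x hx => indicator_of_mem hx g
  have hint : ∀ᵐ x ∂(areaMeasure P), x ∈ interior P :=
    ae_restrict_mem isOpen_interior.measurableSet
  refine ⟨G, hG, starApprox c hc.pos F,
    fun m => contDiff_starMollify c _ _ hFi.locallyIntegrable,
    tendsto_eLpNorm_of_tendstoUniformlyOn (hint.mono fun x hx => interior_subset hx) hlim
      (fun _ _ => rfl) 2, ?_,
    tendsto_eLpNorm_of_tendstoUniformlyOn hP.ae_mem_frontier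
      (hlim.mono hP.frontier_subset) (fun x hx => ?_) 2⟩
  -- With `Gₘ` the approximation of `G`, the gradient of the approximation of `g` is `s Gₘ`, and `s
  -- Gₘ - G = s (Gₘ - G) - (1 - s) G`.
  · have h1 := tendsto_eLpNorm_starApprox hP.isCompact hc hGm hG.memLp_grad
    have h2 : Tendsto (fun m : ℕ => ‖1 / ((m : ℝ) + 2)‖ₑ * eLpNorm G 2 (areaMeasure P)) atTop
        (𝓝 0) := by
      have h3 : Tendsto (fun m : ℕ => ‖1 / ((m : ℝ) + 2)‖ₑ) atTop (𝓝 0) := by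
        simpa using tendsto_starScale.enorm
      simpa using ENNReal.Tendsto.mul_const h3 (Or.inr hG.memLp_grad.2.ne)
    have h4 := h1.add h2
    rw [add_zero] at h4
    refine tendsto_of_tendsto_of_tendsto_of_le_of_le tendsto_const_nhds h4 (fun _ => zero_le)
      fun m => ?_
    have hFG : LocallyIntegrable ((interior P).indicator G) :=
      ((integrable_indicator_iff isOpen_interior.measurableSet).2
        (hG.memLp_grad.integrable (by norm_num))).locallyIntegrable
    have m1 : AEStronglyMeasurable (fun x => starApprox c hc.pos ((interior P).indicator G) m x -
        G x) (areaMeasure P) :=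
      ((contDiff_starMollify c _ _ hFG).continuous.measurable.sub hGm).aestronglyMeasurable
    set s := 1 - 1 / ((m : ℝ) + 2) with hs
    have hs' : 1 / ((m : ℝ) + 2) = 1 - s := by rw [hs]; ring
    have hs1 : ‖s‖ₑ ≤ 1 := by
      rw [Real.enorm_of_nonneg (by linarith [(starScale_mem m).1])]
      exact ENNReal.ofReal_le_one.2 (starScale_mem m).2
    calc eLpNorm (fun x => ∇ (starApprox c hc.pos F m) x - G x) 2 (areaMeasure P)
        = eLpNorm ((s • fun x => starApprox c hc.pos ((interior P).indicator G) m x - G x) -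
            (1 / ((m : ℝ) + 2)) • G) 2 (areaMeasure P) := by
          refine eLpNorm_congr_ae (hint.mono fun x hx => ?_)
          have := gradient_starMollify hP.isCompact hG
            (hc.closedBall_starBump_subset m (interior_subset hx))
          rw [← hs] at this
          simp only [Pi.sub_apply, Pi.smul_apply, hs', starApprox, sub_sub_cancel] at this ⊢
          rw [hF, this]
          module
      _ ≤ _ := by
          refine (eLpNorm_sub_le (m1.const_smul s) (hG.memLp_grad.1.const_smul _)
            (by norm_num)).trans (add_le_add ?_ ?_)
          · rw [eLpNorm_const_smul]
            exact mul_le_of_le_one_left' hs1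
          · rw [eLpNorm_const_smul]
  · rw [← hw ⟨x, hx⟩, extendZero_apply w ⟨x, hx⟩]

/-! ### Cutoffs with a point singularity -/

/-- `η` is smooth off `b`, bounded by `1`, and its gradient on `P` is `O(1 / |x - b|)`. -/
structure IsCutoffAt (P : Set Plane) (b : Plane) (η : Plane → ℝ) : Prop where
  contDiffAt : ∀ x ≠ b, ContDiffAt ℝ ∞ η x
  norm_le : ∀ x, ‖η x‖ ≤ 1
  gradient_le : ∃ C, ∀ x ∈ P, x ≠ b → ‖∇ η x‖ ≤ C / dist x b

/-- The singular point is outside the interior, so `η` is smooth near the support of `φ`. -/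
theorem IsCutoffAt.mul_testFunction {P : Set Plane} {b : Plane} {η : Plane → ℝ}
    (hη : IsCutoffAt P b η) (hb : b ∉ interior P) {φ : Plane → ℝ}
    (hφ : IsTestFunction (interior P) φ) : IsTestFunction (interior P) fun x => η x * φ x where
  smooth := by
    refine contDiff_iff_contDiffAt.2 fun x => ?_
    by_cases hx : x ∈ tsupport φ
    · exact (hη.contDiffAt x fun h => hb (h ▸ hφ.support_subset hx)).mul hφ.smooth.contDiffAt
    · refine contDiffAt_const (c := (0 : ℝ)) |>.congr_of_eventuallyEq ?_
      filter_upwards [notMem_tsupport_iff_eventuallyEq.1 hx] with y hy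
      simp [hy]
  compactSupport := hφ.compactSupport.mul_left
  support_subset := (tsupport_mul_subset_right).trans hφ.support_subset

theorem IsCutoffAt.aestronglyMeasurable {P : Set Plane} {b : Plane} {η : Plane → ℝ}
    (hη : IsCutoffAt P b η) (hb : b ∉ interior P) :
    AEStronglyMeasurable η (areaMeasure P) ∧ AEStronglyMeasurable (∇ η) (areaMeasure P) := by
  have h : ContDiffOn ℝ ∞ η (interior P) := fun x hx =>
    (hη.contDiffAt x fun h => hb (h ▸ hx)).contDiffWithinAt
  refine ⟨h.continuousOn.aestronglyMeasurable isOpen_interior.measurableSet,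
    ContinuousOn.aestronglyMeasurable ?_ isOpen_interior.measurableSet⟩
  exact (InnerProductSpace.toDual ℝ Plane).symm.continuous.comp_continuousOn
    (h.continuousOn_fderiv_of_isOpen isOpen_interior (by simp))

/-- The product rule, obtained by testing the weak gradient of `g` with `η φ`. The term `g ∇η` is
square integrable because `|∇η| ≤ C / |x - b|`; this is where the vertex condition enters. -/
theorem IsCutoffAt.hasWeakGradient_mul {P : Set Plane} {b : Plane} {η g : Plane → ℝ}
    {G : Plane → Plane} (hη : IsCutoffAt P b η) (hb : b ∉ interior P)
    (hg : HasWeakGradient P g G) (hgb : MemLp (fun x => g x / dist x b) 2 (areaMeasure P)) :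
    HasWeakGradient P (fun x => η x * g x) (fun x => η x • G x + g x • ∇ η x) := by
  obtain ⟨m1, m2⟩ := hη.aestronglyMeasurable hb
  obtain ⟨C, hC⟩ := hη.gradient_le
  have hint : ∀ᵐ x ∂(areaMeasure P), x ∈ interior P :=
    ae_restrict_mem isOpen_interior.measurableSet
  have l1 : MemLp (fun x => η x • G x) 2 (areaMeasure P) :=
    hg.memLp_grad.of_le (m1.smul hg.memLp_grad.1) (.of_forall fun x => by
      rw [norm_smul]
      exact mul_le_of_le_one_left (norm_nonneg _) (hη.norm_le x))
  have l2 : MemLp (fun x => g x • ∇ η x) 2 (areaMeasure P) := by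
    refine hgb.of_le_mul (c := C) (hg.memLp.1.smul m2) (hint.mono fun x hx => ?_)
    have := hC x (interior_subset hx) fun h => hb (h ▸ hx)
    rw [norm_smul, norm_div, Real.norm_of_nonneg (dist_nonneg : 0 ≤ dist x b)]
    refine (mul_le_mul_of_nonneg_left this (norm_nonneg _)).trans_eq ?_
    ring
  refine ⟨hg.memLp.of_le (m1.mul hg.memLp.1) (.of_forall fun x => ?_), l1.add l2, fun φ hφ => ?_⟩
  · rw [norm_mul]
    exact mul_le_of_le_one_left (norm_nonneg _) (hη.norm_le x)
  have hηφ := hη.mul_testFunction hb hφ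
  have hφm := hφ.memLp (areaMeasure P)
  have i1 : Integrable (fun x => g x • ∇ (fun x => η x * φ x) x) (areaMeasure P) :=
    integrable_smul_of_memLp hg.memLp (hηφ.memLp_gradient _)
  have i2 : Integrable (fun x => φ x • g x • ∇ η x) (areaMeasure P) :=
    integrable_smul_of_memLp hφm l2
  have i3 : Integrable (fun x => (η x * φ x) • G x) (areaMeasure P) :=
    integrable_smul_of_memLp (hηφ.memLp _) hg.memLp_grad
  calc ∫ x in interior P, (η x * g x) • ∇ φ x
      = ∫ x in interior P, (g x • ∇ (fun x => η x * φ x) x - φ x • g x • ∇ η x) := by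
        refine integral_congr_ae (hint.mono fun x hx => ?_)
        simp only
        rw [gradient_mul ((hη.contDiffAt x fun h => hb (h ▸ hx)).differentiableAt (by simp))
          ((hφ.smooth.differentiable (by simp)) x)]
        module
    _ = - ∫ x in interior P, ((η x * φ x) • G x + φ x • g x • ∇ η x) := by
        rw [integral_sub i1 i2, integral_add i3 i2, hg.integral_eq _ hηφ]
        module
    _ = _ := by
        congr 1
        refine integral_congr_ae (.of_forall fun x => ?_)
        module

/-- At `b` the factor `η` may jump but is bounded, and `g` tends to `0` there. -/
theorem IsCutoffAt.continuousOn_mul {P : Set Plane} {b : Plane} {η g : Plane → ℝ}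
    (hη : IsCutoffAt P b η) (hg : ContinuousOn g P) (hgb : g b = 0) :
    ContinuousOn (fun x => η x * g x) P := by
  intro x hx
  rcases eq_or_ne x b with rfl | hxb
  · have h0 : Tendsto (fun y => ‖g y‖) (𝓝[P] x) (𝓝 0) := by
      simpa [hgb] using (hg x hx).norm.tendsto
    rw [ContinuousWithinAt, hgb, mul_zero]
    refine squeeze_zero_norm (fun y => ?_) h0
    rw [norm_mul]
    exact mul_le_of_le_one_left (norm_nonneg _) (hη.norm_le y)
  · exact (hη.contDiffAt x hxb).continuousAt.continuousWithinAt.mul (hg x hx)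

theorem isCutoffAt_of_contDiff {P : Set Plane} (hP : IsCompact P) (b : Plane) {η : Plane → ℝ}
    (hη : ContDiff ℝ ∞ η) (h1 : ∀ x, ‖η x‖ ≤ 1) : IsCutoffAt P b η := by
  refine ⟨fun x _ => hη.contDiffAt, h1, ?_⟩
  obtain ⟨C, hC⟩ := hP.exists_bound_of_continuousOn
    (f := fun x => dist x b • ∇ η x)
    ((continuous_id.dist continuous_const).smul (continuous_gradient hη)).continuousOn
  refine ⟨C, fun x hx hxb => (le_div_iff₀ (dist_pos.2 hxb)).2 ?_⟩
  have := hC x hx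
  rwa [norm_smul, Real.norm_of_nonneg dist_nonneg, mul_comm] at this

/-- One unit of the constant `2` pays for moving the vector, the other for the change of its norm.
The bound also covers `y = 0`, whose normalization is `0`. -/
theorem norm_inv_norm_smul_sub_le {E : Type*} [NormedAddCommGroup E] [NormedSpace ℝ E] {x : E}
    (hx : x ≠ 0) (y : E) : ‖‖y‖⁻¹ • y - ‖x‖⁻¹ • x‖ ≤ 2 / ‖x‖ * ‖y - x‖ := by
  have hx0 : 0 < ‖x‖ := norm_pos_iff.2 hx
  rcases eq_or_ne y 0 with rfl | hy
  · rw [smul_zero, zero_sub, norm_neg, zero_sub, norm_neg, norm_smul, norm_inv, norm_norm,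
      inv_mul_cancel₀ hx0.ne', div_mul_cancel₀ _ hx0.ne']
    norm_num
  have hy0 : 0 < ‖y‖ := norm_pos_iff.2 hy
  have e : ‖y‖⁻¹ • y - ‖x‖⁻¹ • x = ‖x‖⁻¹ • (y - x) + ((‖x‖ - ‖y‖) * (‖x‖⁻¹ * ‖y‖⁻¹)) • y := by
    have : (‖x‖ - ‖y‖) * (‖x‖⁻¹ * ‖y‖⁻¹) = ‖y‖⁻¹ - ‖x‖⁻¹ := by field_simp
    rw [this]
    module
  rw [e]
  refine (norm_add_le _ _).trans ?_
  rw [norm_smul, norm_smul, norm_mul, norm_mul, norm_inv, norm_inv, norm_norm, norm_norm]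
  have h1 : ‖‖x‖ - ‖y‖‖ ≤ ‖y - x‖ := by
    rw [norm_sub_rev y x]
    exact abs_norm_sub_norm_le x y
  have h2 : ‖‖x‖ - ‖y‖‖ * (‖x‖⁻¹ * ‖y‖⁻¹) * ‖y‖ = ‖‖x‖ - ‖y‖‖ * ‖x‖⁻¹ := by
    field_simp
  rw [h2]
  calc ‖x‖⁻¹ * ‖y - x‖ + ‖‖x‖ - ‖y‖‖ * ‖x‖⁻¹ ≤ ‖x‖⁻¹ * ‖y - x‖ + ‖y - x‖ * ‖x‖⁻¹ := by gcongr
    _ = _ := by ring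

/-- A cutoff which separates two rays from `b`. -/
theorem exists_isCutoffAt_ray (P : Set Plane) (b : Plane) {d e : Plane} (hd : d ≠ 0) (he : e ≠ 0)
    (h : ¬SameRay ℝ d e) : ∃ η, IsCutoffAt P b η ∧
      ∀ t : ℝ, 0 < t → η (b + t • d) = 1 ∧ η (b + t • e) = 0 := by
  have hne : ‖d‖⁻¹ • d ≠ ‖e‖⁻¹ • e := fun h' =>
    h ((sameRay_iff_inv_norm_smul_eq_of_ne hd he).2 h')
  have hδ := dist_pos.2 hne.symm
  -- A bump about the unit vector of `d`, vanishing from the unit vector of `e` outwards. Evaluated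
  -- at the direction of `x - b` it is constant along rays, and its gradient decays like `1 / |x -
  -- b|`.
  let f : ContDiffBump (‖d‖⁻¹ • d) := ⟨_, _, half_pos hδ, half_lt_self hδ⟩
  have hf : ContDiff ℝ ∞ f := f.contDiff
  obtain ⟨K, hK⟩ := (hf.of_le (m := 1) (by simp)).lipschitzWith_of_hasCompactSupport
    f.hasCompactSupport one_ne_zero
  refine ⟨fun x => f (‖x - b‖⁻¹ • (x - b)), ⟨fun x hx => ?_, fun x => ?_, K * 2, fun x _ hx => ?_⟩,
    fun t ht => ?_⟩
  · have h1 : ContDiffAt ℝ ∞ (fun x : Plane => x - b) x := by fun_prop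
    have h2 : ContDiffAt ℝ ∞ (fun x : Plane => ‖x - b‖⁻¹) x :=
      (h1.norm ℝ (sub_ne_zero.2 hx)).inv (norm_ne_zero_iff.2 (sub_ne_zero.2 hx))
    have h3 : ContDiffAt ℝ ∞ (fun x : Plane => ‖x - b‖⁻¹ • (x - b)) x := h2.smul h1
    exact hf.contDiffAt.comp x h3
  · rw [Real.norm_of_nonneg f.nonneg]
    exact f.le_one
  · rw [norm_gradient_eq]
    refine norm_fderiv_le_of_lip' ℝ (by positivity) (.of_forall fun y => ?_)
    refine (hK.norm_sub_le _ _).trans ?_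
    have := norm_inv_norm_smul_sub_le (sub_ne_zero.2 hx) (y - b)
    rw [sub_sub_sub_cancel_right, ← dist_eq_norm x b] at this
    refine (mul_le_mul_of_nonneg_left this K.coe_nonneg).trans_eq ?_
    ring
  · have h1 : ∀ v : Plane, ‖t • v‖⁻¹ • t • v = ‖v‖⁻¹ • v := fun v => by
      rw [norm_smul, Real.norm_of_nonneg ht.le, mul_inv, smul_smul, mul_right_comm,
        inv_mul_cancel₀ ht.ne', one_mul]
    simp only [add_sub_cancel_left, h1]
    exact ⟨f.one_of_mem_closedBall (Metric.mem_closedBall_self f.rIn_pos.le),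
      f.zero_of_le_dist le_rfl⟩

theorem exists_contDiff_zero_one {s t : Set Plane} (hs : IsClosed s) (ht : IsClosed t)
    (hd : Disjoint s t) : ∃ f : Plane → ℝ, ContDiff ℝ ∞ f ∧ EqOn f 0 s ∧ EqOn f 1 t ∧
      ∀ x, ‖f x‖ ≤ 1 := by
  obtain ⟨f, h0, h1, hf⟩ := exists_contMDiffMap_zero_one_of_isClosed (n := (⊤ : ℕ∞))
    (modelWithCornersSelf ℝ Plane) hs ht hd
  refine ⟨f, f.contMDiff.contDiff, h0, h1, fun x => ?_⟩
  rw [Real.norm_of_nonneg (hf x).1]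
  exact (hf x).2

/-- A smooth function is Lipschitz on the compact set `P`, so the quotient is bounded. -/
theorem memLp_sub_div_dist_of_contDiff {P : Set Plane} (hP : IsCompact P) {f : Plane → ℝ}
    (hf : ContDiff ℝ ∞ f) {b : Plane} (hb : b ∈ P) :
    MemLp (fun x => (f x - f b) / dist x b) 2 (areaMeasure P) := by
  have := hP.isFiniteMeasure_areaMeasure
  obtain ⟨K, hK⟩ := LocallyLipschitzOn.exists_lipschitzOnWith_of_compact hP
    ((hf.of_le (m := 1) (by simp)).locallyLipschitz.locallyLipschitzOn)
  refine MemLp.of_bound (C := K) ?_ ?_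
  · exact ((hf.continuous.measurable.sub_const _).div
      (measurable_id.dist measurable_const)).aestronglyMeasurable
  · filter_upwards [ae_restrict_mem isOpen_interior.measurableSet] with x hx
    rw [norm_div, Real.norm_of_nonneg (dist_nonneg : 0 ≤ dist x b)]
    refine div_le_of_le_mul₀ dist_nonneg K.coe_nonneg ?_
    rw [← dist_eq_norm]
    exact hK.dist_le_mul x (interior_subset hx) b hb

/-! ### Lifting of boundary values -/

theorem IsPolygonalElement.finRotate_finRotate_ne {n : ℕ} {P : Set Plane} {a : Polygon Plane n}
    (hP : IsPolygonalElement P a) (i : Fin n) : finRotate n (finRotate n i) ≠ i := by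
  obtain ⟨m, rfl⟩ : ∃ m, n = m + 3 := ⟨n - 3, by have := hP.three_le; omega⟩
  rw [finRotate_apply, finRotate_apply, add_assoc]
  intro h
  have h2 := congrArg Fin.val (add_eq_left.1 h)
  simp [Fin.val_add, Nat.mod_eq_of_lt (by omega : 2 < m + 3)] at h2

theorem exists_eq_add_smul_of_mem_edgeSet {n : ℕ} (a : Polygon Plane n) (i : Fin n) {x : Plane}
    (hx : x ∈ a.edgeSet ℝ i) :
    (x ≠ a i → ∃ t : ℝ, 0 < t ∧ x = a i + t • (a (finRotate n i) - a i)) ∧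
    (x ≠ a (finRotate n i) →
      ∃ t : ℝ, 0 < t ∧ x = a (finRotate n i) + t • (a i - a (finRotate n i))) := by
  rw [a.edgeSet_eq_image_edgePath ℝ] at hx
  obtain ⟨t, ⟨h0, h1⟩, rfl⟩ := hx
  simp only [Polygon.edgePath, AffineMap.lineMap_apply, vsub_eq_sub, vadd_eq_add]
  refine ⟨fun h => ⟨t, h0.lt_of_ne ?_, by module⟩, fun h => ⟨1 - t, sub_pos.2 (h1.lt_of_ne ?_),
    by module⟩⟩
  · rintro rfl
    simp at h
  · rintro rfl
    simp at h

/-- If two consecutive edges left their common vertex in the same direction, the far end of the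
shorter one would lie on the longer one, against simplicity. Opposite directions, that is aligned
edges, remain allowed. -/
theorem IsPolygonalElement.not_sameRay {n : ℕ} {P : Set Plane} {a : Polygon Plane n}
    (hP : IsPolygonalElement P a) (i : Fin n) :
    ¬SameRay ℝ (a i - a (finRotate n i))
      (a (finRotate n (finRotate n i)) - a (finRotate n i)) := by
  intro h
  have hne := hP.finRotate_finRotate_ne i
  have hne1 := hP.finRotate_ne i
  have hne2 := hP.finRotate_ne (finRotate n i)
  obtain ⟨r, s, hr, hs, hrs⟩ := h.exists_pos (sub_ne_zero.2 (hP.ne i).symm)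
    (sub_ne_zero.2 (hP.ne (finRotate n i)))
  have hsimple := hP.simple i (finRotate n i) hne1.symm
  rcases le_total r s with hle | hle
  · have hmem : a (finRotate n (finRotate n i)) ∈ a.edgeSet ℝ i := by
      have := edgePath_mem a i (t := 1 - r / s) (sub_nonneg.2 ((div_le_one hs).2 hle))
        (by linarith [div_pos hr hs])
      convert this using 1
      have e : a (finRotate n (finRotate n i)) - a (finRotate n i) =
          (r / s) • (a i - a (finRotate n i)) := by
        rw [div_eq_inv_mul, mul_smul, hrs, inv_smul_smul₀ hs.ne']
      simp only [Polygon.edgePath, AffineMap.lineMap_apply, vsub_eq_sub, vadd_eq_add]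
      rw [← sub_add_cancel (a (finRotate n (finRotate n i))) (a (finRotate n i)), e]
      module
    rcases (hsimple ⟨hmem, a.right_mem_edgeSet _⟩).1 with h1 | h1
    · exact hne (hP.injective h1)
    · exact hne2 (hP.injective h1)
  · have hmem : a i ∈ a.edgeSet ℝ (finRotate n i) := by
      have := edgePath_mem a (finRotate n i) (t := s / r) (div_pos hs hr).le ((div_le_one hr).2 hle)
      convert this using 1
      have e : a i - a (finRotate n i) =
          (s / r) • (a (finRotate n (finRotate n i)) - a (finRotate n i)) := by
        rw [div_eq_inv_mul, mul_smul, ← hrs, inv_smul_smul₀ hr.ne']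
      simp only [Polygon.edgePath, AffineMap.lineMap_apply, vsub_eq_sub, vadd_eq_add]
      rw [← e, sub_add_cancel]
    rcases (hsimple ⟨a.left_mem_edgeSet _, hmem⟩).2 with h1 | h1
    · exact hne1.symm (hP.injective h1)
    · exact hne.symm (hP.injective h1)

theorem IsPolygonalElement.disjoint_edgeSet {n : ℕ} {P : Set Plane} {a : Polygon Plane n}
    (hP : IsPolygonalElement P a) {i j : Fin n} (hij : j ≠ i) (h1 : j ≠ finRotate n i)
    (h2 : finRotate n j ≠ i) : Disjoint (a.edgeSet ℝ i) (a.edgeSet ℝ j) := by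
  refine Set.disjoint_left.2 fun x hi hj => ?_
  obtain ⟨hxi, hxj⟩ := hP.simple i j hij.symm ⟨hi, hj⟩
  rcases hxi with rfl | rfl <;> rcases hxj with h | h
  · exact hij (hP.injective h).symm
  · exact h2 (hP.injective h).symm
  · exact h1 (hP.injective h).symm
  · exact hij ((finRotate n).injective (hP.injective h)).symm

theorem IsPolygonalElement.vertex_notMem_interior {n : ℕ} {P : Set Plane} {a : Polygon Plane n}
    (hP : IsPolygonalElement P a) (i : Fin n) : a i ∉ interior P := (hP.vertex_mem i).2

theorem IsCutoffAt.memLp_mul_div {P : Set Plane} {b : Plane} {η g : Plane → ℝ}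
    (hη : IsCutoffAt P b η) (hb : b ∉ interior P) {c : Plane}
    (hg : MemLp (fun x => g x / dist x c) 2 (areaMeasure P)) :
    MemLp (fun x => η x * g x / dist x c) 2 (areaMeasure P) := by
  simp only [mul_div_assoc]
  refine hg.of_le ((hη.aestronglyMeasurable hb).1.mul hg.1) (.of_forall fun x => ?_)
  rw [norm_mul]
  exact mul_le_of_le_one_left (norm_nonneg _) (hη.norm_le x)

/-- Multiply `g` by three cutoffs equal to `1` on the open edge: `χ` vanishes on the edges disjoint
from it, `θ` on the next edge and `ζ` on the previous one. At the two shared vertices `g` itself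
vanishes. -/
theorem IsPolygonalElement.exists_edge_lift {n : ℕ} {P : Set Plane} {a : Polygon Plane n}
    (hP : IsPolygonalElement P a) (i : Fin n) {g : Plane → ℝ} (hg : MemH1 P g)
    (hgc : ContinuousOn g P) (h0i : g (a i) = 0)
    (h0n : g (a (finRotate n i)) = 0)
    (hri : MemLp (fun x => g x / dist x (a i)) 2 (areaMeasure P))
    (hrn : MemLp (fun x => g x / dist x (a (finRotate n i))) 2 (areaMeasure P)) :
    ∃ u, MemH1 P u ∧ ContinuousOn u P ∧ (∀ x ∈ a.edgeSet ℝ i, u x = g x) ∧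
      ∀ j ≠ i, ∀ x ∈ a.edgeSet ℝ j, u x = 0 := by
  obtain ⟨G, hG⟩ := hg
  have hcl : ∀ j, IsClosed (a.edgeSet ℝ j) := fun j => (isCompact_edgeSet a j).isClosed
  obtain ⟨χ, hχ, hχ0, hχ1, hχb⟩ := exists_contDiff_zero_one
    (s := ⋃ j ∈ {j | Disjoint (a.edgeSet ℝ i) (a.edgeSet ℝ j)}, a.edgeSet ℝ j)
    (t := a.edgeSet ℝ i) ((Set.toFinite _).isClosed_biUnion fun j _ => hcl j) (hcl i)
    (Set.disjoint_iUnion₂_left.2 fun j hj => hj.symm)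
  have hχc := isCutoffAt_of_contDiff hP.isCompact (a i) hχ hχb
  obtain ⟨θ, hθ, hθv⟩ := exists_isCutoffAt_ray P (a (finRotate n i))
    (sub_ne_zero.2 (hP.ne i).symm) (sub_ne_zero.2 (hP.ne (finRotate n i))) (hP.not_sameRay i)
  obtain ⟨j, hj⟩ : ∃ j, finRotate n j = i := (finRotate n).surjective i
  obtain ⟨ζ, hζ, hζv⟩ := exists_isCutoffAt_ray P (a i) (d := a (finRotate n i) - a i)
    (e := a j - a i) (sub_ne_zero.2 (hP.ne i)) (sub_ne_zero.2 (hj ▸ (hP.ne j).symm))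
    (fun h => hP.not_sameRay j (by rw [hj]; exact h.symm))
  have hbi := hP.vertex_notMem_interior i
  have hbn := hP.vertex_notMem_interior (finRotate n i)
  refine ⟨fun x => χ x * (θ x * (ζ x * g x)), ?_, ?_, fun x hx => ?_, fun l hl x hx => ?_⟩
  · exact ⟨_, hχc.hasWeakGradient_mul hbi (hθ.hasWeakGradient_mul hbn (hζ.hasWeakGradient_mul hbi hG hri)
      (hζ.memLp_mul_div hbi hrn)) (hθ.memLp_mul_div hbn (hζ.memLp_mul_div hbi hri))⟩
  · exact hχ.continuous.continuousOn.mul (hθ.continuousOn_mul (hζ.continuousOn_mul hgc h0i)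
      (by rw [h0n, mul_zero]))
  · by_cases h1 : x = a i
    · simp [h1, h0i]
    by_cases h2 : x = a (finRotate n i)
    · simp only [h2, h0n, mul_zero]
    obtain ⟨t, ht, e1⟩ := (exists_eq_add_smul_of_mem_edgeSet a i hx).1 h1
    obtain ⟨s, hs, e2⟩ := (exists_eq_add_smul_of_mem_edgeSet a i hx).2 h2
    have k1 : ζ x = 1 := by rw [e1]; exact (hζv t ht).1
    have k2 : θ x = 1 := by rw [e2]; exact (hθv s hs).1
    simp only [k1, k2, hχ1 hx, Pi.one_apply, one_mul]
  · by_cases h1 : x = a i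
    · simp [h1, h0i]
    by_cases h2 : x = a (finRotate n i)
    · simp only [h2, h0n, mul_zero]
    by_cases k1 : l = finRotate n i
    · obtain ⟨t, ht, e1⟩ := (exists_eq_add_smul_of_mem_edgeSet a l hx).1 (by rwa [k1])
      rw [k1] at e1
      have : θ x = 0 := by rw [e1]; exact (hθv t ht).2
      simp [this]
    by_cases k2 : finRotate n l = i
    · obtain rfl : l = j := (finRotate n).injective (k2.trans hj.symm)
      obtain ⟨t, ht, e1⟩ := (exists_eq_add_smul_of_mem_edgeSet a l hx).2 (by rwa [k2])
      rw [k2] at e1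
      have : ζ x = 0 := by rw [e1]; exact (hζv t ht).2
      simp [this]
    have : χ x = 0 := hχ0 (mem_biUnion (hP.disjoint_edgeSet hl k1 k2) hx)
    simp [this]

theorem MemH1.sum {P : Set Plane} {ι : Type*} (s : Finset ι) {u : ι → Plane → ℝ}
    (hu : ∀ i, MemH1 P (u i)) : MemH1 P fun x => ∑ i ∈ s, u i x := by
  classical
  induction s using Finset.induction_on with
  | empty => simpa using ⟨_, hasWeakGradient_zero P⟩
  | insert i s his ih =>
    obtain ⟨G, hG⟩ := ih
    obtain ⟨H, hH⟩ := hu i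
    refine ⟨_, (hH.smul_add hG 1).congr (.of_forall fun x => ?_)⟩
    simp [Finset.sum_insert his]

theorem IsPolygonalElement.exists_contDiff_eq_vertices {n : ℕ} {P : Set Plane}
    {a : Polygon Plane n} (hP : IsPolygonalElement P a) (m : Fin n → ℝ) :
    ∃ F : Plane → ℝ, ContDiff ℝ ∞ F ∧ ∀ i, F (a i) = m i := by
  have h := fun i => exists_contDiff_zero_one (s := a '' {i}ᶜ) (t := {a i})
    (Set.toFinite _).isClosed isClosed_singleton (Set.disjoint_singleton_right.2 (by
      rintro ⟨j, hj, h⟩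
      exact hj (hP.injective h)))
  choose f hf h0 h1 _ using h
  refine ⟨fun x => ∑ i, m i * f i x, ContDiff.sum fun i _ => contDiff_const.mul (hf i),
    fun j => ?_⟩
  simp only
  rw [Finset.sum_eq_single j]
  · rw [h1 j rfl, Pi.one_apply, mul_one]
  · intro i _ hij
    rw [h0 i (mem_image_of_mem _ (by simpa using hij.symm)), Pi.zero_apply, mul_zero]
  · simp

/-- After subtracting a smooth `F` with the same vertex values, each edge can be lifted separately:
the function to be lifted vanishes at both ends and inherits the vertex condition from `ψ`. -/
theorem IsPolygonalElement.exists_lift {n : ℕ} {P : Set Plane} {a : Polygon Plane n}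
    (hP : IsPolygonalElement P a) {k : ℕ} {Ψ : Submodule ℝ (Plane → ℝ)}
    (hΨc : ∀ ψ ∈ Ψ, ContinuousOn ψ P) (hΨ : ∀ ψ ∈ Ψ, MemH1 P ψ) (hr : VertexRegular P a Ψ)
    {w : C(frontier P, ℝ)} (hw : w ∈ boundarySpace P a k Ψ) :
    ∃ u, MemH1 P u ∧ ContinuousOn u P ∧ ∀ x : frontier P, w x = u x := by
  obtain ⟨F, hF, hFv⟩ := hP.exists_contDiff_eq_vertices fun i => w ⟨a i, hP.vertex_mem i⟩
  have key : ∀ i, ∃ u, MemH1 P u ∧ ContinuousOn u P ∧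
      (∀ x : frontier P, x.1 ∈ a.edgeSet ℝ i → u x = w x - F x) ∧
      ∀ j ≠ i, ∀ x ∈ a.edgeSet ℝ j, u x = 0 := by
    intro i
    obtain ⟨g, hg, hgw⟩ := hw i
    obtain ⟨p, hp, ψ, hψ, rfl⟩ := Submodule.mem_sup.1 hg
    have hpF : ContDiff ℝ ∞ fun x => p x - F x := (contDiff_of_mem_polySpace hp).sub hF
    obtain ⟨H, hH⟩ := hΨ ψ hψ
    have hz : ∀ j, a j ∈ a.edgeSet ℝ i → 1 * (p (a j) - F (a j)) + ψ (a j) = 0 := by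
      intro j hj
      have := hgw ⟨a j, hP.vertex_mem j⟩ hj
      rw [Pi.add_apply] at this
      rw [hFv, this]
      ring
    have hzr : ∀ j, a j ∈ a.edgeSet ℝ i →
        MemLp (fun x => (1 * (p x - F x) + ψ x) / dist x (a j)) 2 (areaMeasure P) := by
      intro j hj
      -- Since `p - F + ψ` vanishes at `a j`, it is the sum of the increments of `p - F` and of `ψ`
      -- from that vertex.
      have h1 := (memLp_sub_div_dist_of_contDiff hP.isCompact hpF
        (hP.frontier_subset (hP.vertex_mem j))).add (hr ψ hψ j)
      refine (memLp_congr_ae (.of_forall fun x => ?_)).1 h1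
      have := hz j hj
      rw [Pi.add_apply, ← add_div]
      congr 1
      linarith
    have hl := a.left_mem_edgeSet i
    have hr := a.right_mem_edgeSet i
    obtain ⟨u, hu, huc, hui, huj⟩ := hP.exists_edge_lift i
      ⟨_, (hasWeakGradient_of_contDiff hP.isCompact hpF).smul_add hH 1⟩
      ((continuousOn_const.mul hpF.continuous.continuousOn).add (hΨc ψ hψ))
      (hz _ hl) (hz _ hr) (hzr _ hl) (hzr _ hr)
    refine ⟨u, hu, huc, fun x hx => ?_, huj⟩
    rw [hui x hx, hgw x hx, Pi.add_apply]
    ring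
  choose u hu huc hui huj using key
  obtain ⟨H, hH⟩ := MemH1.sum Finset.univ hu
  refine ⟨_, ⟨_, (hasWeakGradient_of_contDiff hP.isCompact hF).smul_add hH 1⟩,
    (continuousOn_const.mul hF.continuous.continuousOn).add
      (continuousOn_finsetSum _ fun i _ => huc i), fun x => ?_⟩
  obtain ⟨i, hi⟩ := mem_iUnion.1 (hP.frontier_eq ▸ x.2 : x.1 ∈ a.boundary ℝ)
  -- On edge `i` all other edge lifts vanish.
  rw [Finset.sum_eq_single i (fun j _ hj => huj j i hj.symm x hi) (by simp), hui i x hi]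
  ring

/-- Every function of the boundary space is the trace of a function which is harmonic in `P`. -/
theorem IsPolygonalElement.exists_harmonic_hasTrace {n : ℕ} {P : Set Plane} {a : Polygon Plane n}
    (hP : IsPolygonalElement P a) {k : ℕ} {Ψ : Submodule ℝ (Plane → ℝ)}
    (hΨc : ∀ ψ ∈ Ψ, ContinuousOn ψ P) (hΨ : ∀ ψ ∈ Ψ, MemH1 P ψ) (hr : VertexRegular P a Ψ)
    {w : C(frontier P, ℝ)} (hw : w ∈ boundarySpace P a k Ψ) :
    ∃ v, MemLp v 2 (areaMeasure P) ∧ HasWeakLaplacian P v 0 ∧ HasTrace P a v w := by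
  obtain ⟨u, ⟨H, hH⟩, huc, hwu⟩ := hP.exists_lift hΨc hΨ hr hw
  obtain ⟨z, G, hz, hzG⟩ := hP.exists_isTestLimit_inner_eq hH.memLp_grad
  have hzw := hz.hasWeakGradient hP.isCompact
  -- The harmonic function is the lift `u` minus its zero-trace part `z`.
  have hv := hzw.smul_add hH (-1)
  refine ⟨_, hv.memLp, ⟨_, hv, fun φ hφ => ?_⟩, ?_⟩
  · have hφg := hφ.memLp_gradient (areaMeasure P)
    have i1 := integrable_inner_of_memLp hzw.memLp_grad hφg
    have i2 := integrable_inner_of_memLp hH.memLp_grad hφg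
    simp only [inner_add_left, real_inner_smul_left, Pi.zero_apply, zero_mul, integral_zero,
      neg_zero]
    rw [integral_add (i1.const_mul (-1)) i2, integral_const_mul, hzG φ hφ]
    ring
  · have := (hz.hasTrace_zero hP).smul_add (hH.hasTrace_of_continuousOn hP huc hwu) (-1)
    rwa [smul_zero, zero_add] at this

/-! ### Unisolvence -/

theorem mem_boundarySpace_of_hasTrace {n : ℕ} {P : Set Plane} {a : Polygon Plane n}
    (hP : IsPolygonalElement P a) {k : ℕ} {Ψ : Submodule ℝ (Plane → ℝ)}
    (v : virtualSpace P a k Ψ) {w : C(frontier P, ℝ)} (h : HasTrace P a v.1 w) :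
    w ∈ boundarySpace P a k Ψ := by
  obtain ⟨-, z, hz, hvz⟩ := v.2
  exact HasTrace.unique hP h hvz ▸ hz

/-- The trace map on the virtual element space. -/
theorem IsPolygonalElement.exists_trace {n : ℕ} {P : Set Plane} {a : Polygon Plane n}
    (hP : IsPolygonalElement P a) (k : ℕ) (Ψ : Submodule ℝ (Plane → ℝ)) :
    ∃ T : virtualSpace P a k Ψ →ₗ[ℝ] C(frontier P, ℝ),
      ∀ (v : virtualSpace P a k Ψ) (w : C(frontier P, ℝ)), HasTrace P a v.1 w ↔ T v = w := by
  have hex : ∀ v : virtualSpace P a k Ψ, ∃ w, HasTrace P a v.1 w := fun v => by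
    obtain ⟨-, w, -, hw⟩ := v.2
    exact ⟨w, hw⟩
  choose T hT using hex
  refine ⟨⟨⟨T, fun u v => ?_⟩, fun c v => ?_⟩, fun v w => ⟨fun h => HasTrace.unique hP (hT v) h, ?_⟩⟩
  · refine HasTrace.unique hP (hT (u + v)) ?_
    have := (hT u).smul_add (hT v) 1
    rw [one_smul] at this
    refine this.congr ?_
    filter_upwards [Lp.coeFn_add u.1 v.1] with x hx
    rw [one_mul]
    exact hx.symm
  · refine HasTrace.unique hP (hT (c • v)) ?_
    have := (hT v).smul_add (hasTrace_zero P a) c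
    rw [add_zero] at this
    refine this.congr ?_
    filter_upwards [Lp.coeFn_smul c v.1] with x hx
    rw [add_zero]
    exact hx.symm
  · rintro rfl
    exact hT v

theorem boundaryDofs_bijective {n : ℕ} {P : Set Plane} {a : Polygon Plane n}
    (hP : IsPolygonalElement P a) {k : ℕ} (hk : 1 ≤ k) {Ψ : Submodule ℝ (Plane → ℝ)}
    [FiniteDimensional ℝ Ψ] (hΨ : ∀ ψ ∈ Ψ, ContinuousOn ψ P) :
    Function.Bijective (fun w : boundarySpace P a k Ψ => boundaryDofs P a k Ψ w) := by
  obtain ⟨m, rfl⟩ : ∃ m, k = m + 1 := ⟨k - 1, by omega⟩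
  refine ⟨fun w z h => Subtype.ext (sub_eq_zero.1 ?_), fun d => ?_⟩
  · refine boundaryDofs_injOn hP (Submodule.sub_mem _ w.2 z.2) ?_
    rw [map_sub]
    exact sub_eq_zero.2 h
  · obtain ⟨w, hw, h⟩ := boundaryDofs_surjOn hP hΨ d
    exact ⟨⟨w, hw⟩, h⟩

/-- Equal boundary degrees of freedom force equal traces, so the difference has zero trace and zero
projection, and the energy identity applies to it. -/
theorem dofs_injective {n : ℕ} {P : Set Plane} {a : Polygon Plane n}
    (hP : IsPolygonalElement P a) {k : ℕ} (hk : 1 ≤ k) {Ψ : Submodule ℝ (Plane → ℝ)}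
    [FiniteDimensional ℝ Ψ] (hΨ : ∀ ψ ∈ Ψ, ContinuousOn ψ P)
    {T : virtualSpace P a k Ψ →ₗ[ℝ] C(frontier P, ℝ)}
    (hT : ∀ (v : virtualSpace P a k Ψ) (w : C(frontier P, ℝ)), HasTrace P a v.1 w ↔ T v = w) :
    Function.Injective (fun v : virtualSpace P a k Ψ => dofs P a k Ψ (v, T v)) := by
  intro u v h
  have hb : boundaryDofs P a k Ψ (T u) = boundaryDofs P a k Ψ (T v) := congrArg Prod.fst h
  have hm : (elementMomentSpace P k Ψ).orthogonalProjectionOnto u.1 =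
      (elementMomentSpace P k Ψ).orthogonalProjectionOnto v.1 := congrArg Prod.snd h
  have hmem : ∀ v, T v ∈ boundarySpace P a k Ψ := fun v =>
    mem_boundarySpace_of_hasTrace hP v ((hT v _).2 rfl)
  have hTuv : T u = T v := congrArg Subtype.val
    ((boundaryDofs_bijective hP hk hΨ).1 (a₁ := ⟨T u, hmem u⟩) (a₂ := ⟨T v, hmem v⟩) hb)
  have ht : HasTrace P a (u - v).1 0 := (hT (u - v) 0).2 (by rw [map_sub, hTuv, sub_self])
  obtain ⟨⟨f, hf, hL⟩, -⟩ := (u - v).2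
  have h0 := eq_zero_of_hasTrace_of_orthogonalProjection hP hf hL ht (by
    rw [Submodule.coe_sub, map_sub, hm, sub_self])
  exact sub_eq_zero.1 (Subtype.ext h0)

/-- The element moments can be prescribed without changing the trace. -/
theorem exists_dofs_eq {n : ℕ} {P : Set Plane} {a : Polygon Plane n}
    (hP : IsPolygonalElement P a) {k : ℕ} {Ψ : Submodule ℝ (Plane → ℝ)} [FiniteDimensional ℝ Ψ]
    {T : virtualSpace P a k Ψ →ₗ[ℝ] C(frontier P, ℝ)}
    (hT : ∀ (v : virtualSpace P a k Ψ) (w : C(frontier P, ℝ)), HasTrace P a v.1 w ↔ T v = w)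
    {w : C(frontier P, ℝ)} (hw : w ∈ LinearMap.range T) (s : elementMomentSpace P k Ψ) :
    ∃ v : virtualSpace P a k Ψ, dofs P a k Ψ (v, T v) = (boundaryDofs P a k Ψ w, s) := by
  obtain ⟨u, rfl⟩ := hw
  -- The missing moments are supplied by a zero-trace function, which leaves the boundary data of
  -- `u` untouched.
  obtain ⟨z, hz, hz0, hzs⟩ := exists_hasTrace_zero_orthogonalProjection_eq hP
    (elementMomentSpace P k Ψ) (s - (elementMomentSpace P k Ψ).orthogonalProjectionOnto u.1)
  let z' : virtualSpace P a k Ψ := ⟨z, hz, 0, Submodule.zero_mem _, hz0⟩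
  have hTz : T z' = 0 := (hT z' 0).1 hz0
  refine ⟨u + z', Prod.ext ?_ ?_⟩
  · change boundaryDofs P a k Ψ (T (u + z')) = _
    rw [map_add, hTz, add_zero]
  · change (elementMomentSpace P k Ψ).orthogonalProjectionOnto (u.1 + z) = s
    rw [map_add, hzs, add_sub_cancel]

/-- A harmonic extension has Laplacian `0`, which lies in the moment space, so it belongs to the
virtual element space. -/
theorem range_trace_eq {n : ℕ} {P : Set Plane} {a : Polygon Plane n}
    (hP : IsPolygonalElement P a) {k : ℕ} {Ψ : Submodule ℝ (Plane → ℝ)}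
    (hΨc : ∀ ψ ∈ Ψ, ContinuousOn ψ P) (hΨ : ∀ ψ ∈ Ψ, MemH1 P ψ) (hr : VertexRegular P a Ψ)
    {T : virtualSpace P a k Ψ →ₗ[ℝ] C(frontier P, ℝ)}
    (hT : ∀ (v : virtualSpace P a k Ψ) (w : C(frontier P, ℝ)), HasTrace P a v.1 w ↔ T v = w) :
    LinearMap.range T = boundarySpace P a k Ψ := by
  refine le_antisymm ?_ fun w hw => ?_
  · rintro _ ⟨v, rfl⟩
    exact mem_boundarySpace_of_hasTrace hP v ((hT v _).2 rfl)
  · obtain ⟨v, hv, hL, ht⟩ := hP.exists_harmonic_hasTrace hΨc hΨ hr hw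
    have ht' := ht.congr hv.coeFn_toLp.symm
    let v' : virtualSpace P a k Ψ := ⟨hv.toLp,
      ⟨0, Submodule.zero_mem _, hL.congr hv.coeFn_toLp.symm (Lp.coeFn_zero _ _ _).symm⟩, w, hw, ht'⟩
    exact ⟨v', (hT v' w).1 ht'⟩

theorem mainTheorem4 {n : ℕ} (P : Set Plane) (a : Polygon Plane n) (hP : IsPolygonalElement P a)
    (k : ℕ) (hk : 1 ≤ k) (Ψ : Submodule ℝ (Plane → ℝ)) [FiniteDimensional ℝ Ψ]
    (hΨ_cont : ∀ ψ ∈ Ψ, ContinuousOn ψ P)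
    (hΨ_H1 : ∀ ψ ∈ Ψ, MemH1 P ψ)
    (hΨ_lap : ∀ ψ ∈ Ψ, ∃ f, MemLp f 2 (areaMeasure P) ∧ HasWeakLaplacian P ψ f) :
    ∃ T : virtualSpace P a k Ψ →ₗ[ℝ] C(frontier P, ℝ),
      (∀ (v : virtualSpace P a k Ψ) (w : C(frontier P, ℝ)), HasTrace P a v.1 w ↔ T v = w) ∧
      LinearMap.range T ≤ boundarySpace P a k Ψ ∧
      Function.Bijective (fun w : boundarySpace P a k Ψ => boundaryDofs P a k Ψ w) ∧
      Function.Injective (fun v : virtualSpace P a k Ψ => dofs P a k Ψ (v, T v)) ∧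
      (∀ w ∈ LinearMap.range T, ∀ s : elementMomentSpace P k Ψ,
        ∃ v : virtualSpace P a k Ψ, dofs P a k Ψ (v, T v) = (boundaryDofs P a k Ψ w, s)) ∧
      (VertexRegular P a Ψ →
        LinearMap.range T = boundarySpace P a k Ψ ∧
        Function.Bijective (fun v : virtualSpace P a k Ψ => dofs P a k Ψ (v, T v))) := by
  obtain ⟨T, hT⟩ := hP.exists_trace k Ψ
  have hinj := dofs_injective hP hk hΨ_cont hT
  refine ⟨T, hT, ?_, boundaryDofs_bijective hP hk hΨ_cont, hinj,
    fun w hw s => exists_dofs_eq hP hT hw s, fun hr => ?_⟩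
  · rintro _ ⟨v, rfl⟩
    exact mem_boundarySpace_of_hasTrace hP v ((hT v _).2 rfl)
  have hrange := range_trace_eq hP hΨ_cont hΨ_H1 hr hT
  refine ⟨hrange, hinj, fun d => ?_⟩
  obtain ⟨w, hw⟩ := (boundaryDofs_bijective hP hk hΨ_cont).2 d.1
  -- The vertex condition is needed only here: it makes the interpolating boundary function `w` an
  -- actual trace.
  obtain ⟨v, hv⟩ := exists_dofs_eq hP hT (w := w) (hrange.ge w.2) d.2
  exact ⟨v, hv.trans (Prod.ext hw rfl)⟩
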